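/- Fix $\gamma\ge 1$ and $\alpha>0$, and put $f(u)=u^{\gamma}/(2\gamma)$. For each dimension $d$ let $C=C_d$ be a symmetric positive definite $d\times d$ matrix with eigenvalues $c_1,\dots,c_d$, let $\rho$ be the centred Gaussian law $\mathcal N(0,C_d)$ on $\mathbb R^d$, and let $n=n_d\ge 1$ be integers with $\frac1d\log n_d\to\alpha$. Assume that $\frac1d\operatorname{Tr}C_d$ is bounded and that the spectral distributions $\frac1d\sum_r\delta_{c_r}$ converge, in the sense of distributions, to a probability measure $\rho_C\neq\delta_0$. Let $K(x)=\exp\big(d\,[c-f(|x|^2/d)]\big)$ on $\mathbb R^d$, with $c=c_{\gamma,d}$ such that $\int K=1$, and for a bandwidth $h>0$ and data $\mathcal D=(y_1,\dots,y_n)$ drawn i.i.d. from $\rho$ let $$\hat\rho_h(x)=\frac1{n h^d}\sum_{i=1}^n K\Big(\frac{x-y_i}{h}\Big).$$ For $h,m>0$ the limit $$\overline g(h^2,m)=\lim_{d\to\infty}\frac1d\,\mathbb E_{x\sim\rho}\log \mathbb E_{y\sim\rho}\Big[K\Big(\frac{x-y}{h}\Big)^m\Big]-m\log h$$ exists. Let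 $\phi_{\alpha,h}(m)=\frac{1-m}{m}\alpha+\frac1m\overline g(h^2,m)$; it is differentiable at $m=1$, and $D(\alpha,h)=\partial_m\phi_{\alpha,h}(m)\big|_{m=1}$ vanishes for exactly one bandwidth $h=h_G(\alpha)>0$. There is a unique $\hat l>0$ with $$\alpha=\frac12\int\rho_C(d\lambda)\Big(\log(1+\lambda\hat l)-\frac{\lambda\hat l}{(1+\lambda\hat l)^2}\Big);$$ put $$l=\int\rho_C(d\lambda)\Big(\frac{\lambda}{1+\hat l\lambda}+\frac{\lambda}{(1+\hat l\lambda)^2}\Big),$$ and let $u^*>0$ be the unique solution of $2u^*f'(u^*)=1$. Then, for every $0<h<h_G(\alpha)$, the Kullback–Leibler divergence $D_{KL}(\rho\|\hat\rho_h)$ is finite for every data set, and, as $d\to\infty$, $$\frac1d D_{KL}(\rho\|\hat\rho_h)-\Big[\alpha-\frac1{2d}\operatorname{Tr}\log C_d+\frac12\log u^*-f(u^*)+\log h+f\Big(\frac{l}{h^2}\Big)\Big]\longrightarrow 0$$ in $L^1$ with respect to the law of the data $\mathcal D$. -/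

import Mathlib

open MeasureTheory ProbabilityTheory InformationTheory Filter Topology

namespace HighDimKDE

/-- The rate function `f_γ(u) = u ^ γ / (2 γ)` of the `γ`-kernel. -/
noncomputable def rate (γ u : ℝ) : ℝ := u ^ γ / (2 * γ)

/-- The unnormalised `γ`-kernel `exp (-d f_γ(|x|² / d))` on `ℝᵈ`. -/
noncomputable def kernelShape (γ : ℝ) {d : ℕ} (x : EuclideanSpace ℝ (Fin d)) : ℝ :=
  Real.exp (-((d : ℝ) * rate γ (‖x‖ ^ 2 / d)))

/-- The `γ`-kernel `K_γ(x) = exp (d [c - f_γ(|x|² / d)])`, where `c` (depending on `d` and `γ`) is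
the constant for which `K_γ` has integral one. -/
noncomputable def gammaKernel (γ : ℝ) {d : ℕ} (x : EuclideanSpace ℝ (Fin d)) : ℝ :=
  kernelShape γ x / ∫ z : EuclideanSpace ℝ (Fin d), kernelShape γ z

/-- The kernel density estimator `(1 / (n hᵈ)) ∑ᵢ K_γ((x - yᵢ) / h)` of the data set `y`. -/
noncomputable def kde (γ h : ℝ) {n d : ℕ} (y : Fin n → EuclideanSpace ℝ (Fin d))
    (x : EuclideanSpace ℝ (Fin d)) : ℝ :=
  1 / ((n : ℝ) * h ^ d) * ∑ i, gammaKernel γ (h⁻¹ • (x - y i))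

/-- The centred Gaussian law on `ℝᵈ` with covariance matrix `C`. -/
noncomputable def gaussianLaw {d : ℕ} (C : Matrix (Fin d) (Fin d) ℝ) :
    Measure (EuclideanSpace ℝ (Fin d)) :=
  multivariateGaussian 0 C

/-- The law of a data set of `n` independent points drawn from the centred Gaussian law. -/
noncomputable def dataLaw {d : ℕ} (n : ℕ) (C : Matrix (Fin d) (Fin d) ℝ) :
    Measure (Fin n → EuclideanSpace ℝ (Fin d)) :=
  Measure.pi fun _ => gaussianLaw C

/-- The Kullback-Leibler divergence of the Gaussian law from the law with density `kde γ h y`. -/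
noncomputable def klKde (γ h : ℝ) {n d : ℕ} (C : Matrix (Fin d) (Fin d) ℝ)
    (y : Fin n → EuclideanSpace ℝ (Fin d)) : ENNReal :=
  klDiv (gaussianLaw C) (volume.withDensity fun x => ENNReal.ofReal (kde γ h y x))

/-- `g(x, h², m) = (1 / d) log 𝔼_y [K_γ((x - y) / h) ^ m] - m log h`. -/
noncomputable def gFun (γ : ℝ) {d : ℕ} (C : Matrix (Fin d) (Fin d) ℝ) (h m : ℝ)
    (x : EuclideanSpace ℝ (Fin d)) : ℝ :=
  1 / (d : ℝ) * Real.log (∫ y, gammaKernel γ (h⁻¹ • (x - y)) ^ m ∂gaussianLaw C)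
    - m * Real.log h

/-- The mean of `g(x, h², m)` over `x` drawn from the Gaussian law. -/
noncomputable def gMean (γ : ℝ) {d : ℕ} (C : Matrix (Fin d) (Fin d) ℝ) (h m : ℝ) : ℝ :=
  ∫ x, gFun γ C h m x ∂gaussianLaw C

/-- The limit of the mean of `g(x, h², m)` as the dimension tends to infinity. -/
noncomputable def gBar (γ : ℝ) (C : ∀ d : ℕ, Matrix (Fin d) (Fin d) ℝ) (h m : ℝ) : ℝ :=
  limUnder atTop fun d : ℕ => gMean γ (C d) h m

/-- The replica free entropy `φ_{α,h}(m) = ((1 - m) / m) α + (1 / m) gBar(h², m)`. -/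
noncomputable def replicaFreeEntropy (γ α : ℝ) (C : ∀ d : ℕ, Matrix (Fin d) (Fin d) ℝ)
    (h m : ℝ) : ℝ :=
  (1 - m) / m * α + 1 / m * gBar γ C h m

/-- `D(α, h)`, the derivative of the replica free entropy in `m` at `m = 1`. -/
noncomputable def glassD (γ α : ℝ) (C : ∀ d : ℕ, Matrix (Fin d) (Fin d) ℝ) (h : ℝ) : ℝ :=
  deriv (fun m => replicaFreeEntropy γ α C h m) 1

/-- The trace of `log C` for a positive definite matrix `C`. -/
noncomputable def traceLog {d : ℕ} {C : Matrix (Fin d) (Fin d) ℝ} (hC : C.PosDef) : ℝ :=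
  ∑ i, Real.log (hC.isHermitian.eigenvalues i)

/-- The normalised eigenvalue counting measures `(1 / d) ∑ᵣ δ_{cᵣ}` of `C d` converge to `ρC` in the
sense of distributions. -/
def SpectralLimit {C : ∀ d : ℕ, Matrix (Fin d) (Fin d) ℝ} (hC : ∀ d, (C d).PosDef)
    (ρC : Measure ℝ) : Prop :=
  ∀ φ : ℝ → ℝ, ContDiff ℝ ((⊤ : ℕ∞) : WithTop ℕ∞) φ → HasCompactSupport φ →
    Tendsto (fun d : ℕ => 1 / (d : ℝ) * ∑ i, φ ((hC d).isHermitian.eigenvalues i)) atTop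
      (𝓝 (∫ c, φ c ∂ρC))

/-- `(1 / 2) ∫ (log (1 + t c) - t c / (1 + t c)²) dρC(c)`. -/
noncomputable def alphaOf (ρC : Measure ℝ) (t : ℝ) : ℝ :=
  1 / 2 * ∫ c, (Real.log (1 + t * c) - t * c / (1 + t * c) ^ 2) ∂ρC

/-- `∫ (c / (1 + t c) + c / (1 + t c)²) dρC(c)`. -/
noncomputable def lOf (ρC : Measure ℝ) (t : ℝ) : ℝ :=
  ∫ c, (c / (1 + t * c) + c / (1 + t * c) ^ 2) ∂ρC

end HighDimKDE

/-! The argument is a random energy model computation. Fix a test point `x` and let `y` be Gaussian.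
In the eigenbasis of `C` the logarithm of `𝔼_y exp(-t|x-y|²/2)` is an explicit quadratic form in the
coordinates of `x`. Divided by `d`, it has variance at most `sqVar / d` whatever the spectrum, and
converges in `L¹` to `-psiOf ρC t` (`SpectralLimit.tendsto_log_laplace`). Since `psiOf` has
derivative `lOf / 2`, tilting by `t` moves `|x-y|²/d` to `lOf ρC t`, and the probability of coming
that close is about `exp(-d alphaOf ρC t)`, with `alphaOf = psiOf - (t/2) lOf` the Legendre
transform (`SpectralLimit.small_ball`). As `t` grows the distance decreases and the cost increases.
With `n ≈ exp(dα)` data points the nearest one sits where the cost equals `α`, that is at tilt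
`lhat` and normalised squared distance `l = lOf ρC lhat`.

The rate `f` is convex because `γ ≥ 1`, so a power `m` of the kernel lies below the exponential of
an affine function of `|x-y|²`. Chernoff at the saddle point `t = (m / h^(2γ)) l(t)^(γ-1)`, matched
with the small ball lower bound, gives `gBar` in closed form. By an envelope argument its
`m`-derivative involves only the rate at the saddle, and `D(α,h) = alphaOf(t) - α`, where `t` is the
saddle for `m = 1`. This vanishes exactly when that saddle is `lhat`, that is when `h^(2γ) = l^(γ-1)
/ lhat`.

The divergence equals explicit Gaussian and kernel entropy terms minus the mean over `x` of `log ∑ᵢ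
exp(-d f(|x-yᵢ|²/(d h²)))`. It remains to prove that this logarithm, divided by `d`, tends to
`-f(l/h²)` in `L¹` (`SpectralLimit.tendsto_integral_abs_log_expSum`). From below, keep the nearest
point, which is within `l + o(1)` with probability tending to one; uniform integrability handles the
exception. From above, for `h < h_G` the number `θ = (h/h_G)^(2γ) < 1` makes `lhat` the saddle for
`m = θ`. Lowering the inverse temperature through `log ∑ e^u ≤ θ⁻¹ log ∑ e^(θu)` and then applying
Jensen gives exactly `-f(l/h²)`, because the entropy `α` and the cost `alphaOf ρC lhat` cancel. -/

namespace HighDimKDE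

/-! ### One-dimensional Gaussian integrals. -/

section OneDimensional

/-- Completing the square turns the weighted density into a constant multiple of the Gaussian
density with mean `tvx/(1+tv)` and variance `v/(1+tv)`. -/
lemma integral_exp_neg_sq_sub_gaussianReal {v t : ℝ} (hv : 0 < v) (ht : 0 < t) (x : ℝ) :
    ∫ y, Real.exp (-(t / 2 * (x - y) ^ 2)) ∂gaussianReal 0 v.toNNReal
      = Real.exp (-(1 / 2 * (Real.log (1 + t * v) + t * x ^ 2 / (1 + t * v)))) := by
  have hv0 : v.toNNReal ≠ 0 := by simpa using hv
  have h1 : 0 < 1 + t * v := by positivity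
  have hw : 0 < v / (1 + t * v) := by positivity
  have hw0 : (v / (1 + t * v)).toNNReal ≠ 0 := by simpa using hw
  rw [integral_gaussianReal_eq_integral_smul hv0]
  have key : ∀ y, gaussianPDFReal 0 v.toNNReal y • Real.exp (-(t / 2 * (x - y) ^ 2))
      = Real.exp (-(1 / 2 * (Real.log (1 + t * v) + t * x ^ 2 / (1 + t * v))))
        * gaussianPDFReal (t * v * x / (1 + t * v)) (v / (1 + t * v)).toNNReal y := by
    intro y
    have h2 : Real.exp (-(1 / 2 * Real.log (1 + t * v))) = (√(1 + t * v))⁻¹ := by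
      rw [Real.sqrt_eq_rpow, Real.rpow_def_of_pos h1, ← Real.exp_neg]; ring_nf
    rw [mul_add, neg_add, Real.exp_add, h2]
    simp only [gaussianPDFReal, Real.coe_toNNReal _ hv.le, Real.coe_toNNReal _ hw.le, smul_eq_mul]
    have h3 : √(2 * Real.pi * v) = √(1 + t * v) * √(2 * Real.pi * (v / (1 + t * v))) := by
      rw [← Real.sqrt_mul h1.le]; congr 1; field_simp
    rw [h3, mul_inv]
    have h4 : Real.exp (-(y - 0) ^ 2 / (2 * v)) * Real.exp (-(t / 2 * (x - y) ^ 2))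
        = Real.exp (-(1 / 2 * (t * x ^ 2 / (1 + t * v))))
          * Real.exp (-(y - t * v * x / (1 + t * v)) ^ 2 / (2 * (v / (1 + t * v)))) := by
      rw [← Real.exp_add, ← Real.exp_add]; congr 1; field_simp; ring
    linear_combination ((√(1 + t * v))⁻¹ * (√(2 * Real.pi * (v / (1 + t * v))))⁻¹) * h4
  simp_rw [key]
  rw [integral_const_mul, integral_gaussianPDFReal_eq_one _ hw0, mul_one]

lemma gaussianReal_eq_map_std {v : ℝ} (hv : 0 ≤ v) :
    gaussianReal 0 v.toNNReal = (gaussianReal 0 1).map (√v * ·) := by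
  rw [gaussianReal_map_const_mul]
  congr 1
  · simp
  · ext; simp [Real.sq_sqrt hv, hv]

lemma integral_gaussianReal_eq_std {v : ℝ} (hv : 0 < v) (φ : ℝ → ℝ) :
    ∫ y, φ y ∂gaussianReal 0 v.toNNReal = ∫ z, φ (√v * z) ∂gaussianReal 0 1 := by
  rw [gaussianReal_eq_map_std hv.le]
  exact (MeasurableEquiv.mulLeft₀ (√v) (Real.sqrt_pos.2 hv).ne').measurableEmbedding.integral_map φ

lemma integrable_abs_rpow_gaussianReal (v : NNReal) {p : ℝ} (hp : 0 ≤ p) :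
    Integrable (fun z : ℝ => |z| ^ p) (gaussianReal 0 v) := by
  have h := (memLp_id_gaussianReal (μ := 0) (v := v) p.toNNReal).integrable_norm_rpow'
  simpa [Real.coe_toNNReal _ hp] using h

lemma memLp_sq_gaussianReal (v : NNReal) :
    MemLp (fun z : ℝ => z ^ 2) 2 (gaussianReal 0 v) := by
  rw [memLp_two_iff_integrable_sq (by fun_prop)]
  have h := integrable_abs_rpow_gaussianReal v (p := 4) (by norm_num)
  refine h.congr (ae_of_all _ fun z => ?_)
  have : |z| ^ (4 : ℝ) = |z| ^ 4 := by exact_mod_cast Real.rpow_natCast |z| 4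
  simp only [this]
  rw [show (z ^ 2) ^ 2 = z ^ 4 by ring, ← abs_pow]
  exact abs_of_nonneg (by positivity)

lemma integral_sq_gaussianReal {v : ℝ} (hv : 0 ≤ v) :
    ∫ z, z ^ 2 ∂gaussianReal 0 v.toNNReal = v := by
  have h := variance_id_gaussianReal (μ := 0) (v := v.toNNReal)
  rw [variance_eq_integral (by fun_prop)] at h
  simpa [Real.coe_toNNReal _ hv] using h

/-- The variance of the square of a standard Gaussian variable. -/
noncomputable def sqVar : ℝ := Var[fun z : ℝ => z ^ 2; gaussianReal 0 1]

lemma sqVar_nonneg : 0 ≤ sqVar := variance_nonneg _ _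

lemma variance_sq_gaussianReal {v : ℝ} (hv : 0 ≤ v) :
    Var[fun z : ℝ => z ^ 2; gaussianReal 0 v.toNNReal] = v ^ 2 * sqVar := by
  rw [gaussianReal_eq_map_std hv, variance_map (by fun_prop) (by fun_prop)]
  have : ((fun z : ℝ => z ^ 2) ∘ fun z => √v * z) = fun z => v * z ^ 2 := by
    ext z; simp [mul_pow, Real.sq_sqrt hv]
  rw [this, variance_const_mul, sqVar]

end OneDimensional

/-! ### Reduction to independent coordinates in the eigenbasis. -/

section Diagonalisation

variable {d : ℕ} {A : Matrix (Fin d) (Fin d) ℝ}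

/-- The product of centred Gaussian laws with variances `c i`. -/
noncomputable def diagGaussian (c : Fin d → ℝ) : Measure (Fin d → ℝ) :=
  Measure.pi fun i => gaussianReal 0 (c i).toNNReal

instance (c : Fin d → ℝ) : IsProbabilityMeasure (diagGaussian c) := by
  unfold diagGaussian; infer_instance

instance : IsProbabilityMeasure (gaussianLaw A) := by
  unfold gaussianLaw; infer_instance

instance (n : ℕ) : IsProbabilityMeasure (dataLaw n A) := by
  unfold dataLaw; infer_instance

/-- The eigenvalues of a positive definite matrix. -/
noncomputable abbrev eig (hA : A.PosDef) : Fin d → ℝ := hA.isHermitian.eigenvalues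

lemma eig_pos (hA : A.PosDef) (i : Fin d) : 0 < eig hA i := hA.eigenvalues_pos i

lemma sum_eig (hA : A.PosDef) : ∑ i, eig hA i = A.trace := by
  simpa using hA.isHermitian.trace_eq_sum_eigenvalues.symm

/-- The isometry from coordinates to vectors given by the eigenvector basis. -/
noncomputable def eigEquiv (hA : A.PosDef) : (Fin d → ℝ) ≃ᵐ EuclideanSpace ℝ (Fin d) :=
  (MeasurableEquiv.toLp 2 (Fin d → ℝ)).trans
    hA.isHermitian.eigenvectorBasis.repr.symm.toHomeomorph.toMeasurableEquiv

lemma eigEquiv_apply (hA : A.PosDef) (z : Fin d → ℝ) :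
    eigEquiv hA z = hA.isHermitian.eigenvectorBasis.repr.symm (WithLp.toLp 2 z) := rfl

lemma norm_eigEquiv_sub_sq (hA : A.PosDef) (z w : Fin d → ℝ) :
    ‖eigEquiv hA z - eigEquiv hA w‖ ^ 2 = ∑ i, (z i - w i) ^ 2 := by
  rw [eigEquiv_apply, eigEquiv_apply, ← map_sub, LinearIsometryEquiv.norm_map,
    EuclideanSpace.real_norm_sq_eq]
  simp

lemma norm_eigEquiv_sq (hA : A.PosDef) (z : Fin d → ℝ) :
    ‖eigEquiv hA z‖ ^ 2 = ∑ i, z i ^ 2 := by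
  rw [eigEquiv_apply, LinearIsometryEquiv.norm_map, EuclideanSpace.real_norm_sq_eq]

lemma measurePreserving_eigEquiv (hA : A.PosDef) :
    MeasurePreserving (eigEquiv hA) volume volume :=
  hA.isHermitian.eigenvectorBasis.measurePreserving_repr_symm.comp
    (PiLp.volume_preserving_toLp (Fin d))

lemma dotProduct_mulVec_eq_sum_eig (hA : A.PosDef) (x : EuclideanSpace ℝ (Fin d)) :
    x ⬝ᵥ A.mulVec x
      = ∑ i, eig hA i * (hA.isHermitian.eigenvectorBasis.repr x i) ^ 2 := by
  set b := hA.isHermitian.eigenvectorBasis with hb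
  have h1 : ∀ y : EuclideanSpace ℝ (Fin d), inner ℝ y (A.toEuclideanLin x)
      = y.ofLp ⬝ᵥ A.mulVec x.ofLp := by
    intro y
    simp [PiLp.inner_apply, dotProduct, Matrix.toLpLin_apply, mul_comm]
  have h2 : A.toEuclideanLin x = ∑ i, (b.repr x i * eig hA i) • b i := by
    conv_lhs => rw [← b.sum_repr x]
    rw [map_sum]
    refine Finset.sum_congr rfl fun i _ => ?_
    rw [map_smul, mul_smul]
    congr 1
    ext j
    have := congrFun (hA.isHermitian.mulVec_eigenvectorBasis i) j
    simpa [Matrix.toLpLin_apply] using this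
  rw [← h1, h2, inner_sum]
  refine Finset.sum_congr rfl fun i _ => ?_
  rw [inner_smul_right, real_inner_comm, ← b.repr_apply_apply]
  ring

/-- The characteristic functions agree, the quadratic form of `A` being diagonal in the eigenbasis.
Gaussian expectations thereby become integrals over a product of one-dimensional laws. -/
lemma gaussianLaw_eq_map (hA : A.PosDef) :
    gaussianLaw A = (diagGaussian (eig hA)).map (eigEquiv hA) := by
  have : IsProbabilityMeasure ((diagGaussian (eig hA)).map (eigEquiv hA)) :=
    Measure.isProbabilityMeasure_map (eigEquiv hA).measurable.aemeasurable
  apply Measure.ext_of_charFun (E := EuclideanSpace ℝ (Fin d))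
  ext t
  set b := hA.isHermitian.eigenvectorBasis with hb
  rw [gaussianLaw, charFun_multivariateGaussian hA.posSemidef, dotProduct_mulVec_eq_sum_eig hA]
  have h1 : charFun ((diagGaussian (eig hA)).map (eigEquiv hA)) t
      = charFun ((diagGaussian (eig hA)).map (WithLp.toLp 2)) (b.repr t) := by
    have h2 := (MeasurableEquiv.toLp 2 (Fin d → ℝ)).measurableEmbedding.integral_map
      (μ := diagGaussian (eig hA))
      (fun y : EuclideanSpace ℝ (Fin d) => Complex.exp (↑(inner ℝ y (b.repr t)) * Complex.I))
    rw [charFun_apply, charFun_apply, (eigEquiv hA).measurableEmbedding.integral_map]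
    refine Eq.trans ?_ h2.symm
    congr 1; ext z
    rw [eigEquiv_apply]
    congr 3
    rw [← b.repr.inner_map_map, LinearIsometryEquiv.apply_symm_apply]
    rfl
  rw [h1, diagGaussian, charFun_pi]
  simp_rw [charFun_gaussianReal, ← Complex.exp_sum]
  congr 1
  simp only [inner_zero_right, Complex.ofReal_zero, zero_mul, zero_sub, mul_zero]
  rw [Complex.ofReal_sum, Finset.sum_div, ← Finset.sum_neg_distrib]
  refine Finset.sum_congr rfl fun i _ => ?_
  rw [Real.coe_toNNReal _ (eig_pos hA i).le]
  push_cast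
  ring

lemma integral_gaussianLaw {E : Type*} [NormedAddCommGroup E] [NormedSpace ℝ E] (hA : A.PosDef)
    (φ : EuclideanSpace ℝ (Fin d) → E) :
    ∫ x, φ x ∂gaussianLaw A = ∫ z, φ (eigEquiv hA z) ∂diagGaussian (eig hA) := by
  rw [gaussianLaw_eq_map hA, (eigEquiv hA).measurableEmbedding.integral_map]

lemma integrable_gaussianLaw_iff {E : Type*} [NormedAddCommGroup E] (hA : A.PosDef)
    (φ : EuclideanSpace ℝ (Fin d) → E) :
    Integrable φ (gaussianLaw A) ↔
      Integrable (fun z => φ (eigEquiv hA z)) (diagGaussian (eig hA)) := by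
  rw [gaussianLaw_eq_map hA, (eigEquiv hA).measurableEmbedding.integrable_map_iff]; rfl

end Diagonalisation

/-! ### Gaussian density and entropy. -/

section Density

variable {d : ℕ} {A : Matrix (Fin d) (Fin d) ℝ}

/-- The density of `diagGaussian c`. -/
noncomputable def diagPDF (c : Fin d → ℝ) (z : Fin d → ℝ) : ℝ :=
  ∏ i, gaussianPDFReal 0 (c i).toNNReal (z i)

lemma diagPDF_pos {c : Fin d → ℝ} (hc : ∀ i, 0 < c i) (z : Fin d → ℝ) : 0 < diagPDF c z :=
  Finset.prod_pos fun i _ => gaussianPDFReal_pos _ _ _ (by simpa using hc i)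

lemma measurable_diagPDF (c : Fin d → ℝ) : Measurable (diagPDF c) := by
  unfold diagPDF
  exact Finset.measurable_prod _ fun i _ =>
    (measurable_gaussianPDFReal 0 _).comp (measurable_pi_apply i)

lemma diagGaussian_eq_withDensity {c : Fin d → ℝ} (hc : ∀ i, 0 < c i) :
    diagGaussian c = volume.withDensity fun z => ENNReal.ofReal (diagPDF c z) := by
  refine (Measure.pi_eq fun s hs => ?_)
  rw [withDensity_apply _ (MeasurableSet.univ_pi hs), volume_pi, Measure.restrict_pi_pi]
  have hint : Integrable (diagPDF c) (Measure.pi fun i => volume.restrict (s i)) :=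
    Integrable.fintype_prod (f := fun i => gaussianPDFReal 0 (c i).toNNReal)
      fun i => (integrable_gaussianPDFReal 0 _).restrict
  rw [← ofReal_integral_eq_lintegral_ofReal hint (ae_of_all _ fun z => (diagPDF_pos hc z).le)]
  unfold diagPDF
  rw [integral_fintype_prod_eq_prod (fun i => gaussianPDFReal 0 (c i).toNNReal),
    ENNReal.ofReal_prod_of_nonneg
      fun i _ => integral_nonneg fun z => gaussianPDFReal_nonneg _ _ _]
  refine Finset.prod_congr rfl fun i _ => ?_
  rw [gaussianReal_apply_eq_integral _ (by simpa using hc i)]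

lemma log_diagPDF {c : Fin d → ℝ} (hc : ∀ i, 0 < c i) (z : Fin d → ℝ) :
    Real.log (diagPDF c z)
      = ∑ i, (-(1 / 2) * Real.log (2 * Real.pi) - 1 / 2 * Real.log (c i)
        - z i ^ 2 / (2 * c i)) := by
  rw [diagPDF, Real.log_prod fun i _ => (gaussianPDFReal_pos _ _ _ (by simpa using hc i)).ne']
  refine Finset.sum_congr rfl fun i _ => ?_
  have h := hc i
  rw [gaussianPDFReal, Real.coe_toNNReal _ h.le, Real.log_mul (by positivity) (by positivity),
    Real.log_exp, Real.log_inv, Real.log_sqrt (by positivity),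
    Real.log_mul (by positivity) h.ne']
  ring

lemma integrable_sq_diagGaussian (c : Fin d → ℝ) (i : Fin d) :
    Integrable (fun z => z i ^ 2) (diagGaussian c) :=
  integrable_comp_eval (μ := fun i => gaussianReal 0 (c i).toNNReal) (f := fun y : ℝ => y ^ 2)
    ((memLp_sq_gaussianReal _).integrable (by norm_num))

lemma integral_sq_diagGaussian {c : Fin d → ℝ} (hc : ∀ i, 0 < c i) (i : Fin d) :
    ∫ z, z i ^ 2 ∂diagGaussian c = c i := by
  rw [diagGaussian, integral_comp_eval (μ := fun i => gaussianReal 0 (c i).toNNReal)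
    (f := fun y : ℝ => y ^ 2) (by fun_prop), integral_sq_gaussianReal (hc i).le]

lemma integrable_log_diagPDF {c : Fin d → ℝ} (hc : ∀ i, 0 < c i) :
    Integrable (fun z => Real.log (diagPDF c z)) (diagGaussian c) := by
  simp_rw [log_diagPDF hc]
  exact integrable_finsetSum _ fun i _ =>
    (integrable_const _).sub ((integrable_sq_diagGaussian c i).div_const _)

lemma integral_log_diagPDF {c : Fin d → ℝ} (hc : ∀ i, 0 < c i) :
    ∫ z, Real.log (diagPDF c z) ∂diagGaussian c
      = -((d : ℝ) / 2) * (Real.log (2 * Real.pi) + 1) - 1 / 2 * ∑ i, Real.log (c i) := by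
  simp_rw [log_diagPDF hc]
  have hint : ∀ i ∈ Finset.univ, Integrable (fun z : Fin d → ℝ => -(1 / 2) * Real.log (2 * Real.pi)
      - 1 / 2 * Real.log (c i) - z i ^ 2 / (2 * c i)) (diagGaussian c) := fun i _ =>
    (integrable_const _).sub ((integrable_sq_diagGaussian c i).div_const _)
  rw [integral_finsetSum _ hint]
  have : ∀ i, ∫ z, (-(1 / 2) * Real.log (2 * Real.pi) - 1 / 2 * Real.log (c i)
      - z i ^ 2 / (2 * c i)) ∂diagGaussian c
      = -(1 / 2) * (Real.log (2 * Real.pi) + 1) - 1 / 2 * Real.log (c i) := by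
    intro i
    rw [integral_sub (integrable_const _) ((integrable_sq_diagGaussian c i).div_const _),
      integral_div, integral_sq_diagGaussian hc]
    have := (hc i).ne'
    simp
    field_simp
    ring
  simp_rw [this]
  simp only [Finset.sum_sub_distrib, Finset.sum_const, Finset.card_univ, Fintype.card_fin,
    nsmul_eq_mul, ← Finset.mul_sum]
  ring

/-- The density of the Gaussian law. -/
noncomputable def gaussianDensity (hA : A.PosDef) (x : EuclideanSpace ℝ (Fin d)) : ℝ :=
  diagPDF (eig hA) ((eigEquiv hA).symm x)

lemma gaussianDensity_pos (hA : A.PosDef) (x : EuclideanSpace ℝ (Fin d)) :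
    0 < gaussianDensity hA x := diagPDF_pos (eig_pos hA) _

lemma measurable_gaussianDensity (hA : A.PosDef) : Measurable (gaussianDensity hA) :=
  (measurable_diagPDF _).comp (eigEquiv hA).symm.measurable

/-- The eigenbasis map is an isometry and hence preserves Lebesgue measure, so no Jacobian appears.
-/
lemma gaussianLaw_eq_withDensity (hA : A.PosDef) :
    gaussianLaw A = volume.withDensity fun x => ENNReal.ofReal (gaussianDensity hA x) := by
  ext s hs
  rw [gaussianLaw_eq_map hA, diagGaussian_eq_withDensity (eig_pos hA),
    (eigEquiv hA).map_apply, withDensity_apply _ ((eigEquiv hA).measurable hs),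
    withDensity_apply _ hs, ← (measurePreserving_eigEquiv hA).setLIntegral_comp_preimage hs
      (measurable_gaussianDensity hA).ennreal_ofReal]
  simp [gaussianDensity]

lemma integrable_log_gaussianDensity (hA : A.PosDef) :
    Integrable (fun x => Real.log (gaussianDensity hA x)) (gaussianLaw A) := by
  rw [integrable_gaussianLaw_iff hA]
  simpa [gaussianDensity] using integrable_log_diagPDF (eig_pos hA)

lemma integral_log_gaussianDensity (hA : A.PosDef) :
    ∫ x, Real.log (gaussianDensity hA x) ∂gaussianLaw A
      = -((d : ℝ) / 2) * (Real.log (2 * Real.pi) + 1) - 1 / 2 * traceLog hA := by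
  rw [integral_gaussianLaw hA]
  simpa [gaussianDensity, traceLog] using integral_log_diagPDF (eig_pos hA)

end Density

/-! ### Laplace transform of the squared distance and its concentration. -/

section Laplace

variable {d : ℕ} {A : Matrix (Fin d) (Fin d) ℝ}

/-- The Laplace transform at `t / 2` of the squared distance from `x` to a Gaussian point. -/
noncomputable def laplace (A : Matrix (Fin d) (Fin d) ℝ) (t : ℝ) (x : EuclideanSpace ℝ (Fin d)) :
    ℝ :=
  ∫ y, Real.exp (-(t / 2 * ‖x - y‖ ^ 2)) ∂gaussianLaw A

/-- The integrand of the limiting exponent of the Laplace transform. -/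
noncomputable def psiFun (t c : ℝ) : ℝ := 1 / 2 * (Real.log (1 + t * c) + t * c / (1 + t * c))

lemma integrable_exp_neg_sq_dist (A : Matrix (Fin d) (Fin d) ℝ) {t : ℝ} (ht : 0 ≤ t)
    (x : EuclideanSpace ℝ (Fin d)) :
    Integrable (fun y => Real.exp (-(t / 2 * ‖x - y‖ ^ 2))) (gaussianLaw A) := by
  refine Integrable.of_bound (by fun_prop) 1 (ae_of_all _ fun y => ?_)
  rw [Real.norm_eq_abs, Real.abs_exp, Real.exp_le_one_iff]
  have : 0 ≤ t / 2 * ‖x - y‖ ^ 2 := by positivity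
  linarith

/-- Independence factorises the expectation, so the logarithm is an exact sum over eigenvalues,
quadratic in the test point. -/
lemma log_laplace_eigEquiv (hA : A.PosDef) {t : ℝ} (ht : 0 < t) (z : Fin d → ℝ) :
    Real.log (laplace A t (eigEquiv hA z))
      = -∑ i, 1 / 2 * (Real.log (1 + t * eig hA i) + t * z i ^ 2 / (1 + t * eig hA i)) := by
  have h : laplace A t (eigEquiv hA z)
      = ∏ i, Real.exp (-(1 / 2 * (Real.log (1 + t * eig hA i)
        + t * z i ^ 2 / (1 + t * eig hA i)))) := by
    rw [laplace, integral_gaussianLaw hA]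
    simp_rw [norm_eigEquiv_sub_sq, Finset.mul_sum, ← Finset.sum_neg_distrib, Real.exp_sum]
    rw [diagGaussian, integral_fintype_prod_eq_prod
      (f := fun i y => Real.exp (-(t / 2 * (z i - y) ^ 2)))]
    exact Finset.prod_congr rfl fun i _ =>
      integral_exp_neg_sq_sub_gaussianReal (eig_pos hA i) ht (z i)
  rw [h, ← Real.exp_sum, Real.log_exp, Finset.sum_neg_distrib]

lemma laplace_pos (A : Matrix (Fin d) (Fin d) ℝ) {t : ℝ} (ht : 0 ≤ t)
    (x : EuclideanSpace ℝ (Fin d)) : 0 < laplace A t x :=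
  integral_exp_pos (integrable_exp_neg_sq_dist A ht x)

/-- The centred quadratic fluctuation of the logarithm of the Laplace transform. -/
lemma log_laplace_fluctuation (hA : A.PosDef) {t : ℝ} (ht : 0 < t) (z : Fin d → ℝ) :
    1 / (d : ℝ) * Real.log (laplace A t (eigEquiv hA z)) + 1 / (d : ℝ) * ∑ i, psiFun t (eig hA i)
      = ∑ i, (-(1 / (d : ℝ) * (t / 2 / (1 + t * eig hA i)))) * (z i ^ 2 - eig hA i) := by
  rw [log_laplace_eigEquiv hA ht, ← mul_add, ← sub_eq_neg_add, ← Finset.sum_sub_distrib,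
    Finset.mul_sum]
  refine Finset.sum_congr rfl fun i _ => ?_
  have : 0 < 1 + t * eig hA i := by have := eig_pos hA i; positivity
  rw [psiFun]
  field_simp
  ring

lemma memLp_quadratic (c a : Fin d → ℝ) :
    MemLp (fun z => ∑ i, a i * (z i ^ 2 - c i)) 2 (diagGaussian c) := by
  refine memLp_finsetSum _ fun i _ => MemLp.const_mul (MemLp.sub ?_ (memLp_const _)) _
  exact (memLp_sq_gaussianReal (c i).toNNReal).comp_measurePreserving
    (measurePreserving_eval (fun i => gaussianReal 0 (c i).toNNReal) i)

/-- The quadratic form is centred, so its first absolute moment is at most its standard deviation,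
and variances add over independent coordinates. -/
lemma integral_abs_quadratic_le {c : Fin d → ℝ} (hc : ∀ i, 0 < c i) (a : Fin d → ℝ) :
    ∫ z, |∑ i, a i * (z i ^ 2 - c i)| ∂diagGaussian c
      ≤ √(∑ i, (a i * c i) ^ 2 * sqVar) := by
  set Y : (Fin d → ℝ) → ℝ := fun z => ∑ i, a i * (z i ^ 2 - c i) with hY
  have hm : MemLp Y 2 (diagGaussian c) := memLp_quadratic c a
  have hmean : ∫ z, Y z ∂diagGaussian c = 0 := by
    have hint : ∀ i ∈ Finset.univ,
        Integrable (fun z : Fin d → ℝ => a i * (z i ^ 2 - c i)) (diagGaussian c) := fun i _ =>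
      ((integrable_sq_diagGaussian c i).sub (integrable_const (c i))).const_mul (a i)
    simp only [hY]
    rw [integral_finsetSum _ hint]
    refine Finset.sum_eq_zero fun i _ => ?_
    rw [integral_const_mul, integral_sub (integrable_sq_diagGaussian c i) (integrable_const _),
      integral_sq_diagGaussian hc]
    simp
  have hvar : Var[Y; diagGaussian c] = ∑ i, (a i * c i) ^ 2 * sqVar := by
    have h1 : Y = ∑ i, fun z : Fin d → ℝ => a i * (z i ^ 2 - c i) := by
      ext z; simp [hY]
    rw [h1, diagGaussian, variance_sum_pi (X := fun i y => a i * (y ^ 2 - c i))]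
    · refine Finset.sum_congr rfl fun i _ => ?_
      rw [variance_const_mul, variance_sub_const (by fun_prop), variance_sq_gaussianReal (hc i).le]
      ring
    · exact fun i => MemLp.const_mul (MemLp.sub (memLp_sq_gaussianReal _) (memLp_const _)) _
  have h2 : ∫ z, Y z ^ 2 ∂diagGaussian c = ∑ i, (a i * c i) ^ 2 * sqVar := by
    rw [← hvar, variance_of_integral_eq_zero hm.aemeasurable hmean]
  -- Nonnegativity of the variance of `|Y|` is the Cauchy–Schwarz bound `(𝔼|Y|)² ≤ 𝔼 Y²`.
  have h3 := variance_nonneg |Y| (diagGaussian c)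
  rw [variance_eq_sub hm.abs] at h3
  refine Real.le_sqrt_of_sq_le ?_
  rw [← h2]
  have h4 : (∫ z, (|Y| ^ 2) z ∂diagGaussian c) = ∫ z, Y z ^ 2 ∂diagGaussian c := by
    simp
  rw [h4] at h3
  simpa using h3

lemma integrable_log_laplace (hA : A.PosDef) {t : ℝ} (ht : 0 < t) :
    Integrable (fun x => 1 / (d : ℝ) * Real.log (laplace A t x)) (gaussianLaw A) := by
  rw [integrable_gaussianLaw_iff hA]
  have h := ((memLp_quadratic (eig hA)
    (fun i => -(1 / (d : ℝ) * (t / 2 / (1 + t * eig hA i))))).integrable (by norm_num)).sub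
    (integrable_const (1 / (d : ℝ) * ∑ i, psiFun t (eig hA i)))
  refine h.congr (ae_of_all _ fun z => ?_)
  simp only [Pi.sub_apply, ← log_laplace_fluctuation hA ht]
  ring

/-- Each coefficient times its eigenvalue is at most `1/d` in absolute value, because `(t/2)c ≤ 1 +
tc`. The bound is therefore free of the spectrum, and no control of the largest eigenvalue is
needed. -/
lemma integral_abs_log_laplace_le (hA : A.PosDef) {t : ℝ} (ht : 0 < t) :
    ∫ x, |1 / (d : ℝ) * Real.log (laplace A t x) + 1 / (d : ℝ) * ∑ i, psiFun t (eig hA i)|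
      ∂gaussianLaw A ≤ √(sqVar / d) := by
  rw [integral_gaussianLaw hA]
  simp_rw [log_laplace_fluctuation hA ht]
  refine (integral_abs_quadratic_le (eig_pos hA) _).trans (Real.sqrt_le_sqrt ?_)
  rcases Nat.eq_zero_or_pos d with rfl | hd
  · simp
  have hd' : (0 : ℝ) < d := by exact_mod_cast hd
  calc _ ≤ ∑ i : Fin d, (1 / (d : ℝ)) ^ 2 * sqVar := by
        refine Finset.sum_le_sum fun i _ => mul_le_mul_of_nonneg_right ?_ sqVar_nonneg
        have hc := eig_pos hA i
        have h1 : 0 < 1 + t * eig hA i := by positivity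
        rw [neg_mul, neg_sq, mul_assoc, mul_pow]
        refine mul_le_of_le_one_right (by positivity) ?_
        have h2 : t / 2 / (1 + t * eig hA i) * eig hA i ≤ 1 := by
          rw [div_mul_eq_mul_div, div_le_one h1]
          nlinarith [mul_pos ht hc]
        have h3 : 0 ≤ t / 2 / (1 + t * eig hA i) * eig hA i := by positivity
        exact pow_le_one₀ h3 h2
    _ = sqVar / d := by
        simp
        field_simp

end Laplace

/-! ### Moments of the normalised squared norm, uniformly in the dimension. -/

section Moments

variable {d : ℕ} {A : Matrix (Fin d) (Fin d) ℝ}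

/-- The moments of a standard Gaussian variable. -/
noncomputable def stdMoment (p : ℝ) : ℝ := ∫ z, |z| ^ (2 * p) ∂gaussianReal 0 1

lemma stdMoment_nonneg (p : ℝ) : 0 ≤ stdMoment p := integral_nonneg fun z => by positivity

/-- Jensen with weights `cᵢ / ∑ cⱼ` applied to `zᵢ²/cᵢ`. After integration only the trace survives,
whereas uniform weights would require bounds on the `p`-th spectral moments. -/
lemma sum_sq_rpow_le {c : Fin d → ℝ} (hc : ∀ i, 0 < c i) {p : ℝ} (hp : 1 ≤ p) (hd : 0 < d)
    (z : Fin d → ℝ) :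
    ((∑ i, z i ^ 2) / d) ^ p
      ≤ ((∑ i, c i) / d) ^ p * ∑ i, c i / (∑ j, c j) * ((c i) ^ (-p) * |z i| ^ (2 * p)) := by
  have : Nonempty (Fin d) := ⟨⟨0, hd⟩⟩
  have hT : 0 < ∑ i, c i := Finset.sum_pos (fun i _ => hc i) Finset.univ_nonempty
  have hd' : (0 : ℝ) < d := by exact_mod_cast hd
  have h1 : (∑ i, z i ^ 2) / d
      = (∑ i, c i) / d * ∑ i, c i / (∑ j, c j) * (z i ^ 2 / c i) := by
    rw [Finset.mul_sum, Finset.sum_div]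
    refine Finset.sum_congr rfl fun i _ => ?_
    have := (hc i).ne'
    field_simp
  have h2 : (∑ i, c i / (∑ j, c j) * (z i ^ 2 / c i)) ^ p
      ≤ ∑ i, c i / (∑ j, c j) * (z i ^ 2 / c i) ^ p := by
    refine Real.rpow_arith_mean_le_arith_mean_rpow _ _ _ (fun i _ => ?_) ?_ (fun i _ => ?_) hp
    · exact (div_pos (hc i) hT).le
    · rw [← Finset.sum_div, div_self hT.ne']
    · have := hc i; positivity
  rw [h1, Real.mul_rpow (by positivity)
    (Finset.sum_nonneg fun i _ => by have := hc i; positivity)]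
  refine mul_le_mul_of_nonneg_left (h2.trans_eq ?_) (by positivity)
  refine Finset.sum_congr rfl fun i _ => ?_
  rw [Real.div_rpow (by positivity) (hc i).le, Real.rpow_neg (hc i).le, Real.rpow_mul (abs_nonneg _),
    Real.rpow_two, sq_abs]
  field_simp

lemma integral_rpow_diagGaussian {c : Fin d → ℝ} (hc : ∀ i, 0 < c i) (p : ℝ) (i : Fin d) :
    ∫ z, |z i| ^ (2 * p) ∂diagGaussian c = (c i) ^ p * stdMoment p := by
  rw [diagGaussian, integral_comp_eval (μ := fun i => gaussianReal 0 (c i).toNNReal)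
    (f := fun y : ℝ => |y| ^ (2 * p)) (Measurable.aestronglyMeasurable (by fun_prop)),
    integral_gaussianReal_eq_std (hc i),
    stdMoment, ← integral_const_mul]
  congr 1; ext z
  rw [abs_mul, Real.mul_rpow (abs_nonneg _) (abs_nonneg _), abs_of_nonneg (Real.sqrt_nonneg _),
    Real.rpow_mul (Real.sqrt_nonneg _), Real.rpow_two, Real.sq_sqrt (hc i).le]

lemma integrable_rpow_diagGaussian (c : Fin d → ℝ) {p : ℝ} (hp : 0 ≤ p) (i : Fin d) :
    Integrable (fun z => |z i| ^ (2 * p)) (diagGaussian c) :=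
  integrable_comp_eval (μ := fun i => gaussianReal 0 (c i).toNNReal)
    (f := fun y : ℝ => |y| ^ (2 * p)) (integrable_abs_rpow_gaussianReal _ (by positivity))

lemma integrable_norm_sq_rpow (hA : A.PosDef) {p : ℝ} (hp : 1 ≤ p) :
    Integrable (fun x => (‖x‖ ^ 2 / d) ^ p) (gaussianLaw A) := by
  rcases Nat.eq_zero_or_pos d with rfl | hd
  · simp
  rw [integrable_gaussianLaw_iff hA]
  simp_rw [norm_eigEquiv_sq]
  refine Integrable.mono' (g := fun z => ((∑ i, eig hA i) / d) ^ p *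
    ∑ i, eig hA i / (∑ j, eig hA j) * ((eig hA i) ^ (-p) * |z i| ^ (2 * p))) ?_
    (Measurable.aestronglyMeasurable (by fun_prop)) (ae_of_all _ fun z => ?_)
  · exact (integrable_finsetSum _ fun i _ =>
      ((integrable_rpow_diagGaussian _ (by linarith) i).const_mul _).const_mul _).const_mul _
  · rw [Real.norm_of_nonneg (by positivity)]
    exact sum_sq_rpow_le (eig_pos hA) hp hd z

lemma integral_norm_sq_rpow_le (hA : A.PosDef) {p M : ℝ} (hp : 1 ≤ p) (hM : A.trace ≤ M * d) :
    ∫ x, (‖x‖ ^ 2 / d) ^ p ∂gaussianLaw A ≤ |M| ^ p * stdMoment p := by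
  rcases Nat.eq_zero_or_pos d with rfl | hd
  · simp only [Nat.cast_zero, div_zero, Real.zero_rpow (by linarith : p ≠ 0), integral_zero]
    exact mul_nonneg (by positivity) (stdMoment_nonneg p)
  have hd' : (0 : ℝ) < d := by exact_mod_cast hd
  have : Nonempty (Fin d) := ⟨⟨0, hd⟩⟩
  have hT : 0 < ∑ i, eig hA i := Finset.sum_pos (fun i _ => eig_pos hA i) Finset.univ_nonempty
  have hTM : (∑ i, eig hA i) / d ≤ |M| := by
    rw [sum_eig hA]
    exact ((div_le_iff₀ hd').2 hM).trans (le_abs_self M)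
  have hint : ∀ i ∈ Finset.univ, Integrable (fun z : Fin d → ℝ =>
      eig hA i / (∑ j, eig hA j) * ((eig hA i) ^ (-p) * |z i| ^ (2 * p)))
      (diagGaussian (eig hA)) := fun i _ =>
    ((integrable_rpow_diagGaussian _ (by linarith) i).const_mul _).const_mul _
  calc ∫ x, (‖x‖ ^ 2 / d) ^ p ∂gaussianLaw A
      ≤ ∫ z, ((∑ i, eig hA i) / d) ^ p * ∑ i, eig hA i / (∑ j, eig hA j)
          * ((eig hA i) ^ (-p) * |z i| ^ (2 * p)) ∂diagGaussian (eig hA) := by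
        rw [integral_gaussianLaw hA]
        refine integral_mono ((integrable_gaussianLaw_iff hA _).1 (integrable_norm_sq_rpow hA hp))
          ((integrable_finsetSum _ hint).const_mul _) fun z => ?_
        simp only [norm_eigEquiv_sq]
        exact sum_sq_rpow_le (eig_pos hA) hp hd z
    _ = ((∑ i, eig hA i) / d) ^ p * stdMoment p := by
        rw [integral_const_mul, integral_finsetSum _ hint]
        congr 1
        calc _ = ∑ i, eig hA i / (∑ j, eig hA j) * stdMoment p := by
              refine Finset.sum_congr rfl fun i _ => ?_
              have := eig_pos hA i
              rw [integral_const_mul, integral_const_mul, integral_rpow_diagGaussian (eig_pos hA),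
                ← mul_assoc ((eig hA i) ^ (-p)), ← Real.rpow_add this]
              simp
          _ = stdMoment p := by
              rw [← Finset.sum_mul, ← Finset.sum_div, div_self hT.ne', one_mul]
    _ ≤ |M| ^ p * stdMoment p := by
        gcongr
        · exact stdMoment_nonneg p

end Moments

/-! ### The limiting spectral measure and convergence of sublinear statistics. -/

section SpectralMeasure

variable {M : ℝ} {C : ∀ d : ℕ, Matrix (Fin d) (Fin d) ℝ} {hC : ∀ d, (C d).PosDef} {ρC : Measure ℝ}

/-- A bump function supported in the negative half-line has zero empirical averages, since all
eigenvalues are positive, and hence zero limiting integral. -/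
lemma SpectralLimit.ae_nonneg (hlim : SpectralLimit hC ρC) [IsProbabilityMeasure ρC] :
    ∀ᵐ c ∂ρC, 0 ≤ c := by
  have h : ρC (Set.Iio 0) = 0 := by
    refine measure_null_of_locally_null _ fun x hx => ?_
    have hx' : x < 0 := hx
    -- The outer radius `-x/2` keeps the support to the left of `x/2 < 0`.
    let φ : ContDiffBump x := ⟨-x / 3, -x / 2, by linarith, by linarith⟩
    refine ⟨Metric.ball x (-x / 3), mem_nhdsWithin_of_mem_nhds
      (Metric.ball_mem_nhds x (by linarith)), ?_⟩
    have h1 := hlim φ φ.contDiff φ.hasCompactSupport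
    have h2 : ∀ d : ℕ, 1 / (d : ℝ) * ∑ i, φ ((hC d).isHermitian.eigenvalues i) = 0 := by
      intro d
      rw [Finset.sum_eq_zero, mul_zero]
      intro i _
      refine φ.zero_of_le_dist ?_
      have := (hC d).eigenvalues_pos i
      change -x / 2 ≤ dist _ x
      rw [Real.dist_eq, abs_of_pos (by linarith)]
      linarith
    simp_rw [h2] at h1
    have h3 : ∫ c, φ c ∂ρC = 0 := tendsto_nhds_unique h1 tendsto_const_nhds
    have hint : Integrable φ ρC := φ.continuous.integrable_of_hasCompactSupport φ.hasCompactSupport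
    rw [integral_eq_zero_iff_of_nonneg (fun c => φ.nonneg) hint] at h3
    refine measure_mono_null (fun y hy => ?_) h3
    simp only [Set.mem_compl_iff, Set.mem_ofPred_eq, Pi.zero_apply]
    rw [φ.one_of_mem_closedBall (Metric.ball_subset_closedBall hy)]
    exact one_ne_zero
  filter_upwards [measure_eq_zero_iff_ae_notMem.1 h] with c hc
  exact not_lt.1 hc

lemma mean_eig_le (hM : ∀ d, (C d).trace ≤ M * d) (d : ℕ) :
    1 / (d : ℝ) * ∑ i, eig (hC d) i ≤ |M| := by
  rcases Nat.eq_zero_or_pos d with rfl | hd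
  · simp
  have hd' : (0 : ℝ) < d := by exact_mod_cast hd
  rw [sum_eig, one_div, inv_mul_le_iff₀ hd', mul_comm]
  exact (hM d).trans (mul_le_mul_of_nonneg_right (le_abs_self M) hd'.le)

/-- Fatou over smooth truncations of the identity, each of which is a test function with empirical
mean at most the mean eigenvalue. Only an inequality can be expected, as part of the trace may
escape to infinity. -/
lemma SpectralLimit.lintegral_le (hlim : SpectralLimit hC ρC) [IsProbabilityMeasure ρC]
    (hM : ∀ d, (C d).trace ≤ M * d) :
    ∫⁻ c, ENNReal.ofReal c ∂ρC ≤ ENNReal.ofReal |M| := by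
  let φ : ℕ → ContDiffBump (0 : ℝ) := fun k => ⟨k + 1, k + 2, by positivity, by linarith⟩
  have hlow : ∀ c : ℝ, Tendsto (fun k => ENNReal.ofReal (c * φ k c)) atTop
      (𝓝 (ENNReal.ofReal c)) := by
    intro c
    refine tendsto_const_nhds.congr' ?_
    obtain ⟨k0, hk0⟩ := exists_nat_ge |c|
    filter_upwards [eventually_ge_atTop k0] with k hk
    rw [(φ k).one_of_mem_closedBall, mul_one]
    have : (k0 : ℝ) ≤ k := by exact_mod_cast hk
    simp only [Metric.mem_closedBall, dist_zero_right, Real.norm_eq_abs]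
    change |c| ≤ (k : ℝ) + 1
    linarith
  have hcont : ∀ k, Continuous fun c => c * φ k c := fun k =>
    continuous_id.mul (φ k).continuous
  calc ∫⁻ c, ENNReal.ofReal c ∂ρC
      = ∫⁻ c, liminf (fun k => ENNReal.ofReal (c * φ k c)) atTop ∂ρC := by
        refine lintegral_congr fun c => ((hlow c).liminf_eq).symm
    _ ≤ liminf (fun k => ∫⁻ c, ENNReal.ofReal (c * φ k c) ∂ρC) atTop :=
        lintegral_liminf_le fun k => (hcont k).measurable.ennreal_ofReal
    _ ≤ liminf (fun _ : ℕ => ENNReal.ofReal |M|) atTop := by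
        refine liminf_le_liminf (Eventually.of_forall fun k => ?_)
        have hsupp : HasCompactSupport fun c => c * φ k c := (φ k).hasCompactSupport.mul_left
        have hint : Integrable (fun c => c * φ k c) ρC :=
          (hcont k).integrable_of_hasCompactSupport hsupp
        have hnn : 0 ≤ᵐ[ρC] fun c => c * φ k c := by
          filter_upwards [hlim.ae_nonneg] with c hc using mul_nonneg hc (φ k).nonneg
        rw [← ofReal_integral_eq_lintegral_ofReal hint hnn]
        refine ENNReal.ofReal_le_ofReal (le_of_tendsto
          (hlim (fun c => c * φ k c) (contDiff_id.mul (φ k).contDiff) hsupp)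
          (Eventually.of_forall fun d => ?_))
        refine le_trans ?_ (mean_eig_le (hC := hC) hM d)
        refine mul_le_mul_of_nonneg_left (Finset.sum_le_sum fun i _ => ?_) (by positivity)
        exact mul_le_of_le_one_right (eig_pos (hC d) i).le (φ k).le_one
    _ = ENNReal.ofReal |M| := by simp

lemma SpectralLimit.integrable_id (hlim : SpectralLimit hC ρC) [IsProbabilityMeasure ρC]
    (hM : ∀ d, (C d).trace ≤ M * d) : Integrable (fun c => c) ρC := by
  refine ⟨by fun_prop, ?_⟩
  rw [hasFiniteIntegral_iff_ofReal hlim.ae_nonneg]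
  exact (hlim.lintegral_le hM).trans_lt ENNReal.ofReal_lt_top

lemma SpectralLimit.integral_id_le (hlim : SpectralLimit hC ρC) [IsProbabilityMeasure ρC]
    (hM : ∀ d, (C d).trace ≤ M * d) : ∫ c, c ∂ρC ≤ |M| := by
  rw [integral_eq_lintegral_of_nonneg_ae hlim.ae_nonneg (by fun_prop)]
  exact ENNReal.toReal_le_of_le_ofReal (abs_nonneg M) (hlim.lintegral_le hM)

/-- With a bounded mean eigenvalue, the eigenvalues above `R` contribute at most `δ|M|` to a
statistic that is below `δx` there. Cutting off at `R` reduces to test functions. -/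
lemma SpectralLimit.tendsto_of_sublinear (hlim : SpectralLimit hC ρC) [IsProbabilityMeasure ρC]
    (hM : ∀ d, (C d).trace ≤ M * d) {g : ℝ → ℝ} {ε₀ : ℝ} (hε₀ : 0 < ε₀)
    (hg : ∀ x, -ε₀ < x → ContDiffAt ℝ ((⊤ : ℕ∞) : WithTop ℕ∞) g x)
    (hint : Integrable g ρC)
    (hsub : ∀ ε > 0, ∃ R > 0, ∀ x ≥ R, |g x| ≤ ε * x) :
    Tendsto (fun d : ℕ => 1 / (d : ℝ) * ∑ i, g (eig (hC d) i)) atTop (𝓝 (∫ c, g c ∂ρC)) := by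
  rw [Metric.tendsto_atTop]
  intro ε hε
  have hM0 := abs_nonneg M
  -- Two truncation errors, one empirical and one in the limit, and the test function error each
  -- cost less than `ε/3`.
  set δ := ε / (3 * (|M| + 1)) with hδ
  have hδ0 : 0 < δ := by positivity
  have hδM : δ * |M| < ε / 3 := by
    rw [hδ, div_mul_eq_mul_div, div_lt_div_iff₀ (by positivity) (by norm_num)]
    nlinarith
  obtain ⟨R, hR, hgR⟩ := hsub δ hδ0
  -- This cutoff is one on `[0, R]` and supported in `[-ε₀/2, R + ε₀/2]`, inside the region where
  -- `g` is smooth.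
  let χ : ContDiffBump (R / 2) := ⟨R / 2, R / 2 + ε₀ / 2, by linarith, by linarith⟩
  set f : ℝ → ℝ := fun x => χ x * g x with hf
  have hfsupp : HasCompactSupport f := χ.hasCompactSupport.mul_right
  have hfs : ContDiff ℝ ((⊤ : ℕ∞) : WithTop ℕ∞) f := by
    rw [contDiff_iff_contDiffAt]
    intro x
    rcases lt_or_ge (-ε₀) x with hx | hx
    · exact χ.contDiff.contDiffAt.mul (hg x hx)
    · have : f =ᶠ[𝓝 x] fun _ => 0 := by
        filter_upwards [Iio_mem_nhds (show x < -ε₀ / 2 by linarith)] with y hy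
        have hy' : y < -ε₀ / 2 := hy
        rw [hf]
        simp only
        rw [χ.zero_of_le_dist, zero_mul]
        change R / 2 + ε₀ / 2 ≤ dist y (R / 2)
        rw [Real.dist_eq, abs_of_neg (by linarith)]
        linarith
      exact contDiffAt_const.congr_of_eventuallyEq this
  have hdiff : ∀ x, 0 ≤ x → |g x - f x| ≤ δ * x := by
    intro x hx
    rcases le_total x R with h | h
    · have : χ x = 1 := by
        refine χ.one_of_mem_closedBall ?_
        change dist x (R / 2) ≤ R / 2
        rw [Real.dist_eq, abs_le]
        constructor <;> linarith
      rw [hf]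
      simp only [this, one_mul, sub_self, abs_zero]
      positivity
    · have h1 : g x - f x = (1 - χ x) * g x := by rw [hf]; ring
      rw [h1, abs_mul, abs_of_nonneg (by linarith [χ.le_one (x := x)])]
      exact (mul_le_of_le_one_left (abs_nonneg _) (by linarith [χ.nonneg (x := x)])).trans
        (hgR x h)
  have hfint : Integrable f ρC := hfs.continuous.integrable_of_hasCompactSupport hfsupp
  have h1 : |∫ c, g c ∂ρC - ∫ c, f c ∂ρC| ≤ δ * |M| := by
    rw [← integral_sub hint hfint]
    refine (abs_integral_le_integral_abs).trans ?_
    calc ∫ c, |g c - f c| ∂ρC ≤ ∫ c, δ * c ∂ρC := by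
          refine integral_mono_ae (hint.sub hfint).abs ((hlim.integrable_id hM).const_mul δ) ?_
          filter_upwards [hlim.ae_nonneg] with c hc using hdiff c hc
      _ ≤ δ * |M| := by
          rw [integral_const_mul]
          exact mul_le_mul_of_nonneg_left (hlim.integral_id_le hM) hδ0.le
  have h2 : ∀ d : ℕ, |1 / (d : ℝ) * ∑ i, g (eig (hC d) i) - 1 / (d : ℝ) * ∑ i, f (eig (hC d) i)|
      ≤ δ * |M| := by
    intro d
    rw [← mul_sub, ← Finset.sum_sub_distrib, abs_mul, abs_of_nonneg (by positivity)]
    calc 1 / (d : ℝ) * |∑ i, (g (eig (hC d) i) - f (eig (hC d) i))|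
        ≤ 1 / (d : ℝ) * ∑ i, δ * eig (hC d) i := by
          refine mul_le_mul_of_nonneg_left ((Finset.abs_sum_le_sum_abs _ _).trans
            (Finset.sum_le_sum fun i _ => hdiff _ (eig_pos (hC d) i).le)) (by positivity)
      _ = δ * (1 / (d : ℝ) * ∑ i, eig (hC d) i) := by rw [← Finset.mul_sum]; ring
      _ ≤ δ * |M| := mul_le_mul_of_nonneg_left (mean_eig_le hM d) hδ0.le
  obtain ⟨N, hN⟩ := Metric.tendsto_atTop.1 (hlim f hfs hfsupp) (ε / 3) (by positivity)
  refine ⟨N, fun d hd => ?_⟩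
  have h3 := hN d hd
  have h4 := h2 d
  rw [Real.dist_eq] at h3 ⊢
  rw [abs_lt] at h3 ⊢
  rw [abs_le] at h1 h4
  constructor <;> linarith [h1.1, h1.2, h4.1, h4.2, h3.1, h3.2]

end SpectralMeasure

/-! ### The limiting exponent of the Laplace transform. -/

section Psi

/-- The limiting exponent of the Laplace transform. -/
noncomputable def psiOf (ρC : Measure ℝ) (t : ℝ) : ℝ := ∫ c, psiFun t c ∂ρC

variable {ρC : Measure ℝ}

lemma measurable_psiFun (t : ℝ) : Measurable (psiFun t) := by unfold psiFun; fun_prop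

lemma psiFun_nonneg {t c : ℝ} (ht : 0 ≤ t) (hc : 0 ≤ c) : 0 ≤ psiFun t c := by
  have : 0 ≤ t * c := by positivity
  have := Real.log_nonneg (show 1 ≤ 1 + t * c by linarith)
  unfold psiFun
  positivity

lemma psiFun_le {t c : ℝ} (ht : 0 ≤ t) (hc : 0 ≤ c) : psiFun t c ≤ t * c := by
  have h0 : 0 ≤ t * c := by positivity
  have h1 := Real.log_le_sub_one_of_pos (show 0 < 1 + t * c by linarith)
  have h2 : t * c / (1 + t * c) ≤ t * c := div_le_self h0 (by linarith)
  unfold psiFun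
  linarith

lemma integrable_psiFun (h0 : ∀ᵐ c ∂ρC, 0 ≤ c) (hi : Integrable (fun c => c) ρC) {t : ℝ}
    (ht : 0 ≤ t) : Integrable (psiFun t) ρC := by
  refine (hi.const_mul t).mono' (measurable_psiFun t).aestronglyMeasurable ?_
  filter_upwards [h0] with c hc
  rw [Real.norm_of_nonneg (psiFun_nonneg ht hc)]
  exact psiFun_le ht hc

/-- The tangent of slope `δ = ε/t` to the logarithm bounds `log(1+tx)` by `εx` plus a constant. The
factor `1/2` in `psiFun` leaves another `εx/2` to absorb that constant for large `x`. -/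
lemma psiFun_sublinear {t : ℝ} (ht : 0 < t) :
    ∀ ε > 0, ∃ R > 0, ∀ x ≥ R, |psiFun t x| ≤ ε * x := by
  intro ε hε
  set δ := ε / t with hδ
  have hδ0 : 0 < δ := by positivity
  refine ⟨(|δ - Real.log δ - 1| + 1) / ε, by positivity, fun x hx => ?_⟩
  have hx0 : 0 < x := lt_of_lt_of_le (by positivity) hx
  rw [ge_iff_le, div_le_iff₀ hε] at hx
  have htx : 0 < t * x := by positivity
  rw [abs_of_nonneg (psiFun_nonneg ht.le hx0.le)]
  have h1 := Real.log_le_sub_one_of_pos (show 0 < δ * (1 + t * x) by positivity)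
  rw [Real.log_mul hδ0.ne' (by positivity)] at h1
  have h2 : t * x / (1 + t * x) ≤ 1 := by rw [div_le_one (by positivity)]; linarith
  have h3 : δ * (1 + t * x) = δ + ε * x := by rw [hδ]; field_simp
  have h4 := le_abs_self (δ - Real.log δ - 1)
  unfold psiFun
  linarith

lemma contDiffAt_psiFun {t : ℝ} (ht : 0 < t) (x : ℝ) (hx : -(1 / t) < x) :
    ContDiffAt ℝ ((⊤ : ℕ∞) : WithTop ℕ∞) (psiFun t) x := by
  have h1 : 0 < 1 + t * x := by
    have := mul_lt_mul_of_pos_left hx ht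
    rw [mul_neg, mul_one_div_cancel ht.ne'] at this
    linarith
  unfold psiFun
  have h2 : ContDiffAt ℝ ((⊤ : ℕ∞) : WithTop ℕ∞) (fun c => t * c) x := by fun_prop
  have h3 : ContDiffAt ℝ ((⊤ : ℕ∞) : WithTop ℕ∞) (fun c => 1 + t * c) x := by fun_prop
  exact contDiffAt_const.mul ((h3.log h1.ne').add (h2.div h3 h1.ne'))

lemma SpectralLimit.tendsto_psi {M : ℝ} {C : ∀ d : ℕ, Matrix (Fin d) (Fin d) ℝ}
    {hC : ∀ d, (C d).PosDef} [IsProbabilityMeasure ρC] (hlim : SpectralLimit hC ρC)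
    (hM : ∀ d, (C d).trace ≤ M * d) {t : ℝ} (ht : 0 < t) :
    Tendsto (fun d : ℕ => 1 / (d : ℝ) * ∑ i, psiFun t (eig (hC d) i)) atTop
      (𝓝 (psiOf ρC t)) :=
  hlim.tendsto_of_sublinear hM (one_div_pos.2 ht) (contDiffAt_psiFun ht)
    (integrable_psiFun hlim.ae_nonneg (hlim.integrable_id hM) ht.le) (psiFun_sublinear ht)

/-- Adds the `O(d^(-1/2))` fluctuation to the convergence of the spectral mean. -/
lemma SpectralLimit.tendsto_log_laplace {M : ℝ} {C : ∀ d : ℕ, Matrix (Fin d) (Fin d) ℝ}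
    {hC : ∀ d, (C d).PosDef} [IsProbabilityMeasure ρC] (hlim : SpectralLimit hC ρC)
    (hM : ∀ d, (C d).trace ≤ M * d) {t : ℝ} (ht : 0 < t) :
    Tendsto (fun d : ℕ => ∫ x, |1 / (d : ℝ) * Real.log (laplace (C d) t x) + psiOf ρC t|
      ∂gaussianLaw (C d)) atTop (𝓝 0) := by
  have h1 : Tendsto (fun d : ℕ => √(sqVar / d)
      + |psiOf ρC t - 1 / (d : ℝ) * ∑ i, psiFun t (eig (hC d) i)|) atTop (𝓝 0) := by
    have h2 : Tendsto (fun d : ℕ => √(sqVar / d)) atTop (𝓝 0) := by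
      simpa using (tendsto_const_div_atTop_nhds_zero_nat sqVar).sqrt
    have h3 := ((tendsto_const_nhds (x := psiOf ρC t)).sub (hlim.tendsto_psi hM ht)).abs
    simpa using h2.add h3
  refine squeeze_zero (fun d => integral_nonneg fun x => abs_nonneg _) (fun d => ?_) h1
  have hint := integrable_log_laplace (hC d) ht
  calc _ ≤ ∫ x, (|1 / (d : ℝ) * Real.log (laplace (C d) t x)
          + 1 / (d : ℝ) * ∑ i, psiFun t (eig (hC d) i)|
          + |psiOf ρC t - 1 / (d : ℝ) * ∑ i, psiFun t (eig (hC d) i)|) ∂gaussianLaw (C d) := by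
        refine integral_mono (hint.add (integrable_const _)).abs
          ((hint.add (integrable_const _)).abs.add (integrable_const _)) fun x => ?_
        refine le_trans (le_of_eq ?_) (abs_add_le _ _)
        congr 1; ring
    _ ≤ _ := by
        have hint' : Integrable (fun x => |1 / (d : ℝ) * Real.log (laplace (C d) t x)
            + 1 / (d : ℝ) * ∑ i, psiFun t (eig (hC d) i)|) (gaussianLaw (C d)) :=
          (hint.add (integrable_const _)).abs
        rw [integral_add hint' (integrable_const _)]
        simpa using integral_abs_log_laplace_le (hC d) ht

end Psi

/-! ### Monotonicity, continuity and range of the distance and cost functions. -/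

section LimitFunctions

variable {ρC : Measure ℝ}

lemma measure_Ioi_pos [IsProbabilityMeasure ρC] (h0 : ∀ᵐ c ∂ρC, 0 ≤ c)
    (hρC : ρC ≠ Measure.dirac 0) : 0 < ρC (Set.Ioi 0) := by
  rw [pos_iff_ne_zero]
  intro h
  refine hρC ?_
  have h1 : ρC ({0}ᶜ) = 0 := by
    refine measure_mono_null (t := {c | ¬ 0 ≤ c} ∪ Set.Ioi 0) (fun c hc => ?_)
      (measure_union_null (ae_iff.1 h0) h)
    rcases lt_trichotomy c 0 with h | h | h
    · exact Or.inl (not_le.2 h)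
    · exact absurd h hc
    · exact Or.inr h
  have h2 : ρC {0} = 1 := (prob_compl_eq_zero_iff (measurableSet_singleton 0)).1 h1
  have h3 : ρC.restrict {0} = ρC := by
    rw [Measure.restrict_eq_self_of_ae_mem]
    exact measure_eq_zero_iff_ae_notMem.1 h1 |>.mono fun c hc => by simpa using hc
  rw [← h3, Measure.restrict_singleton, h2, one_smul]

/-- The integrands of interest vanish at `c = 0`, so strictness has to come from the mass on `(0,
∞)`, present because `ρC ≠ δ₀`. -/
lemma integral_lt_of_lt_on_Ioi (h0 : ∀ᵐ c ∂ρC, 0 ≤ c) (hpos : 0 < ρC (Set.Ioi 0)) {f g : ℝ → ℝ}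
    (hf : Integrable f ρC) (hg : Integrable g ρC) (hfg0 : f 0 ≤ g 0)
    (hfg : ∀ c, 0 < c → f c < g c) : ∫ c, f c ∂ρC < ∫ c, g c ∂ρC := by
  rw [← sub_pos, ← integral_sub hg hf]
  refine (integral_pos_iff_support_of_nonneg_ae (f := fun c => g c - f c) ?_ (hg.sub hf)).2 ?_
  rotate_left
  · refine hpos.trans_le (measure_mono fun c hc => ?_)
    exact (sub_pos.2 (hfg c hc)).ne'
  · filter_upwards [h0] with c hc
    rcases hc.eq_or_lt with h | h
    · rw [← h]; exact sub_nonneg.2 hfg0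
    · exact sub_nonneg.2 (hfg c h).le

/-- The integrand of `lOf`. -/
noncomputable def lFun (t c : ℝ) : ℝ := c / (1 + t * c) + c / (1 + t * c) ^ 2

lemma lOf_eq (t : ℝ) : lOf ρC t = ∫ c, lFun t c ∂ρC := rfl

lemma measurable_lFun (t : ℝ) : Measurable (lFun t) := by unfold lFun; fun_prop

lemma lFun_nonneg {t c : ℝ} (ht : 0 ≤ t) (hc : 0 ≤ c) : 0 ≤ lFun t c := by
  unfold lFun; positivity

lemma lFun_le {t c : ℝ} (ht : 0 ≤ t) (hc : 0 ≤ c) : lFun t c ≤ 2 * c := by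
  have h : 0 ≤ t * c := by positivity
  have h1 : c / (1 + t * c) ≤ c := div_le_self hc (by linarith)
  have h2 : c / (1 + t * c) ^ 2 ≤ c := div_le_self hc (one_le_pow₀ (by linarith))
  unfold lFun; linarith

lemma integrable_lFun (h0 : ∀ᵐ c ∂ρC, 0 ≤ c) (hi : Integrable (fun c => c) ρC) {t : ℝ}
    (ht : 0 ≤ t) : Integrable (lFun t) ρC := by
  refine (hi.const_mul 2).mono' (measurable_lFun t).aestronglyMeasurable ?_
  filter_upwards [h0] with c hc
  rw [Real.norm_of_nonneg (lFun_nonneg ht hc)]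
  exact lFun_le ht hc

/-- Legendre relation: as `lOf = 2 psiOf'`, the right side is `sup_u (psiOf u - u s/2)` at `s = lOf
ρC t`, the Chernoff exponent for `|x-y|²/d ≤ s`. -/
lemma alphaOf_eq (h0 : ∀ᵐ c ∂ρC, 0 ≤ c) (hi : Integrable (fun c => c) ρC) {t : ℝ}
    (ht : 0 ≤ t) : alphaOf ρC t = psiOf ρC t - t / 2 * lOf ρC t := by
  rw [alphaOf, psiOf, lOf_eq, ← integral_const_mul, ← integral_const_mul,
    ← integral_sub (integrable_psiFun h0 hi ht) ((integrable_lFun h0 hi ht).const_mul _)]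
  refine integral_congr_ae ?_
  filter_upwards [h0] with c hc
  have : 0 < 1 + t * c := by positivity
  unfold psiFun lFun
  field_simp
  ring

lemma lOf_pos (h0 : ∀ᵐ c ∂ρC, 0 ≤ c) (hi : Integrable (fun c => c) ρC)
    (hpos : 0 < ρC (Set.Ioi 0)) {t : ℝ} (ht : 0 ≤ t) : 0 < lOf ρC t := by
  have h := integral_lt_of_lt_on_Ioi h0 hpos (integrable_zero ℝ ℝ ρC) (integrable_lFun h0 hi ht)
    (by simp [lFun]) (fun c hc => by simp only [lFun]; positivity)
  simpa [lOf_eq] using h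

lemma lOf_strictAntiOn (h0 : ∀ᵐ c ∂ρC, 0 ≤ c) (hi : Integrable (fun c => c) ρC)
    (hpos : 0 < ρC (Set.Ioi 0)) : StrictAntiOn (lOf ρC) (Set.Ici 0) := by
  intro s hs t ht hst
  have hs : 0 ≤ s := hs
  have ht : 0 ≤ t := ht
  refine integral_lt_of_lt_on_Ioi h0 hpos (integrable_lFun h0 hi ht) (integrable_lFun h0 hi hs)
    (by simp) fun c hc => ?_
  gcongr

/-- The subtracted term increases on `[0, 1]`, so monotonicity is not termwise; the growth of the
logarithm has to dominate it. -/
lemma alphaFun_lt {u v : ℝ} (hu : 0 ≤ u) (huv : u < v) :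
    Real.log (1 + u) - u / (1 + u) ^ 2 < Real.log (1 + v) - v / (1 + v) ^ 2 := by
  have ha : 0 < 1 + u := by linarith
  have hb : 0 < 1 + v := by linarith
  have h1 := Real.one_sub_inv_le_log_of_pos (div_pos hb ha)
  rw [Real.log_div hb.ne' ha.ne', inv_div] at h1
  have h2 : u / (1 + u) ^ 2 = 1 / (1 + u) - (1 / (1 + u)) ^ 2 := by field_simp; ring
  have h3 : v / (1 + v) ^ 2 = 1 / (1 + v) - (1 / (1 + v)) ^ 2 := by field_simp; ring
  have h4 : (1 + u) / (1 + v) = (1 + u) * (1 / (1 + v)) := by ring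
  -- In these variables the subtracted terms are `p - p²` and `q - q²`, and the claim reduces to `(p
  -- - q)(u + 2 - p - q) > 0`.
  set p := 1 / (1 + u) with hp
  set q := 1 / (1 + v) with hq
  have hpq : q < p := one_div_lt_one_div_of_lt ha (by linarith)
  have hp1 : p ≤ 1 := by rw [hp, div_le_one ha]; linarith
  have hq0 : 0 < q := by positivity
  have h5 : (1 + u) * p = 1 := by rw [hp]; field_simp
  rw [h4] at h1
  rw [h2, h3]
  have h6 : 1 - (1 + u) * q = (1 + u) * (p - q) := by linear_combination -h5
  nlinarith [mul_nonneg hu (sub_pos.2 hpq).le, mul_pos (sub_pos.2 hpq) (show 0 < 2 - p - q by linarith)]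

lemma alphaFun_nonneg {u : ℝ} (hu : 0 ≤ u) : 0 ≤ Real.log (1 + u) - u / (1 + u) ^ 2 := by
  rcases hu.eq_or_lt with h | h
  · simp [← h]
  · simpa using (alphaFun_lt le_rfl h).le

lemma alphaFun_le {u : ℝ} (hu : 0 ≤ u) : Real.log (1 + u) - u / (1 + u) ^ 2 ≤ u := by
  have h1 := Real.log_le_sub_one_of_pos (show 0 < 1 + u by linarith)
  have : 0 ≤ u / (1 + u) ^ 2 := by positivity
  linarith

lemma integrable_alphaFun (h0 : ∀ᵐ c ∂ρC, 0 ≤ c) (hi : Integrable (fun c => c) ρC) {t : ℝ}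
    (ht : 0 ≤ t) :
    Integrable (fun c => Real.log (1 + t * c) - t * c / (1 + t * c) ^ 2) ρC := by
  refine (hi.const_mul t).mono' (Measurable.aestronglyMeasurable (by fun_prop)) ?_
  filter_upwards [h0] with c hc
  rw [Real.norm_of_nonneg (alphaFun_nonneg (by positivity))]
  exact alphaFun_le (by positivity)

lemma alphaOf_strictMonoOn (h0 : ∀ᵐ c ∂ρC, 0 ≤ c) (hi : Integrable (fun c => c) ρC)
    (hpos : 0 < ρC (Set.Ioi 0)) : StrictMonoOn (alphaOf ρC) (Set.Ici 0) := by
  intro s hs t ht hst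
  have hs : 0 ≤ s := hs
  refine mul_lt_mul_of_pos_left ?_ (by norm_num)
  exact integral_lt_of_lt_on_Ioi h0 hpos (integrable_alphaFun h0 hi hs)
    (integrable_alphaFun h0 hi ht) (by simp)
    fun c hc => alphaFun_lt (by positivity) (mul_lt_mul_of_pos_right hst hc)

lemma lOf_continuousOn (h0 : ∀ᵐ c ∂ρC, 0 ≤ c) (hi : Integrable (fun c => c) ρC) :
    ContinuousOn (lOf ρC) (Set.Ici 0) := by
  refine continuousOn_of_dominated (F := lFun) (bound := fun c => 2 * c)
    (fun t _ => (measurable_lFun t).aestronglyMeasurable) (fun t ht => ?_) (hi.const_mul 2) ?_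
  · filter_upwards [h0] with c hc
    rw [Real.norm_of_nonneg (lFun_nonneg ht hc)]
    exact lFun_le ht hc
  · filter_upwards [h0] with c hc
    unfold lFun
    refine ContinuousOn.add (ContinuousOn.div (by fun_prop) (by fun_prop) fun t ht => ?_)
      (ContinuousOn.div (by fun_prop) (by fun_prop) fun t ht => ?_)
    · have ht : 0 ≤ t := ht
      positivity
    · have ht : 0 ≤ t := ht
      positivity

lemma alphaOf_continuousOn (h0 : ∀ᵐ c ∂ρC, 0 ≤ c) (hi : Integrable (fun c => c) ρC) (T : ℝ) :
    ContinuousOn (alphaOf ρC) (Set.Icc 0 T) := by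
  refine continuousOn_const.mul (continuousOn_of_dominated
    (F := fun t c => Real.log (1 + t * c) - t * c / (1 + t * c) ^ 2) (bound := fun c => T * c)
    (fun t _ => Measurable.aestronglyMeasurable (by fun_prop)) (fun t ht => ?_)
    (hi.const_mul T) ?_)
  · filter_upwards [h0] with c hc
    have ht0 := ht.1
    rw [Real.norm_of_nonneg (alphaFun_nonneg (by positivity))]
    exact (alphaFun_le (by positivity)).trans (mul_le_mul_of_nonneg_right ht.2 hc)
  · filter_upwards [h0] with c hc
    refine ContinuousOn.sub (ContinuousOn.log (by fun_prop) fun t ht => ?_)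
      (ContinuousOn.div (by fun_prop) (by fun_prop) fun t ht => ?_)
    · have ht0 := ht.1
      positivity
    · have ht0 := ht.1
      positivity

/-- Some `[a, ∞)` with `a > 0` has positive mass, and there the integrand is at least `log(1+Ta) -
1`, which is unbounded in `T`. -/
lemma exists_lt_alphaOf [IsProbabilityMeasure ρC] (h0 : ∀ᵐ c ∂ρC, 0 ≤ c)
    (hi : Integrable (fun c => c) ρC) (hpos : 0 < ρC (Set.Ioi 0)) (α : ℝ) :
    ∃ T, 0 < T ∧ α < alphaOf ρC T := by
  obtain ⟨a, ha, hma⟩ : ∃ a : ℝ, 0 < a ∧ 0 < ρC (Set.Ici a) := by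
    by_contra! h
    have : ρC (⋃ k : ℕ, Set.Ici (1 / ((k : ℝ) + 1))) = 0 :=
      measure_iUnion_null fun k => le_antisymm (h _ (by positivity)) zero_le
    refine hpos.ne' (measure_mono_null (fun c hc => ?_) this)
    obtain ⟨k, hk⟩ := exists_nat_one_div_lt (show 0 < c from hc)
    exact Set.mem_iUnion.2 ⟨k, hk.le⟩
  set m := ρC.real (Set.Ici a) with hm
  have hm0 : 0 < m := ENNReal.toReal_pos hma.ne' (measure_ne_top _ _)
  have key : ∀ T, 0 < T → 1 / 2 * ((Real.log (1 + T * a) - 1) * m) ≤ alphaOf ρC T := by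
    intro T hT
    refine mul_le_mul_of_nonneg_left ?_ (by norm_num)
    have h1 : (Real.log (1 + T * a) - 1) * m
        = ∫ c, (Set.Ici a).indicator (fun _ => Real.log (1 + T * a) - 1) c ∂ρC := by
      rw [integral_indicator measurableSet_Ici, setIntegral_const, smul_eq_mul, mul_comm]
    rw [h1]
    refine integral_mono_ae ((integrable_const _).indicator measurableSet_Ici)
      (integrable_alphaFun h0 hi hT.le) ?_
    filter_upwards [h0] with c hc
    by_cases hca : c ∈ Set.Ici a
    · rw [Set.indicator_of_mem hca]
      have hca' : a ≤ c := hca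
      have h2 : Real.log (1 + T * a) ≤ Real.log (1 + T * c) :=
        Real.log_le_log (by positivity) (by gcongr)
      have h3 : T * c / (1 + T * c) ^ 2 ≤ 1 := by
        rw [div_le_one (by positivity)]
        nlinarith [mul_nonneg hT.le hc]
      linarith
    · rw [Set.indicator_of_notMem hca]
      exact alphaFun_nonneg (by positivity)
  have hlim : Tendsto (fun T : ℝ => 1 / 2 * ((Real.log (1 + T * a) - 1) * m)) atTop atTop := by
    refine Tendsto.const_mul_atTop (by norm_num) (Tendsto.atTop_mul_const hm0 ?_)
    refine tendsto_atTop_add_const_right _ _ (Real.tendsto_log_atTop.comp ?_)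
    exact tendsto_atTop_add_const_left _ _ (tendsto_id.atTop_mul_const ha)
  obtain ⟨T, h1, h2⟩ := ((hlim.eventually_gt_atTop α).and (eventually_gt_atTop 0)).exists
  exact ⟨T, h2, h1.trans_le (key T h2)⟩

lemma alphaOf_zero : alphaOf ρC 0 = 0 := by simp [alphaOf]

lemma exists_alphaOf_eq [IsProbabilityMeasure ρC] (h0 : ∀ᵐ c ∂ρC, 0 ≤ c)
    (hi : Integrable (fun c => c) ρC) (hpos : 0 < ρC (Set.Ioi 0)) {α : ℝ} (hα : 0 < α) :
    ∃ t, 0 < t ∧ alphaOf ρC t = α := by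
  obtain ⟨T, hT, hαT⟩ := exists_lt_alphaOf h0 hi hpos α
  obtain ⟨t, ht, hta⟩ := intermediate_value_Icc hT.le (alphaOf_continuousOn h0 hi T)
    (show α ∈ _ from ⟨by rw [alphaOf_zero]; exact hα.le, hαT.le⟩)
  refine ⟨t, ht.1.lt_of_ne ?_, hta⟩
  rintro rfl
  rw [alphaOf_zero] at hta
  exact hα.ne hta

/-- Differentiation under the integral: the `t`-derivative of the integrand is at most `c` for every
`t > 0`, so the finite first moment dominates. -/
lemma hasDerivAt_psiOf (h0 : ∀ᵐ c ∂ρC, 0 ≤ c) (hi : Integrable (fun c => c) ρC) {t : ℝ}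
    (ht : 0 < t) : HasDerivAt (psiOf ρC) (lOf ρC t / 2) t := by
  have h := (hasDerivAt_integral_of_dominated_loc_of_deriv_le (μ := ρC) (F := psiFun)
    (F' := fun t c => lFun t c / 2) (bound := fun c => c) (Ioi_mem_nhds ht)
    (Eventually.of_forall fun s => (measurable_psiFun s).aestronglyMeasurable)
    (integrable_psiFun h0 hi ht.le) ((measurable_lFun t).div_const 2).aestronglyMeasurable
    ?_ hi ?_).2
  · rwa [integral_div] at h
  · filter_upwards [h0] with c hc s hs
    have hs : 0 < s := hs
    rw [Real.norm_of_nonneg (by have := lFun_nonneg hs.le hc; positivity)]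
    have := lFun_le hs.le hc
    linarith
  · filter_upwards [h0] with c hc s hs
    have hs : 0 < s := hs
    have h1 : 0 < 1 + s * c := by positivity
    have h2 : HasDerivAt (fun s => s * c) c s := by simpa using (hasDerivAt_id s).mul_const c
    have h3 : HasDerivAt (fun s => 1 + s * c) c s := h2.const_add 1
    have h4 := ((h3.log h1.ne').add (h2.div h3 h1.ne')).const_mul (1 / 2)
    refine h4.congr_deriv ?_
    unfold lFun
    field_simp
    ring

end LimitFunctions

/-! ### The saddle point equation. -/

section Tilt

variable {ρC : Measure ℝ}

/-- The saddle point equation `t = q l(t)^(γ-1)` has a solution. -/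
lemma exists_tilt (h0 : ∀ᵐ c ∂ρC, 0 ≤ c) (hi : Integrable (fun c => c) ρC)
    (hpos : 0 < ρC (Set.Ioi 0)) {γ q : ℝ} (hγ : 1 ≤ γ) (hq : 0 < q) :
    ∃ t, 0 < t ∧ t = q * lOf ρC t ^ (γ - 1) := by
  have hγ' : 0 ≤ γ - 1 := by linarith
  have hl0 := lOf_pos h0 hi hpos le_rfl
  -- At `0` the left side is smaller than the right, and at `T` it is at least as large because
  -- `lOf` decreases; a root lies between.
  set T := q * lOf ρC 0 ^ (γ - 1) with hT
  have hT0 : 0 < T := by positivity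
  have hlT : lOf ρC T ≤ lOf ρC 0 :=
    ((lOf_strictAntiOn h0 hi hpos).le_iff_ge (Set.mem_Ici.2 hT0.le) (Set.mem_Ici.2 le_rfl)).2 hT0.le
  have hcont : ContinuousOn (fun t => t - q * lOf ρC t ^ (γ - 1)) (Set.Icc 0 T) :=
    continuousOn_id.sub (continuousOn_const.mul
      (((lOf_continuousOn h0 hi).mono Set.Icc_subset_Ici_self).rpow_const fun _ _ => Or.inr hγ'))
  obtain ⟨t, ht, hteq⟩ := intermediate_value_Icc hT0.le hcont
    (show (0 : ℝ) ∈ _ from ⟨by simp only [zero_sub]; linarith, by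
      have := Real.rpow_le_rpow (lOf_pos h0 hi hpos hT0.le).le hlT hγ'
      have := mul_le_mul_of_nonneg_left this hq.le
      linarith⟩)
  simp only at hteq
  refine ⟨t, ?_, by linarith⟩
  have := Real.rpow_pos_of_pos (lOf_pos h0 hi hpos ht.1) (γ - 1)
  have := mul_pos hq this
  linarith

/-- The right side of the equation is nonincreasing in the tilt, since `γ ≥ 1` and `lOf` decreases,
and strictly increasing in `q`. -/
lemma tilt_lt (h0 : ∀ᵐ c ∂ρC, 0 ≤ c) (hi : Integrable (fun c => c) ρC)
    (hpos : 0 < ρC (Set.Ioi 0)) {γ q₁ q₂ t₁ t₂ : ℝ} (hγ : 1 ≤ γ) (hq₂ : 0 < q₂)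
    (hq : q₁ < q₂) (ht₁ : 0 < t₁) (ht₂ : 0 < t₂) (h₁ : t₁ = q₁ * lOf ρC t₁ ^ (γ - 1))
    (h₂ : t₂ = q₂ * lOf ρC t₂ ^ (γ - 1)) : t₁ < t₂ := by
  by_contra! h
  have hl : lOf ρC t₁ ≤ lOf ρC t₂ := ((lOf_strictAntiOn h0 hi hpos).le_iff_ge
    (Set.mem_Ici.2 ht₁.le) (Set.mem_Ici.2 ht₂.le)).2 h
  have h3 := Real.rpow_le_rpow (lOf_pos h0 hi hpos ht₁.le).le hl (show 0 ≤ γ - 1 by linarith)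
  have h4 := Real.rpow_pos_of_pos (lOf_pos h0 hi hpos ht₁.le) (γ - 1)
  have h5 : q₁ * lOf ρC t₁ ^ (γ - 1) < q₂ * lOf ρC t₂ ^ (γ - 1) :=
    (mul_lt_mul_of_pos_right hq h4).trans_le (mul_le_mul_of_nonneg_left h3 hq₂.le)
  linarith

lemma tilt_unique (h0 : ∀ᵐ c ∂ρC, 0 ≤ c) (hi : Integrable (fun c => c) ρC)
    (hpos : 0 < ρC (Set.Ioi 0)) {γ q t₁ t₂ : ℝ} (hγ : 1 ≤ γ) (hq : 0 < q) (ht₁ : 0 < t₁)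
    (ht₂ : 0 < t₂) (h₁ : t₁ = q * lOf ρC t₁ ^ (γ - 1))
    (h₂ : t₂ = q * lOf ρC t₂ ^ (γ - 1)) : t₁ = t₂ := by
  have aux : ∀ {a b : ℝ}, 0 < a → 0 < b → a = q * lOf ρC a ^ (γ - 1) →
      b = q * lOf ρC b ^ (γ - 1) → ¬ a < b := by
    intro a b ha hb h₁ h₂ hab
    have hl := lOf_strictAntiOn h0 hi hpos (Set.mem_Ici.2 ha.le) (Set.mem_Ici.2 hb.le) hab
    have h3 := Real.rpow_le_rpow (lOf_pos h0 hi hpos hb.le).le hl.le (show 0 ≤ γ - 1 by linarith)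
    have h5 := mul_le_mul_of_nonneg_left h3 hq.le
    linarith
  exact le_antisymm (not_lt.1 (aux ht₂ ht₁ h₂ h₁)) (not_lt.1 (aux ht₁ ht₂ h₁ h₂))

open Classical in
/-- The solution of the saddle point equation `t = q l(t)^(γ-1)`. -/
noncomputable def tilt (ρC : Measure ℝ) (γ q : ℝ) : ℝ :=
  if h : ∃ t, 0 < t ∧ t = q * lOf ρC t ^ (γ - 1) then h.choose else 0

lemma tilt_spec (h0 : ∀ᵐ c ∂ρC, 0 ≤ c) (hi : Integrable (fun c => c) ρC)
    (hpos : 0 < ρC (Set.Ioi 0)) {γ q : ℝ} (hγ : 1 ≤ γ) (hq : 0 < q) :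
    0 < tilt ρC γ q ∧ tilt ρC γ q = q * lOf ρC (tilt ρC γ q) ^ (γ - 1) := by
  have h := exists_tilt h0 hi hpos hγ hq
  have h2 : tilt ρC γ q = h.choose := dif_pos h
  rw [h2]
  exact h.choose_spec

lemma tilt_eq_iff (h0 : ∀ᵐ c ∂ρC, 0 ≤ c) (hi : Integrable (fun c => c) ρC)
    (hpos : 0 < ρC (Set.Ioi 0)) {γ q t : ℝ} (hγ : 1 ≤ γ) (hq : 0 < q) (ht : 0 < t) :
    tilt ρC γ q = t ↔ t = q * lOf ρC t ^ (γ - 1) := by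
  have h := tilt_spec h0 hi hpos hγ hq
  constructor
  · rintro rfl; exact h.2
  · exact fun h' => tilt_unique h0 hi hpos hγ hq h.1 ht h.2 h'

/-- The tilt inverts the strictly increasing map `x ↦ x / lOf(x)^(γ-1)`, so any neighbourhood of its
value is trapped between two levels of that map. -/
lemma tilt_continuousAt (h0 : ∀ᵐ c ∂ρC, 0 ≤ c) (hi : Integrable (fun c => c) ρC)
    (hpos : 0 < ρC (Set.Ioi 0)) {γ q : ℝ} (hγ : 1 ≤ γ) (hq : 0 < q) :
    ContinuousAt (tilt ρC γ) q := by
  have hs := tilt_spec h0 hi hpos hγ hq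
  set t := tilt ρC γ q with ht
  have hle : ∀ {x}, 0 < x → 0 < lOf ρC x ^ (γ - 1) := fun hx =>
    Real.rpow_pos_of_pos (lOf_pos h0 hi hpos hx.le) _
  have hval : ∀ {x}, 0 < x → x = x / lOf ρC x ^ (γ - 1) * lOf ρC x ^ (γ - 1) := fun hx =>
    (div_mul_cancel₀ _ (hle hx).ne').symm
  have hlt : ∀ {x y}, 0 < x → x < y →
      x / lOf ρC x ^ (γ - 1) < y / lOf ρC y ^ (γ - 1) := by
    intro x y hx hxy
    have hy := hx.trans hxy
    have hl := lOf_strictAntiOn h0 hi hpos (Set.mem_Ici.2 hx.le) (Set.mem_Ici.2 hy.le) hxy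
    have h3 := Real.rpow_le_rpow (lOf_pos h0 hi hpos hy.le).le hl.le (show 0 ≤ γ - 1 by linarith)
    exact (div_lt_div_of_pos_right hxy (hle hx)).trans_le
      (div_le_div_of_nonneg_left hy.le (hle hy) h3)
  have hqt : q = t / lOf ρC t ^ (γ - 1) := (eq_div_iff (hle hs.1).ne').2 hs.2.symm
  rw [ContinuousAt, ← ht, tendsto_order]
  constructor
  · intro a ha
    -- The maximum keeps the comparison point positive even when `a` is not.
    set x := max a (t / 2) with hx
    have hxt : x < t := max_lt ha (by linarith [hs.1])
    have hx0 : 0 < x := lt_max_of_lt_right (by linarith [hs.1])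
    have hlt' := hlt hx0 hxt
    rw [← hqt] at hlt'
    filter_upwards [Ioi_mem_nhds hlt', Ioi_mem_nhds hq] with q' hq' hq0
    have hq0 : 0 < q' := hq0
    have hs' := tilt_spec h0 hi hpos hγ hq0
    exact (le_max_left a _).trans_lt
      (tilt_lt h0 hi hpos hγ hq0 hq' hx0 hs'.1 (hval hx0) hs'.2)
  · intro b hb
    have hb0 := hs.1.trans hb
    have hlt' := hlt hs.1 hb
    rw [← hqt] at hlt'
    filter_upwards [Iio_mem_nhds hlt', Ioi_mem_nhds hq] with q' hq' hq0
    have hq0 : 0 < q' := hq0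
    have hs' := tilt_spec h0 hi hpos hγ hq0
    exact tilt_lt h0 hi hpos hγ (div_pos hb0 (hle hb0)) hq' hs'.1 hb0 hs'.2 (hval hb0)

end Tilt

/-! ### Convexity of the rate function. -/

section Rate

lemma rate_nonneg {γ u : ℝ} (hγ : 1 ≤ γ) (hu : 0 ≤ u) : 0 ≤ rate γ u := by
  unfold rate; positivity

lemma rate_mono {γ u v : ℝ} (hγ : 1 ≤ γ) (hu : 0 ≤ u) (huv : u ≤ v) : rate γ u ≤ rate γ v := by
  unfold rate; gcongr

lemma rate_continuous {γ : ℝ} (hγ : 1 ≤ γ) : Continuous (rate γ) := by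
  unfold rate
  exact (Real.continuous_rpow_const (by linarith)).div_const _

/-- Bernoulli's inequality at `v/u - 1` is the tangent line bound for the power `γ ≥ 1`. -/
lemma rate_support {γ u v : ℝ} (hγ : 1 ≤ γ) (hu : 0 < u) (hv : 0 ≤ v) :
    rate γ u + u ^ (γ - 1) / 2 * (v - u) ≤ rate γ v := by
  have h := one_add_mul_self_le_rpow_one_add (s := v / u - 1) (p := γ)
    (by have : 0 ≤ v / u := by positivity
        linarith) hγ
  rw [add_sub_cancel, Real.div_rpow hv hu.le, le_div_iff₀ (by positivity)] at h
  have h2 : u ^ γ = u ^ (γ - 1) * u := by rw [← Real.rpow_add_one hu.ne']; ring_nf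
  have h3 : (1 + γ * (v / u - 1)) * u ^ γ = u ^ γ + γ * (u ^ (γ - 1) * (v - u)) := by
    rw [h2]; field_simp
  rw [h3] at h
  unfold rate
  rw [le_div_iff₀ (by positivity)]
  have : (u ^ γ / (2 * γ) + u ^ (γ - 1) / 2 * (v - u)) * (2 * γ)
      = u ^ γ + γ * (u ^ (γ - 1) * (v - u)) := by field_simp
  linarith

/-- The supporting line of the rescaled rate function at a saddle point. -/
lemma rate_support_scaled {γ H m s t v : ℝ} (hγ : 1 ≤ γ) (hH : 0 < H) (hm : 0 ≤ m) (hs : 0 < s)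
    (hv : 0 ≤ v) (hst : t = m / H ^ γ * s ^ (γ - 1)) :
    m * rate γ (s / H) + t / 2 * (v - s) ≤ m * rate γ (v / H) := by
  have h := mul_le_mul_of_nonneg_left
    (rate_support hγ (div_pos hs hH) (div_nonneg hv hH.le)) hm
  have h2 : H ^ γ = H ^ (γ - 1) * H := by rw [← Real.rpow_add_one hH.ne']; ring_nf
  rw [Real.div_rpow hs.le hH.le] at h
  have : m * (s ^ (γ - 1) / H ^ (γ - 1) / 2 * (v / H - s / H)) = t / 2 * (v - s) := by
    rw [hst, h2]; field_simp
  rw [mul_add, this] at h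
  exact h

lemma two_mul_deriv_rate {γ u : ℝ} (hγ : 1 ≤ γ) (hu : 0 < u) :
    2 * u * deriv (rate γ) u = u ^ γ := by
  have h : HasDerivAt (rate γ) (γ * u ^ (γ - 1) / (2 * γ)) u :=
    (Real.hasDerivAt_rpow_const (Or.inl hu.ne')).div_const _
  have h2 : u ^ γ = u ^ (γ - 1) * u := by rw [← Real.rpow_add_one hu.ne']; ring_nf
  rw [h.deriv, h2]
  field_simp

lemma rpow_eq_one_iff_of_one_le {γ u : ℝ} (hγ : 1 ≤ γ) (hu : 0 < u) : u ^ γ = 1 ↔ u = 1 := by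
  rw [← Real.one_rpow γ]
  exact Real.rpow_left_inj hu.le zero_le_one (by linarith) |>.trans (by simp)

end Rate

/-! ### Crude Stirling bounds, sufficient on the exponential scale. -/

section Gamma

lemma log_Gamma_add_one_le {x : ℝ} (hx : 2 ≤ x) :
    Real.log (Real.Gamma (x + 1)) ≤ x * Real.log x - x + Real.log x + 2 := by
  have hx0 : 0 < x := by linarith
  -- Using the tangent to the logarithm at `x/r` leaves the decay `exp(-t/x)`, whose integral is
  -- `x`, at a cost `-x log r ≤ 2`.
  set r := 1 - 1 / x with hr
  have hxr : x * r = x - 1 := by rw [hr]; field_simp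
  have hr0 : 0 < r := by
    have : 0 < x * r := by rw [hxr]; linarith
    exact (mul_pos_iff_of_pos_left hx0).1 this
  set K := Real.exp (x * Real.log (x / r) - x) with hK
  have hpt : ∀ t ∈ Set.Ioi (0 : ℝ), Real.exp (-t) * t ^ (x + 1 - 1)
      ≤ K * Real.exp (-(1 / x) * t) := by
    intro t ht
    have ht : 0 < t := ht
    rw [add_sub_cancel_right, Real.rpow_def_of_pos ht, ← Real.exp_add, hK, ← Real.exp_add,
      Real.exp_le_exp]
    have h1 := Real.log_le_sub_one_of_pos (show 0 < t / (x / r) by positivity)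
    rw [Real.log_div ht.ne' (by positivity)] at h1
    have h2 := mul_le_mul_of_nonneg_left h1 hx0.le
    have h3 : x * (t / (x / r) - 1) = r * t - x := by field_simp
    have h4 : r * t = t - 1 / x * t := by rw [hr]; ring
    linarith
  have hneg : -(1 / x) < 0 := by
    have : 0 < 1 / x := by positivity
    linarith
  have h1 : Real.Gamma (x + 1) ≤ K * x := by
    rw [Real.Gamma_eq_integral (by linarith)]
    calc _ ≤ ∫ t in Set.Ioi (0 : ℝ), K * Real.exp (-(1 / x) * t) :=
          setIntegral_mono_on (Real.GammaIntegral_convergent (by linarith))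
            ((integrableOn_exp_mul_Ioi hneg 0).const_mul K) measurableSet_Ioi hpt
      _ = K * x := by
          rw [integral_const_mul, integral_exp_mul_Ioi hneg]
          simp
  calc Real.log (Real.Gamma (x + 1)) ≤ Real.log (K * x) :=
        Real.log_le_log (Real.Gamma_pos_of_pos (by linarith)) h1
    _ = x * Real.log x - x * Real.log r - x + Real.log x := by
        rw [Real.log_mul (Real.exp_pos _).ne' hx0.ne', Real.log_exp,
          Real.log_div hx0.ne' hr0.ne']
        ring
    _ ≤ _ := by
        have h2 := Real.one_sub_inv_le_log_of_pos hr0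
        have h3 := mul_le_mul_of_nonneg_left h2 hx0.le
        have h4 : x * (1 - r⁻¹) = - r⁻¹ := by
          have : x * (1 - r⁻¹) = (x * r - x) * r⁻¹ := by field_simp
          rw [this, hxr]; ring
        have h5 : r⁻¹ ≤ 2 := by
          rw [inv_le_comm₀ hr0 (by norm_num), hr]
          have : 1 / x ≤ 1 / 2 := one_div_le_one_div_of_le (by norm_num) hx
          linarith
        linarith

/-- Restrict Euler's integral to `(x, x+1]`, where `t^x ≥ x^x` and `e^(-t) ≥ e^(-x-1)`. -/
lemma le_log_Gamma_add_one {x : ℝ} (hx : 0 < x) :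
    x * Real.log x - x - 1 ≤ Real.log (Real.Gamma (x + 1)) := by
  have hsub : Set.Ioc x (x + 1) ⊆ Set.Ioi 0 := fun t ht => hx.trans ht.1
  have hconv := Real.GammaIntegral_convergent (show 0 < x + 1 by linarith)
  have h1 : Real.exp (x * Real.log x - x - 1) ≤ Real.Gamma (x + 1) := by
    rw [Real.Gamma_eq_integral (by linarith)]
    calc Real.exp (x * Real.log x - x - 1)
        = ∫ _ in Set.Ioc x (x + 1), Real.exp (x * Real.log x - x - 1) := by
          simp
      _ ≤ ∫ t in Set.Ioc x (x + 1), Real.exp (-t) * t ^ (x + 1 - 1) := by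
          refine setIntegral_mono_on (integrable_const _) (hconv.mono_set hsub)
            measurableSet_Ioc fun t ht => ?_
          have ht0 : 0 < t := hsub ht
          rw [add_sub_cancel_right, Real.rpow_def_of_pos ht0, ← Real.exp_add, Real.exp_le_exp]
          have h2 := Real.log_le_log hx ht.1.le
          have h3 := mul_le_mul_of_nonneg_left h2 hx.le
          have := ht.2
          linarith
      _ ≤ _ := by
          refine setIntegral_mono_set hconv ?_ hsub.eventuallyLE
          filter_upwards [ae_restrict_mem measurableSet_Ioi] with t ht
          have ht : 0 < t := ht
          simp only [Pi.zero_apply]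
          positivity
  rwa [Real.le_log_iff_exp_le (Real.Gamma_pos_of_pos (by linarith))]

lemma tendsto_log_Gamma {κ : ℝ} (hκ : 0 < κ) :
    Tendsto (fun d : ℕ => 1 / (d : ℝ) * Real.log (Real.Gamma (κ * d + 1))
      - κ * (Real.log κ + Real.log d) + κ) atTop (𝓝 0) := by
  have hlog : Tendsto (fun d : ℕ => Real.log d / (d : ℝ)) atTop (𝓝 0) :=
    (Real.isLittleO_log_id_atTop.tendsto_div_nhds_zero).comp tendsto_natCast_atTop_atTop
  have hc : ∀ a : ℝ, Tendsto (fun d : ℕ => a / (d : ℝ)) atTop (𝓝 0) :=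
    tendsto_const_div_atTop_nhds_zero_nat
  have hlow : Tendsto (fun d : ℕ => -1 / (d : ℝ)) atTop (𝓝 0) := hc (-1)
  have hup : Tendsto (fun d : ℕ => Real.log d / (d : ℝ) + (Real.log κ + 2) / (d : ℝ)) atTop
      (𝓝 0) := by simpa using hlog.add (hc _)
  have hlarge : ∀ᶠ d : ℕ in atTop, 2 ≤ κ * d :=
    (tendsto_natCast_atTop_atTop.const_mul_atTop hκ).eventually_ge_atTop 2
  refine tendsto_of_tendsto_of_tendsto_of_le_of_le' hlow hup ?_ ?_
  · filter_upwards [hlarge, eventually_gt_atTop 0] with d hd hd0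
    have hd0 : (0 : ℝ) < d := by exact_mod_cast hd0
    have h := le_log_Gamma_add_one (show 0 < κ * d by positivity)
    rw [Real.log_mul hκ.ne' hd0.ne'] at h
    have h2 := mul_le_mul_of_nonneg_left h (show 0 ≤ 1 / (d : ℝ) by positivity)
    have h3 : 1 / (d : ℝ) * (κ * d * (Real.log κ + Real.log d) - κ * d - 1)
      = κ * (Real.log κ + Real.log d) - κ + -1 / d := by field_simp; ring
    linarith
  · filter_upwards [hlarge, eventually_gt_atTop 0] with d hd hd0
    have hd0 : (0 : ℝ) < d := by exact_mod_cast hd0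
    have h := log_Gamma_add_one_le hd
    rw [Real.log_mul hκ.ne' hd0.ne'] at h
    have h2 := mul_le_mul_of_nonneg_left h (show 0 ≤ 1 / (d : ℝ) by positivity)
    have h3 : 1 / (d : ℝ) * (κ * d * (Real.log κ + Real.log d) - κ * d + (Real.log κ + Real.log d)
      + 2) = κ * (Real.log κ + Real.log d) - κ + (Real.log d / d + (Real.log κ + 2) / d) := by
      field_simp
      ring
    linarith

end Gamma

/-! ### The kernel's normalising constant. -/

section Normaliser

/-- The integral of the unnormalised kernel. -/
noncomputable def kernelMass (γ : ℝ) (d : ℕ) : ℝ :=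
  ∫ z : EuclideanSpace ℝ (Fin d), kernelShape γ z

lemma kernelShape_pos (γ : ℝ) {d : ℕ} (x : EuclideanSpace ℝ (Fin d)) : 0 < kernelShape γ x :=
  Real.exp_pos _

lemma kernelShape_continuous {γ : ℝ} (hγ : 1 ≤ γ) {d : ℕ} :
    Continuous (kernelShape γ (d := d)) := by
  unfold kernelShape
  have := rate_continuous hγ
  fun_prop

/-- A dilation by `b` turns the shape into `exp(-|z|^(2γ))`, whose integral is the unit ball volume
times `Γ(d/(2γ)+1)`. -/
lemma kernelMass_eq {γ : ℝ} (hγ : 1 ≤ γ) {d : ℕ} (hd : 0 < d) :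
    kernelMass γ d = (((d : ℝ) ^ (1 - γ) / (2 * γ)) ^ (1 / (2 * γ)))⁻¹ ^ d
      * (√Real.pi ^ d / Real.Gamma ((d : ℝ) / 2 + 1) * Real.Gamma (d / (2 * γ) + 1)) := by
  have hd' : (0 : ℝ) < d := by exact_mod_cast hd
  have : Nonempty (Fin d) := ⟨⟨0, hd⟩⟩
  have hγ0 : 0 < γ := by linarith
  set b := ((d : ℝ) ^ (1 - γ) / (2 * γ)) ^ (1 / (2 * γ)) with hb
  have hb0 : 0 < b := by positivity
  have h1 : ∀ z : EuclideanSpace ℝ (Fin d),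
      kernelShape γ z = Real.exp (-‖b • z‖ ^ (2 * γ)) := by
    intro z
    rw [kernelShape, norm_smul, Real.norm_of_nonneg hb0.le, Real.mul_rpow hb0.le (norm_nonneg _),
      hb, ← Real.rpow_mul (by positivity), one_div_mul_cancel (by positivity), Real.rpow_one, rate,
      Real.div_rpow (by positivity) hd'.le, Real.rpow_mul (norm_nonneg _), Real.rpow_two,
      Real.rpow_sub hd', Real.rpow_one]
    congr 1
    field_simp
  have h2 := measure_unitBall_eq_integral_div_gamma
    (volume : Measure (EuclideanSpace ℝ (Fin d))) (show 0 < 2 * γ by positivity)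
  rw [EuclideanSpace.volume_ball] at h2
  simp only [ENNReal.ofReal_one, one_pow, one_mul, Fintype.card_fin, finrank_euclideanSpace] at h2
  have hG1 : 0 < Real.Gamma ((d : ℝ) / 2 + 1) := Real.Gamma_pos_of_pos (by positivity)
  have hG2 : 0 < Real.Gamma ((d : ℝ) / (2 * γ) + 1) := Real.Gamma_pos_of_pos (by positivity)
  rw [ENNReal.ofReal_eq_ofReal_iff (by positivity)
    (div_nonneg (integral_nonneg fun _ => (Real.exp_pos _).le) hG2.le), eq_div_iff hG2.ne'] at h2
  rw [kernelMass]
  simp_rw [h1]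
  rw [Measure.integral_comp_smul volume
    (fun z : EuclideanSpace ℝ (Fin d) => Real.exp (-‖z‖ ^ (2 * γ))), h2, finrank_euclideanSpace,
    Fintype.card_fin, abs_of_pos (by positivity), smul_eq_mul, inv_pow]

lemma kernelMass_pos_of_pos {γ : ℝ} (hγ : 1 ≤ γ) {d : ℕ} (hd : 0 < d) : 0 < kernelMass γ d := by
  have hd' : (0 : ℝ) < d := by exact_mod_cast hd
  rw [kernelMass_eq hγ hd]
  have hG1 : 0 < Real.Gamma ((d : ℝ) / 2 + 1) := Real.Gamma_pos_of_pos (by positivity)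
  have hG2 : 0 < Real.Gamma ((d : ℝ) / (2 * γ) + 1) := Real.Gamma_pos_of_pos (by positivity)
  have := Real.pi_pos
  positivity

lemma integrable_kernelShape {γ : ℝ} (hγ : 1 ≤ γ) (d : ℕ) :
    Integrable (kernelShape γ (d := d)) := by
  rcases Nat.eq_zero_or_pos d with rfl | hd
  · exact (kernelShape_continuous hγ).integrable_of_hasCompactSupport
      (HasCompactSupport.of_compactSpace _)
  -- A non-integrable shape would have integral zero by convention, contradicting the positive
  -- closed form.
  · by_contra h
    exact (kernelMass_pos_of_pos hγ hd).ne' (integral_undef h)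

lemma kernelMass_pos {γ : ℝ} (hγ : 1 ≤ γ) (d : ℕ) : 0 < kernelMass γ d :=
  integral_exp_pos (integrable_kernelShape hγ d)

/-- The entropy per dimension of the normalised kernel, in the limit of large dimension. -/
noncomputable def kernelExponent (γ : ℝ) : ℝ :=
  1 / 2 * Real.log (2 * Real.pi) + 1 / 2 - 1 / (2 * γ)

/-- The `log d` terms from the dilation and the two Gamma factors cancel, which is why a finite
limit exists. -/
lemma tendsto_log_kernelMass {γ : ℝ} (hγ : 1 ≤ γ) :
    Tendsto (fun d : ℕ => 1 / (d : ℝ) * Real.log (kernelMass γ d)) atTop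
      (𝓝 (kernelExponent γ)) := by
  have hγ0 : 0 < γ := by linarith
  have hκ : 0 < 1 / (2 * γ) := by positivity
  have h := ((tendsto_log_Gamma hκ).sub (tendsto_log_Gamma (κ := 1 / 2) (by norm_num))).add
    (tendsto_const_nhds (x := kernelExponent γ))
  rw [sub_zero, zero_add] at h
  refine h.congr' ?_
  filter_upwards [eventually_gt_atTop 0] with d hd
  have hd' : (0 : ℝ) < d := by exact_mod_cast hd
  have hG1 : 0 < Real.Gamma ((d : ℝ) / 2 + 1) := Real.Gamma_pos_of_pos (by positivity)
  have hG2 : 0 < Real.Gamma ((d : ℝ) / (2 * γ) + 1) := Real.Gamma_pos_of_pos (by positivity)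
  have hpi := Real.pi_pos
  have e1 : Real.log ((d : ℝ) ^ (1 - γ) / (2 * γ)) = (1 - γ) * Real.log d - Real.log (2 * γ) := by
    rw [Real.log_div (by positivity) (by positivity), Real.log_rpow hd']
  have e2 : Real.log (1 / (2 * γ)) = -Real.log (2 * γ) := by rw [one_div, Real.log_inv]
  have e3 : Real.log (1 / 2) = -Real.log 2 := by rw [one_div, Real.log_inv]
  rw [kernelMass_eq hγ hd, Real.log_mul (by positivity) (by positivity),
    Real.log_mul (by positivity) hG2.ne', Real.log_div (by positivity) hG1.ne', Real.log_pow,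
    Real.log_pow, Real.log_inv, Real.log_rpow (by positivity), e1, e2, e3, Real.log_sqrt hpi.le,
    kernelExponent, Real.log_mul two_ne_zero hpi.ne',
    show 1 / (2 * γ) * (d : ℝ) = d / (2 * γ) by ring, show 1 / 2 * (d : ℝ) = d / 2 by ring]
  field_simp
  ring

end Normaliser

/-! ### Positivity and mass of the density estimator. -/

section Estimator

variable {γ : ℝ} {d : ℕ}

lemma gammaKernel_eq (γ : ℝ) (x : EuclideanSpace ℝ (Fin d)) :
    gammaKernel γ x = kernelShape γ x / kernelMass γ d := rfl

lemma gammaKernel_pos (hγ : 1 ≤ γ) (x : EuclideanSpace ℝ (Fin d)) : 0 < gammaKernel γ x :=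
  div_pos (kernelShape_pos γ x) (kernelMass_pos hγ d)

lemma gammaKernel_continuous (hγ : 1 ≤ γ) : Continuous (gammaKernel γ (d := d)) :=
  (kernelShape_continuous hγ).div_const _

lemma integrable_gammaKernel (hγ : 1 ≤ γ) : Integrable (gammaKernel γ (d := d)) :=
  (integrable_kernelShape hγ d).div_const _

lemma integral_gammaKernel (hγ : 1 ≤ γ) :
    ∫ x : EuclideanSpace ℝ (Fin d), gammaKernel γ x = 1 := by
  simp_rw [gammaKernel_eq]
  rw [integral_div]
  exact div_self (kernelMass_pos hγ d).ne'

lemma integrable_gammaKernel_comp (hγ : 1 ≤ γ) {h : ℝ} (hh : 0 < h)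
    (y : EuclideanSpace ℝ (Fin d)) : Integrable fun x => gammaKernel γ (h⁻¹ • (x - y)) :=
  ((integrable_gammaKernel hγ).comp_smul (inv_ne_zero hh.ne')).comp_sub_right y

lemma integral_gammaKernel_comp (hγ : 1 ≤ γ) {h : ℝ} (hh : 0 < h)
    (y : EuclideanSpace ℝ (Fin d)) : ∫ x, gammaKernel γ (h⁻¹ • (x - y)) = h ^ d := by
  rw [integral_sub_right_eq_self (fun x => gammaKernel γ (h⁻¹ • x)),
    Measure.integral_comp_smul volume (gammaKernel γ), integral_gammaKernel hγ,
    finrank_euclideanSpace, Fintype.card_fin, smul_eq_mul, mul_one, inv_pow, inv_inv,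
    abs_of_pos (by positivity)]

variable {n : ℕ}

lemma kde_pos (hγ : 1 ≤ γ) {h : ℝ} (hh : 0 < h) (hn : 0 < n)
    (y : Fin n → EuclideanSpace ℝ (Fin d)) (x : EuclideanSpace ℝ (Fin d)) : 0 < kde γ h y x := by
  have : Nonempty (Fin n) := ⟨⟨0, hn⟩⟩
  have hn' : (0 : ℝ) < n := by exact_mod_cast hn
  exact mul_pos (by positivity)
    (Finset.sum_pos (fun i _ => gammaKernel_pos hγ _) Finset.univ_nonempty)

lemma kde_continuous (hγ : 1 ≤ γ) (h : ℝ) :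
    Continuous fun p : (Fin n → EuclideanSpace ℝ (Fin d)) × EuclideanSpace ℝ (Fin d) =>
      kde γ h p.1 p.2 := by
  unfold kde
  have := gammaKernel_continuous hγ (d := d)
  fun_prop

lemma integrable_kde (hγ : 1 ≤ γ) {h : ℝ} (hh : 0 < h) (y : Fin n → EuclideanSpace ℝ (Fin d)) :
    Integrable (kde γ h y) :=
  (integrable_finsetSum _ fun i _ => integrable_gammaKernel_comp hγ hh (y i)).const_mul _

lemma integral_kde (hγ : 1 ≤ γ) {h : ℝ} (hh : 0 < h) (hn : 0 < n)
    (y : Fin n → EuclideanSpace ℝ (Fin d)) : ∫ x, kde γ h y x = 1 := by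
  have hn' : (0 : ℝ) < n := by exact_mod_cast hn
  unfold kde
  rw [integral_const_mul, integral_finsetSum _
    fun i _ => integrable_gammaKernel_comp hγ hh (y i)]
  simp_rw [integral_gammaKernel_comp hγ hh]
  simp
  field_simp

end Estimator

/-! ### Exponential tilting inequalities. -/

section Chernoff

variable {Ω : Type*} [MeasurableSpace Ω] {μ : Measure Ω} [IsProbabilityMeasure μ]

lemma integrable_exp_neg_of_nonneg {X : Ω → ℝ} (hX : Measurable X) (hX0 : ∀ ω, 0 ≤ X ω) :
    Integrable (fun ω => Real.exp (-X ω)) μ := by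
  refine Integrable.of_bound (by fun_prop) 1 (ae_of_all _ fun ω => ?_)
  rw [Real.norm_eq_abs, Real.abs_exp, Real.exp_le_one_iff]
  linarith [hX0 ω]

/-- A lower bound for the lower tail of a nonnegative variable by its Laplace transform at three
points. -/
lemma laplace_sub_le_measure_le {X : Ω → ℝ} (hX : Measurable X) (hX0 : ∀ ω, 0 ≤ X ω)
    {τ η a b : ℝ} (hη : 0 < η) (hτ : η < τ) :
    ∫ ω, Real.exp (-(τ * X ω)) ∂μ - Real.exp (-(η * b)) * ∫ ω, Real.exp (-((τ - η) * X ω)) ∂μ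
        - Real.exp (η * a) * ∫ ω, Real.exp (-((τ + η) * X ω)) ∂μ
      ≤ Real.exp (-(τ * a)) * μ.real {ω | X ω ≤ b} := by
  have hint : ∀ s, 0 ≤ s → Integrable (fun ω => Real.exp (-(s * X ω))) μ := fun s hs =>
    integrable_exp_neg_of_nonneg (by fun_prop) fun ω => mul_nonneg hs (hX0 ω)
  have h1 := hint τ (by linarith)
  have h2 := (hint (τ - η) (by linarith)).const_mul (Real.exp (-(η * b)))
  have h3 := (hint (τ + η) (by linarith)).const_mul (Real.exp (η * a))
  have hms : MeasurableSet {ω | X ω ≤ b} := hX measurableSet_Iic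
  have hR : Real.exp (-(τ * a)) * μ.real {ω | X ω ≤ b}
      = ∫ ω, {ω | X ω ≤ b}.indicator (fun _ => Real.exp (-(τ * a))) ω ∂μ := by
    rw [integral_indicator hms, setIntegral_const, smul_eq_mul, mul_comm]
  have h12 : Integrable (fun ω => Real.exp (-(τ * X ω))
      - Real.exp (-(η * b)) * Real.exp (-((τ - η) * X ω))) μ := h1.sub h2
  rw [hR, ← integral_const_mul, ← integral_const_mul, ← integral_sub h1 h2,
    ← integral_sub h12 h3]
  refine integral_mono (h12.sub h3) ((integrable_const _).indicator hms) fun ω => ?_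
  simp only
  rw [← Real.exp_add, ← Real.exp_add]
  have p2 := Real.exp_pos (-(η * b) + -((τ - η) * X ω))
  have p3 := Real.exp_pos (η * a + -((τ + η) * X ω))
  -- Each region is charged to one term: `X > b` to the transform at `τ - η`, `a ≤ X ≤ b` to the
  -- indicator, and `X ≤ a` to the transform at `τ + η`.
  by_cases hb : X ω ≤ b
  · rw [Set.indicator_of_mem (show ω ∈ {ω | X ω ≤ b} from hb)]
    rcases le_total a (X ω) with ha | ha
    · have : Real.exp (-(τ * X ω)) ≤ Real.exp (-(τ * a)) := by
        rw [Real.exp_le_exp]; nlinarith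
      linarith
    · have : Real.exp (-(τ * X ω)) ≤ Real.exp (η * a + -((τ + η) * X ω)) := by
        rw [Real.exp_le_exp]; nlinarith
      have := Real.exp_pos (-(τ * a))
      linarith
  · rw [Set.indicator_of_notMem (show ω ∉ {ω | X ω ≤ b} from hb)]
    have : Real.exp (-(τ * X ω)) ≤ Real.exp (-(η * b) + -((τ - η) * X ω)) := by
      rw [Real.exp_le_exp]; nlinarith [not_le.1 hb]
    linarith

/-- Jensen's inequality, through the tangent to the exponential at the mean. -/
lemma neg_integral_le_log_integral_exp {φ : Ω → ℝ} (hφ : Integrable φ μ)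
    (hexp : Integrable (fun ω => Real.exp (-φ ω)) μ) :
    -∫ ω, φ ω ∂μ ≤ Real.log (∫ ω, Real.exp (-φ ω) ∂μ) := by
  rw [Real.le_log_iff_exp_le (integral_exp_pos hexp)]
  set c := -∫ ω, φ ω ∂μ with hc
  have hint : Integrable (fun ω => Real.exp c * (1 + (-φ ω - c))) μ :=
    ((integrable_const _).add (hφ.neg.sub (integrable_const _))).const_mul _
  calc Real.exp c = ∫ ω, Real.exp c * (1 + (-φ ω - c)) ∂μ := by
        have h1 : ∫ ω, (1 + (-φ ω - c)) ∂μ = 1 := by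
          have h2 : ∀ ω, 1 + (-φ ω - c) = (1 - c) - φ ω := fun ω => by ring
          simp_rw [h2]
          rw [integral_sub (integrable_const _) hφ]
          simp [hc]
        rw [integral_const_mul, h1, mul_one]
    _ ≤ _ := by
        refine integral_mono hint hexp fun ω => ?_
        have h1 := Real.add_one_le_exp (-φ ω - c)
        have h2 : Real.exp (-φ ω) = Real.exp c * Real.exp (-φ ω - c) := by
          rw [← Real.exp_add]; ring_nf
        simp only
        rw [h2]
        exact mul_le_mul_of_nonneg_left (by linarith) (Real.exp_pos c).le

end Chernoff

/-! ### Large deviation lower bound for small balls. -/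

section SmallBall

variable {M : ℝ} {C : ∀ d : ℕ, Matrix (Fin d) (Fin d) ℝ} {hC : ∀ d, (C d).PosDef} {ρC : Measure ℝ}

/-- Closeness of the logarithmic Laplace transform to its limit at three points bounds the
probability of a ball from below. -/
lemma exp_le_measure_ball {d : ℕ} (hd : 0 < d) {A : Matrix (Fin d) (Fin d) ℝ}
    {t η a b κ p₀ p₁ p₂ : ℝ} (hη : 0 < η) (hηt : η < t) (x : EuclideanSpace ℝ (Fin d))
    (h0 : |1 / (d : ℝ) * Real.log (laplace A t x) + p₀| ≤ κ)
    (h1 : |1 / (d : ℝ) * Real.log (laplace A (t - η) x) + p₁| ≤ κ)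
    (h2 : |1 / (d : ℝ) * Real.log (laplace A (t + η) x) + p₂| ≤ κ)
    (hg1 : p₀ + 4 * κ ≤ p₁ + η * b / 2) (hg2 : p₀ + 4 * κ ≤ p₂ - η * a / 2)
    (hlarge : Real.exp (-(d * κ)) ≤ 1 / 4) :
    Real.exp (-(d * (p₀ - t * a / 2 + 2 * κ)))
      ≤ (gaussianLaw A).real {y | ‖x - y‖ ^ 2 ≤ d * b} := by
  have hd' : (0 : ℝ) < d := by exact_mod_cast hd
  have hlog : ∀ {s}, 0 < s → laplace A s x
      = Real.exp (d * (1 / (d : ℝ) * Real.log (laplace A s x))) := by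
    intro s hs
    rw [← mul_assoc, mul_one_div_cancel hd'.ne', one_mul, Real.exp_log (laplace_pos A hs.le x)]
  have key := laplace_sub_le_measure_le (μ := gaussianLaw A) (X := fun y => ‖x - y‖ ^ 2)
    (by fun_prop) (fun y => by positivity) (τ := t / 2) (η := η / 2) (a := d * a) (b := d * b)
    (by linarith) (by linarith)
  have e1 : (t / 2 - η / 2) = (t - η) / 2 := by ring
  have e2 : (t / 2 + η / 2) = (t + η) / 2 := by ring
  rw [e1, e2] at key
  change laplace A t x - _ * laplace A (t - η) x - _ * laplace A (t + η) x ≤ _ at key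
  rw [abs_le] at h0 h1 h2
  -- Powers of `q` count the slack: the main term keeps one factor, each error term carries three,
  -- and `q ≤ 1/4` gives `q - 2q³ ≥ q²`.
  set q := Real.exp (-(d * κ)) with hq
  have hq0 : 0 < q := Real.exp_pos _
  have l0 : Real.exp (-(d * p₀)) * q ≤ laplace A t x := by
    rw [hlog (show 0 < t by linarith), hq, ← Real.exp_add, Real.exp_le_exp, ← mul_neg, ← mul_neg,
      ← mul_add]
    exact mul_le_mul_of_nonneg_left (by linarith) hd'.le
  have l1 : Real.exp (-(η / 2 * (d * b))) * laplace A (t - η) x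
      ≤ Real.exp (-(d * p₀)) * (q * q * q) := by
    rw [hlog (show 0 < t - η by linarith), hq, ← Real.exp_add, ← Real.exp_add, ← Real.exp_add,
      ← Real.exp_add, Real.exp_le_exp]
    have := mul_le_mul_of_nonneg_left (show 1 / (d : ℝ) * Real.log (laplace A (t - η) x)
      ≤ η * b / 2 - p₀ - 3 * κ by linarith) hd'.le
    linarith
  have l2 : Real.exp (η / 2 * (d * a)) * laplace A (t + η) x
      ≤ Real.exp (-(d * p₀)) * (q * q * q) := by
    rw [hlog (show 0 < t + η by linarith), hq, ← Real.exp_add, ← Real.exp_add, ← Real.exp_add,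
      ← Real.exp_add, Real.exp_le_exp]
    have := mul_le_mul_of_nonneg_left (show 1 / (d : ℝ) * Real.log (laplace A (t + η) x)
      ≤ -(η * a / 2) - p₀ - 3 * κ by linarith) hd'.le
    linarith
  have l3 : Real.exp (-(d * p₀)) * (q * q) ≤ Real.exp (-(d * p₀)) * q
      - Real.exp (-(d * p₀)) * (q * q * q) - Real.exp (-(d * p₀)) * (q * q * q) := by
    have : q * q ≤ q - q * q * q - q * q * q := by nlinarith [mul_pos hq0 hq0]
    have := mul_le_mul_of_nonneg_left this (Real.exp_pos (-(d * p₀))).le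
    linarith
  have l4 : Real.exp (-(d * p₀)) * (q * q)
      ≤ Real.exp (-(t / 2 * (d * a))) * (gaussianLaw A).real {y | ‖x - y‖ ^ 2 ≤ d * b} := by
    linarith
  have l5 : Real.exp (-(d * (p₀ - t * a / 2 + 2 * κ)))
      = Real.exp (t / 2 * (d * a)) * (Real.exp (-(d * p₀)) * (q * q)) := by
    rw [hq, ← Real.exp_add, ← Real.exp_add, ← Real.exp_add]; congr 1; ring
  rw [l5]
  calc _ ≤ Real.exp (t / 2 * (d * a)) * (Real.exp (-(t / 2 * (d * a)))
        * (gaussianLaw A).real {y | ‖x - y‖ ^ 2 ≤ d * b}) :=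
        mul_le_mul_of_nonneg_left l4 (Real.exp_pos _).le
    _ = _ := by rw [← mul_assoc, ← Real.exp_add]; simp

lemma SpectralLimit.tendsto_measure_laplace_far (hlim : SpectralLimit hC ρC)
    [IsProbabilityMeasure ρC] (hM : ∀ d, (C d).trace ≤ M * d) {t κ : ℝ} (ht : 0 < t) (hκ : 0 < κ) :
    Tendsto (fun d : ℕ => (gaussianLaw (C d)).real
      {x | κ ≤ |1 / (d : ℝ) * Real.log (laplace (C d) t x) + psiOf ρC t|}) atTop (𝓝 0) := by
  have h := (hlim.tendsto_log_laplace hM ht).const_mul κ⁻¹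
  rw [mul_zero] at h
  refine squeeze_zero (fun d => measureReal_nonneg) (fun d => ?_) h
  rw [← div_eq_inv_mul, le_div_iff₀ hκ, mul_comm]
  exact mul_meas_ge_le_integral_of_nonneg (ae_of_all _ fun x => abs_nonneg _)
    ((integrable_log_laplace (hC d) ht).add (integrable_const _)).abs κ

/-- Large deviation lower bound for the probability of a ball, off a set of vanishing
probability. -/
lemma SpectralLimit.small_ball (hlim : SpectralLimit hC ρC)
    [IsProbabilityMeasure ρC] (hM : ∀ d, (C d).trace ≤ M * d) {t ε δ : ℝ} (ht : 0 < t)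
    (hε : 0 < ε) (hδ : 0 < δ) :
    ∃ B : ∀ d : ℕ, Set (EuclideanSpace ℝ (Fin d)), (∀ d, MeasurableSet (B d)) ∧
      Tendsto (fun d => (gaussianLaw (C d)).real (B d)) atTop (𝓝 0) ∧
      ∀ᶠ d : ℕ in atTop, ∀ x ∉ B d, Real.exp (-(d * (alphaOf ρC t + δ)))
        ≤ (gaussianLaw (C d)).real {y | ‖x - y‖ ^ 2 ≤ d * (lOf ρC t + ε)} := by
  have h0 := hlim.ae_nonneg
  have hi := hlim.integrable_id hM
  set s := lOf ρC t with hs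
  -- Half-width of the window around `s`; the bound `δ/t` limits the exponent loss `tε'/2` to `δ/2`.
  set ε' := min ε (δ / t) with hε'
  have hε'0 : 0 < ε' := lt_min hε (by positivity)
  have hε't : t * ε' ≤ δ := by
    calc t * ε' ≤ t * (δ / t) := mul_le_mul_of_nonneg_left (min_le_right _ _) ht.le
      _ = δ := by field_simp
  have hder := hasDerivAt_psiOf h0 hi ht
  rw [hasDerivAt_iff_isLittleO, Asymptotics.isLittleO_iff] at hder
  have hder' := hder (show 0 < ε' / 4 by positivity)
  rw [Metric.eventually_nhds_iff] at hder'
  obtain ⟨r, hr, hder''⟩ := hder'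
  set η := min (t / 2) (r / 2) with hη
  have hη0 : 0 < η := lt_min (by linarith) (by linarith)
  have hηt : η < t := (min_le_left _ _).trans_lt (by linarith)
  have hηr : η < r := (min_le_right _ _).trans_lt (by linarith)
  have d1 := hder'' (y := t - η) (by rw [Real.dist_eq]; simpa [abs_of_pos hη0] using hηr)
  have d2 := hder'' (y := t + η) (by rw [Real.dist_eq]; simpa [abs_of_pos hη0] using hηr)
  simp only [sub_sub_cancel_left, add_sub_cancel_left, smul_eq_mul, Real.norm_eq_abs,
    abs_neg, abs_of_pos hη0] at d1 d2
  rw [abs_le] at d1 d2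
  -- The window gains `ε'η/2` and the first-order expansion of `psiOf` loses `ε'η/4`, leaving the
  -- gap `4κ` needed; `δ/4` makes the remaining loss `2κ` at most `δ/2`.
  set κ := min (δ / 4) (ε' * η / 16) with hκ
  have hκ0 : 0 < κ := lt_min (by positivity) (by positivity)
  have hκ1 : κ ≤ δ / 4 := min_le_left _ _
  have hκ2 : κ ≤ ε' * η / 16 := min_le_right _ _
  let S : ℝ → ∀ d : ℕ, Set (EuclideanSpace ℝ (Fin d)) := fun u d =>
    {x | κ ≤ |1 / (d : ℝ) * Real.log (laplace (C d) u x) + psiOf ρC u|}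
  let B : ∀ d : ℕ, Set (EuclideanSpace ℝ (Fin d)) := fun d => S t d ∪ (S (t - η) d ∪ S (t + η) d)
  refine ⟨fun d => toMeasurable (gaussianLaw (C d)) (B d),
    fun d => measurableSet_toMeasurable _ _, ?_, ?_⟩
  · have hS : ∀ u, 0 < u → Tendsto (fun d => (gaussianLaw (C d)).real (S u d)) atTop (𝓝 0) :=
      fun u hu => hlim.tendsto_measure_laplace_far hM hu hκ0
    have hsum := (hS t ht).add ((hS (t - η) (by linarith)).add (hS (t + η) (by linarith)))
    simp only [add_zero] at hsum
    refine squeeze_zero (fun d => measureReal_nonneg) (fun d => ?_) hsum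
    rw [measureReal_def, measure_toMeasurable]
    exact (measureReal_union_le _ _).trans (by gcongr; exact measureReal_union_le _ _)
  · have hlarge : ∀ᶠ d : ℕ in atTop, Real.exp (-(d * κ)) ≤ 1 / 4 := by
      have : Tendsto (fun d : ℕ => Real.exp (-(d * κ))) atTop (𝓝 0) :=
        Real.tendsto_exp_atBot.comp (tendsto_neg_atTop_atBot.comp
          (tendsto_natCast_atTop_atTop.atTop_mul_const hκ0))
      exact (this.eventually_lt_const (by norm_num)).mono fun d hd => hd.le
    filter_upwards [hlarge, eventually_gt_atTop 0] with d hdl hd x hx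
    have hd' : (0 : ℝ) < d := by exact_mod_cast hd
    have hx' : x ∉ B d := fun h => hx (subset_toMeasurable _ _ h)
    simp only [B, S, Set.mem_union, Set.mem_ofPred_eq, not_or, not_le] at hx'
    have hball := exp_le_measure_ball hd (A := C d) (a := s - ε') (b := s + ε') hη0 hηt x
      hx'.1.le hx'.2.1.le hx'.2.2.le (by linarith) (by linarith) hdl
    refine le_trans ?_ (hball.trans (measureReal_mono (fun y hy => ?_)))
    · rw [Real.exp_le_exp, neg_le_neg_iff]
      refine mul_le_mul_of_nonneg_left ?_ hd'.le
      rw [alphaOf_eq h0 hi ht.le, ← hs]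
      linarith
    · exact le_trans (show ‖x - y‖ ^ 2 ≤ d * (s + ε') from hy)
        (mul_le_mul_of_nonneg_left (by linarith [min_le_left ε (δ / t)]) hd'.le)

end SmallBall

/-! ### Uniform integrability and a polynomial majorant of the energy. -/

section UniformIntegrability

/-- Young's inequality `f ≤ l f² + 1/(4l)` bounds the integral by `lK` plus a multiple of the
measure of `B`; then `l` is taken small. -/
lemma tendsto_setIntegral_of_sq_bounded {Ω : ℕ → Type*} [∀ d, MeasurableSpace (Ω d)]
    {μ : ∀ d, Measure (Ω d)} [∀ d, IsProbabilityMeasure (μ d)] {f : ∀ d, Ω d → ℝ} {K : ℝ}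
    (hf : ∀ d, Integrable (f d) (μ d)) (hf2 : ∀ d, Integrable (fun ω => f d ω ^ 2) (μ d))
    (hf0 : ∀ d ω, 0 ≤ f d ω)
    (hK : ∀ d, ∫ ω, f d ω ^ 2 ∂μ d ≤ K) {B : ∀ d, Set (Ω d)}
    (hlim : Tendsto (fun d => (μ d).real (B d)) atTop (𝓝 0)) :
    Tendsto (fun d => ∫ ω in B d, f d ω ∂μ d) atTop (𝓝 0) := by
  have hK0 : 0 ≤ K := (integral_nonneg fun ω => sq_nonneg _).trans (hK 0)
  have hbound : ∀ (l : ℝ), 0 < l → ∀ d,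
      ∫ ω in B d, f d ω ∂μ d ≤ l * K + 1 / (4 * l) * (μ d).real (B d) := by
    intro l hl d
    have h1 : ∫ ω in B d, f d ω ∂μ d ≤ ∫ ω in B d, (l * f d ω ^ 2 + 1 / (4 * l)) ∂μ d := by
      refine integral_mono (hf d).integrableOn
        (((hf2 d).integrableOn.const_mul l).add (integrable_const _)) fun ω => ?_
      have h2 : l * f d ω ^ 2 + 1 / (4 * l) - f d ω = l * (f d ω - 1 / (2 * l)) ^ 2 := by
        field_simp
        ring
      have h3 : 0 ≤ l * (f d ω - 1 / (2 * l)) ^ 2 := by positivity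
      simp only
      linarith
    rw [integral_add ((hf2 d).integrableOn.const_mul l) (integrable_const _), integral_const_mul,
      setIntegral_const, smul_eq_mul, mul_comm ((μ d).real (B d))] at h1
    have h4 : ∫ ω in B d, f d ω ^ 2 ∂μ d ≤ ∫ ω, f d ω ^ 2 ∂μ d :=
      setIntegral_le_integral (hf2 d) (ae_of_all _ fun ω => sq_nonneg _)
    have h5 := mul_le_mul_of_nonneg_left (h4.trans (hK d)) hl.le
    linarith
  rw [tendsto_order]
  refine ⟨fun a ha => Eventually.of_forall fun d =>
    ha.trans_le (integral_nonneg fun ω => hf0 d ω), fun a ha => ?_⟩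
  set l := a / (2 * (K + 1)) with hl
  have hl0 : 0 < l := by positivity
  have h1 := (hlim.const_mul (1 / (4 * l))).const_add (l * K)
  rw [mul_zero, add_zero] at h1
  have h2 : l * K < a := by
    rw [hl, div_mul_eq_mul_div, div_lt_iff₀ (by positivity)]
    nlinarith
  filter_upwards [h1.eventually_lt_const h2] with d hd
  exact (hbound l hl0 d).trans_lt hd

/-- The constant in the comparison of the rate of a difference with moments of its terms. -/
noncomputable def rateConst (γ H : ℝ) : ℝ := (2 / H) ^ γ * 2 ^ (γ - 1) / (2 * γ)

lemma rateConst_nonneg {γ H : ℝ} (hγ : 1 ≤ γ) (hH : 0 < H) : 0 ≤ rateConst γ H := by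
  unfold rateConst; positivity

lemma rate_norm_sub_le {γ H : ℝ} (hγ : 1 ≤ γ) (hH : 0 < H) {d : ℕ}
    (x y : EuclideanSpace ℝ (Fin d)) :
    rate γ (‖x - y‖ ^ 2 / d / H)
      ≤ rateConst γ H * ((‖x‖ ^ 2 / d) ^ γ + (‖y‖ ^ 2 / d) ^ γ) := by
  have h1 : ‖x - y‖ ^ 2 ≤ 2 * ‖x‖ ^ 2 + 2 * ‖y‖ ^ 2 := by
    have h2 := norm_sub_le x y
    nlinarith [norm_nonneg (x - y), sq_nonneg (‖x‖ - ‖y‖)]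
  have h3 : ‖x - y‖ ^ 2 / d / H ≤ 2 / H * (‖x‖ ^ 2 / d + ‖y‖ ^ 2 / d) := by
    calc ‖x - y‖ ^ 2 / d / H ≤ (2 * ‖x‖ ^ 2 + 2 * ‖y‖ ^ 2) / d / H := by gcongr
      _ = _ := by ring
  have h4 := rate_mono hγ (show 0 ≤ ‖x - y‖ ^ 2 / d / H by positivity) h3
  refine h4.trans ?_
  have h5 : ∀ u v : NNReal, ((u : ℝ) + v) ^ γ ≤ 2 ^ (γ - 1) * ((u : ℝ) ^ γ + (v : ℝ) ^ γ) :=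
    fun u v => by exact_mod_cast NNReal.rpow_add_le_mul_rpow_add_rpow u v hγ
  have h6 := h5 ⟨‖x‖ ^ 2 / d, by positivity⟩ ⟨‖y‖ ^ 2 / d, by positivity⟩
  change (‖x‖ ^ 2 / d + ‖y‖ ^ 2 / d) ^ γ
    ≤ 2 ^ (γ - 1) * ((‖x‖ ^ 2 / d) ^ γ + (‖y‖ ^ 2 / d) ^ γ) at h6
  have h7 := mul_le_mul_of_nonneg_left h6 (show 0 ≤ (2 / H) ^ γ / (2 * γ) by positivity)
  have h8 : rate γ (2 / H * (‖x‖ ^ 2 / d + ‖y‖ ^ 2 / d))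
      = (2 / H) ^ γ * (‖x‖ ^ 2 / d + ‖y‖ ^ 2 / d) ^ γ / (2 * γ) := by
    rw [rate, Real.mul_rpow (by positivity) (by positivity)]
  rw [h8, rateConst]
  refine le_trans (le_of_eq ?_) (h7.trans_eq ?_) <;> ring

end UniformIntegrability

/-! ### Upper and lower bounds for the annealed exponent at a given test point. -/

section LogExp

variable {γ H m : ℝ} {d : ℕ} {A : Matrix (Fin d) (Fin d) ℝ}

/-- `(1 / d) log 𝔼_y exp (-d m f(|x - y|² / (d H)))`. -/
noncomputable def logExp (γ H m : ℝ) {d : ℕ} (A : Matrix (Fin d) (Fin d) ℝ)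
    (x : EuclideanSpace ℝ (Fin d)) : ℝ :=
  1 / (d : ℝ) * Real.log (∫ y, Real.exp (-(d * (m * rate γ (‖x - y‖ ^ 2 / d / H)))) ∂gaussianLaw A)

lemma kernelShape_smul_sub {h : ℝ} (x y : EuclideanSpace ℝ (Fin d)) :
    kernelShape γ (h⁻¹ • (x - y)) = Real.exp (-(d * rate γ (‖x - y‖ ^ 2 / d / h ^ 2))) := by
  rw [kernelShape, norm_smul, mul_pow, norm_inv, Real.norm_eq_abs, inv_pow, sq_abs]
  congr 4
  ring

lemma integrable_exp_rate (hγ : 1 ≤ γ) (hH : 0 < H) (hm : 0 ≤ m) (A : Matrix (Fin d) (Fin d) ℝ)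
    (x : EuclideanSpace ℝ (Fin d)) :
    Integrable (fun y => Real.exp (-(d * (m * rate γ (‖x - y‖ ^ 2 / d / H))))) (gaussianLaw A) :=
  have := (rate_continuous hγ).measurable
  integrable_exp_neg_of_nonneg (by fun_prop) fun y =>
    mul_nonneg (Nat.cast_nonneg d) (mul_nonneg hm (rate_nonneg hγ (by positivity)))

lemma gFun_eq (hγ : 1 ≤ γ) {h : ℝ} (hh : 0 < h) (hm : 0 ≤ m) (A : Matrix (Fin d) (Fin d) ℝ)
    (x : EuclideanSpace ℝ (Fin d)) :
    gFun γ A h m x = logExp γ (h ^ 2) m A x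
      - m * (1 / (d : ℝ) * Real.log (kernelMass γ d)) - m * Real.log h := by
  have hI := kernelMass_pos hγ d
  have h1 : ∀ y, gammaKernel γ (h⁻¹ • (x - y)) ^ m
      = Real.exp (-(d * (m * rate γ (‖x - y‖ ^ 2 / d / h ^ 2)))) / kernelMass γ d ^ m := by
    intro y
    rw [gammaKernel_eq, kernelShape_smul_sub, Real.div_rpow (Real.exp_pos _).le hI.le,
      ← Real.exp_mul]
    congr 2
    ring
  rw [gFun, logExp]
  simp_rw [h1]
  rw [integral_div, Real.log_div
    (integral_exp_pos (integrable_exp_rate hγ (by positivity) hm A x)).ne' (by positivity),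
    Real.log_rpow hI]
  ring

lemma logExp_nonpos (hγ : 1 ≤ γ) (hH : 0 < H) (hm : 0 ≤ m) (A : Matrix (Fin d) (Fin d) ℝ)
    (x : EuclideanSpace ℝ (Fin d)) : logExp γ H m A x ≤ 0 := by
  refine mul_nonpos_of_nonneg_of_nonpos (by positivity) (Real.log_nonpos
    (integral_nonneg fun y => (Real.exp_pos _).le) ?_)
  calc _ ≤ ∫ _, (1 : ℝ) ∂gaussianLaw A := by
        refine integral_mono (integrable_exp_rate hγ hH hm A x) (integrable_const _) fun y => ?_
        simp only
        rw [Real.exp_le_one_iff]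
        have : 0 ≤ d * (m * rate γ (‖x - y‖ ^ 2 / d / H)) :=
          mul_nonneg (Nat.cast_nonneg d) (mul_nonneg hm (rate_nonneg hγ (by positivity)))
        linarith
    _ = 1 := by simp

/-- The `γ`-th moment of the normalised squared norm. -/
noncomputable def meanRpow (γ : ℝ) {d : ℕ} (A : Matrix (Fin d) (Fin d) ℝ) : ℝ :=
  ∫ x, (‖x‖ ^ 2 / d) ^ γ ∂gaussianLaw A

lemma meanRpow_nonneg (γ : ℝ) (A : Matrix (Fin d) (Fin d) ℝ) : 0 ≤ meanRpow γ A :=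
  integral_nonneg fun x => by positivity

lemma integrable_rate (hA : A.PosDef) (hγ : 1 ≤ γ) (hH : 0 < H) (x : EuclideanSpace ℝ (Fin d)) :
    Integrable (fun y => rate γ (‖x - y‖ ^ 2 / d / H)) (gaussianLaw A) := by
  have := (rate_continuous hγ).measurable
  refine (((integrable_const ((‖x‖ ^ 2 / d) ^ γ)).add (integrable_norm_sq_rpow hA hγ)).const_mul
    (rateConst γ H)).mono' (Measurable.aestronglyMeasurable (by fun_prop)) (ae_of_all _ fun y => ?_)
  rw [Real.norm_of_nonneg (rate_nonneg hγ (by positivity))]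
  exact rate_norm_sub_le hγ hH x y

/-- Jensen's inequality followed by the polynomial majorant. The bound is crude but holds for every
`x`, as needed on the exceptional set of the small ball estimate. -/
lemma neg_le_logExp (hA : A.PosDef) (hγ : 1 ≤ γ) (hH : 0 < H) (hm : 0 ≤ m)
    (x : EuclideanSpace ℝ (Fin d)) :
    -(m * rateConst γ H * ((‖x‖ ^ 2 / d) ^ γ + meanRpow γ A)) ≤ logExp γ H m A x := by
  rcases Nat.eq_zero_or_pos d with rfl | hd
  · have : 0 ≤ m * rateConst γ H * ((‖x‖ ^ 2 / (0 : ℕ)) ^ γ + meanRpow γ A) := by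
      have := rateConst_nonneg hγ hH
      have := meanRpow_nonneg γ A
      positivity
    simp only [logExp, Nat.cast_zero, div_zero, zero_mul] at this ⊢
    linarith
  have hd' : (0 : ℝ) < d := by exact_mod_cast hd
  have hir := integrable_rate hA hγ hH x
  have h1 := neg_integral_le_log_integral_exp ((hir.const_mul m).const_mul (d : ℝ))
    (integrable_exp_rate hγ hH hm A x)
  rw [integral_const_mul, integral_const_mul] at h1
  have h2 : ∫ y, rate γ (‖x - y‖ ^ 2 / d / H) ∂gaussianLaw A
      ≤ rateConst γ H * ((‖x‖ ^ 2 / d) ^ γ + meanRpow γ A) := by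
    calc _ ≤ ∫ y, rateConst γ H * ((‖x‖ ^ 2 / d) ^ γ + (‖y‖ ^ 2 / d) ^ γ) ∂gaussianLaw A :=
          integral_mono hir (((integrable_const _).add (integrable_norm_sq_rpow hA hγ)).const_mul _)
            fun y => rate_norm_sub_le hγ hH x y
      _ = _ := by
          rw [integral_const_mul, integral_add (integrable_const _) (integrable_norm_sq_rpow hA hγ)]
          simp [meanRpow]
  have h3 := mul_le_mul_of_nonneg_left h2 hm
  have h4 := mul_le_mul_of_nonneg_left h1 (show 0 ≤ 1 / (d : ℝ) by positivity)
  have h5 : 1 / (d : ℝ) * -(d * (m * ∫ y, rate γ (‖x - y‖ ^ 2 / d / H) ∂gaussianLaw A))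
      = -(m * ∫ y, rate γ (‖x - y‖ ^ 2 / d / H) ∂gaussianLaw A) := by field_simp
  rw [h5] at h4
  unfold logExp
  linarith

lemma integrable_logExp (hA : A.PosDef) (hγ : 1 ≤ γ) (hH : 0 < H) (hm : 0 ≤ m) :
    Integrable (logExp γ H m A) (gaussianLaw A) := by
  have hr := (rate_continuous hγ).measurable
  have hmeas : StronglyMeasurable fun x => ∫ y, Real.exp (-(d * (m * rate γ (‖x - y‖ ^ 2 / d / H))))
      ∂gaussianLaw A := by
    refine StronglyMeasurable.integral_prod_right
      (f := fun x y => Real.exp (-(d * (m * rate γ (‖x - y‖ ^ 2 / d / H))))) ?_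
    refine Measurable.stronglyMeasurable ?_
    unfold Function.uncurry
    fun_prop
  refine ((((integrable_norm_sq_rpow hA hγ).add (integrable_const (meanRpow γ A))).const_mul
    (m * rateConst γ H))).mono' ?_ (ae_of_all _ fun x => ?_)
  · exact ((Real.measurable_log.comp hmeas.measurable).const_mul _).aestronglyMeasurable
  · rw [Real.norm_eq_abs, abs_of_nonpos (logExp_nonpos hγ hH hm A x)]
    have := neg_le_logExp hA hγ hH hm x
    simp only [Pi.add_apply]
    linarith

/-- Chernoff upper bound at a saddle point. -/
lemma logExp_le (hγ : 1 ≤ γ) (hH : 0 < H) (hm : 0 ≤ m) (hd : 0 < d)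
    {s t : ℝ} (hs : 0 < s) (ht : 0 < t) (hst : t = m / H ^ γ * s ^ (γ - 1))
    (x : EuclideanSpace ℝ (Fin d)) :
    logExp γ H m A x ≤ -(m * rate γ (s / H)) + t / 2 * s
      + 1 / (d : ℝ) * Real.log (laplace A t x) := by
  have hd' : (0 : ℝ) < d := by exact_mod_cast hd
  have hle : ∫ y, Real.exp (-(d * (m * rate γ (‖x - y‖ ^ 2 / d / H)))) ∂gaussianLaw A
      ≤ Real.exp (d * (-(m * rate γ (s / H)) + t / 2 * s)) * laplace A t x := by
    rw [laplace, ← integral_const_mul]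
    refine integral_mono (integrable_exp_rate hγ hH hm A x)
      ((integrable_exp_neg_sq_dist A ht.le x).const_mul _) fun y => ?_
    simp only
    rw [← Real.exp_add, Real.exp_le_exp]
    have h1 := rate_support_scaled hγ hH hm hs (show 0 ≤ ‖x - y‖ ^ 2 / d by positivity) hst
    have h2 := mul_le_mul_of_nonneg_left h1 hd'.le
    have h3 : (d : ℝ) * (m * rate γ (s / H) + t / 2 * (‖x - y‖ ^ 2 / d - s))
        = d * (m * rate γ (s / H)) + t / 2 * ‖x - y‖ ^ 2 - d * (t / 2 * s) := by
      field_simp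
      ring
    linarith
  have h1 := Real.log_le_log (integral_exp_pos (integrable_exp_rate hγ hH hm A x)) hle
  rw [Real.log_mul (Real.exp_pos _).ne' (laplace_pos A ht.le x).ne', Real.log_exp] at h1
  have h2 := mul_le_mul_of_nonneg_left h1 (show 0 ≤ 1 / (d : ℝ) by positivity)
  rw [mul_add, ← mul_assoc, one_div_mul_cancel hd'.ne', one_mul] at h2
  exact h2

/-- Lower bound by the probability of a ball. -/
lemma le_logExp_of_ball (hγ : 1 ≤ γ) (hH : 0 < H) (hm : 0 ≤ m) (hd : 0 < d) {b I : ℝ}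
    {x : EuclideanSpace ℝ (Fin d)}
    (hball : Real.exp (-(d * I)) ≤ (gaussianLaw A).real {y | ‖x - y‖ ^ 2 ≤ d * b}) :
    -(m * rate γ (b / H)) - I ≤ logExp γ H m A x := by
  have hd' : (0 : ℝ) < d := by exact_mod_cast hd
  have hms : MeasurableSet {y : EuclideanSpace ℝ (Fin d) | ‖x - y‖ ^ 2 ≤ d * b} :=
    (by fun_prop : Measurable fun y : EuclideanSpace ℝ (Fin d) => ‖x - y‖ ^ 2) measurableSet_Iic
  have h1 : Real.exp (-(d * (m * rate γ (b / H)))) * Real.exp (-(d * I))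
      ≤ ∫ y, Real.exp (-(d * (m * rate γ (‖x - y‖ ^ 2 / d / H)))) ∂gaussianLaw A := by
    calc _ ≤ Real.exp (-(d * (m * rate γ (b / H))))
          * (gaussianLaw A).real {y | ‖x - y‖ ^ 2 ≤ d * b} :=
          mul_le_mul_of_nonneg_left hball (Real.exp_pos _).le
      _ = ∫ y in {y | ‖x - y‖ ^ 2 ≤ d * b}, Real.exp (-(d * (m * rate γ (b / H))))
          ∂gaussianLaw A := by rw [setIntegral_const, smul_eq_mul, mul_comm]
      _ ≤ ∫ y in {y | ‖x - y‖ ^ 2 ≤ d * b},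
          Real.exp (-(d * (m * rate γ (‖x - y‖ ^ 2 / d / H)))) ∂gaussianLaw A := by
          refine setIntegral_mono_on (integrable_const _)
            (integrable_exp_rate hγ hH hm A x).integrableOn hms fun y hy => ?_
          rw [Real.exp_le_exp, neg_le_neg_iff]
          have hy' : ‖x - y‖ ^ 2 / d ≤ b := by
            rw [div_le_iff₀ hd', mul_comm]; exact hy
          refine mul_le_mul_of_nonneg_left (mul_le_mul_of_nonneg_left
            (rate_mono hγ (by positivity) ?_) hm) hd'.le
          gcongr
      _ ≤ _ := setIntegral_le_integral (integrable_exp_rate hγ hH hm A x)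
          (ae_of_all _ fun y => (Real.exp_pos _).le)
  rw [← Real.exp_add, ← Real.le_log_iff_exp_le
    (integral_exp_pos (integrable_exp_rate hγ hH hm A x))] at h1
  have h2 := mul_le_mul_of_nonneg_left h1 (show 0 ≤ 1 / (d : ℝ) by positivity)
  have h3 : 1 / (d : ℝ) * (-(d * (m * rate γ (b / H))) + -(d * I))
      = -(m * rate γ (b / H)) - I := by field_simp; ring
  rw [h3] at h2
  exact h2

end LogExp

/-! ### Closed form of the limit `gBar`. -/

section MeanLimit

variable {M γ : ℝ} {C : ∀ d : ℕ, Matrix (Fin d) (Fin d) ℝ} {hC : ∀ d, (C d).PosDef}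
  {ρC : Measure ℝ}

/-- The limit of the mean of `logExp`. -/
noncomputable def logExpLimit (ρC : Measure ℝ) (γ H m : ℝ) : ℝ :=
  -(m * rate γ (lOf ρC (tilt ρC γ (m / H ^ γ)) / H)) - alphaOf ρC (tilt ρC γ (m / H ^ γ))

lemma meanRpow_le (hC : ∀ d, (C d).PosDef) (hγ : 1 ≤ γ) (hM : ∀ d, (C d).trace ≤ M * d) (d : ℕ) :
    meanRpow γ (C d) ≤ |M| ^ γ * stdMoment γ :=
  integral_norm_sq_rpow_le (hC d) hγ (hM d)

lemma integrable_rpow_sq {d : ℕ} {A : Matrix (Fin d) (Fin d) ℝ} (hA : A.PosDef) (hγ : 1 ≤ γ) :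
    Integrable (fun x => ((‖x‖ ^ 2 / d) ^ γ) ^ 2) (gaussianLaw A) := by
  refine (integrable_norm_sq_rpow hA (p := γ * 2) (by linarith)).congr (ae_of_all _ fun x => ?_)
  simp only
  rw [Real.rpow_mul (by positivity), Real.rpow_two]

lemma integral_rpow_sq_le (hC : ∀ d, (C d).PosDef) (hγ : 1 ≤ γ) (hM : ∀ d, (C d).trace ≤ M * d)
    (d : ℕ) :
    ∫ x, ((‖x‖ ^ 2 / d) ^ γ) ^ 2 ∂gaussianLaw (C d) ≤ |M| ^ (γ * 2) * stdMoment (γ * 2) := by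
  refine le_trans (le_of_eq ?_) (integral_norm_sq_rpow_le (hC d) (p := γ * 2) (by linarith) (hM d))
  congr 1; ext x
  rw [Real.rpow_mul (by positivity), Real.rpow_two]

lemma SpectralLimit.tendsto_integral_log_laplace (hlim : SpectralLimit hC ρC)
    [IsProbabilityMeasure ρC] (hM : ∀ d, (C d).trace ≤ M * d) {t : ℝ} (ht : 0 < t) :
    Tendsto (fun d : ℕ => ∫ x, 1 / (d : ℝ) * Real.log (laplace (C d) t x) ∂gaussianLaw (C d)) atTop
      (𝓝 (-psiOf ρC t)) := by
  rw [tendsto_iff_dist_tendsto_zero]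
  refine squeeze_zero (fun d => dist_nonneg) (fun d => ?_) (hlim.tendsto_log_laplace hM ht)
  have hint := integrable_log_laplace (hC d) ht
  rw [Real.dist_eq, sub_neg_eq_add]
  refine le_trans (le_of_eq ?_) abs_integral_le_integral_abs
  rw [integral_add hint (integrable_const _)]
  simp

/-- From below: the small ball bound off the exceptional set and Jensen on it, the latter
contribution vanishing by uniform integrability. From above: Chernoff at the saddle. The two values
agree by the Legendre relation. -/
lemma SpectralLimit.tendsto_integral_logExp (hlim : SpectralLimit hC ρC)
    [IsProbabilityMeasure ρC] (hM : ∀ d, (C d).trace ≤ M * d) (hρC : ρC ≠ Measure.dirac 0)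
    (hγ : 1 ≤ γ) {H m : ℝ} (hH : 0 < H) (hm : 0 < m) :
    Tendsto (fun d : ℕ => ∫ x, logExp γ H m (C d) x ∂gaussianLaw (C d)) atTop
      (𝓝 (logExpLimit ρC γ H m)) := by
  have h0 := hlim.ae_nonneg
  have hi := hlim.integrable_id hM
  have hpos := measure_Ioi_pos h0 hρC
  obtain ⟨ht, hteq⟩ := tilt_spec h0 hi hpos hγ (show 0 < m / H ^ γ by positivity)
  rw [logExpLimit]
  set t := tilt ρC γ (m / H ^ γ) with htdef
  set s := lOf ρC t with hs
  have hs0 : 0 < s := lOf_pos h0 hi hpos ht.le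
  rw [tendsto_order]
  constructor
  · intro a ha
    have hcont : Tendsto (fun ε => -(m * rate γ ((s + ε) / H)) - alphaOf ρC t - ε) (𝓝[>] 0)
        (𝓝 (-(m * rate γ ((s + 0) / H)) - alphaOf ρC t - 0)) := by
      refine (Continuous.tendsto ?_ 0).mono_left nhdsWithin_le_nhds
      have := rate_continuous hγ
      fun_prop
    rw [add_zero, sub_zero] at hcont
    obtain ⟨ε, hεa, hε⟩ := ((hcont.eventually_const_lt ha).and self_mem_nhdsWithin).exists
    have hε : 0 < ε := hε
    obtain ⟨B, hBm, hB0, hB⟩ := hlim.small_ball hM ht hε hε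
    set K := |M| ^ γ * stdMoment γ with hK
    have hK0 : 0 ≤ K := mul_nonneg (by positivity) (stdMoment_nonneg γ)
    have hkey := tendsto_setIntegral_of_sq_bounded
      (μ := fun d => gaussianLaw (C d)) (B := B)
      (f := fun d x => m * rateConst γ H * ((‖x‖ ^ 2 / d) ^ γ + meanRpow γ (C d)))
      (K := (m * rateConst γ H) ^ 2 * (2 * (|M| ^ (γ * 2) * stdMoment (γ * 2)) + 2 * K ^ 2))
      (fun d => ((integrable_norm_sq_rpow (hC d) hγ).add (integrable_const _)).const_mul _)
      (fun d => ?_) (fun d x => ?_) (fun d => ?_) hB0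
    · have h1 := hkey.neg.const_add (-(m * rate γ ((s + ε) / H)) - alphaOf ρC t - ε)
      rw [neg_zero, add_zero] at h1
      filter_upwards [h1.eventually_const_lt hεa, hB, eventually_gt_atTop 0] with d hd hdB hd0
      refine hd.trans_le ?_
      set c := -(m * rate γ ((s + ε) / H)) - alphaOf ρC t - ε with hc
      have hα0 : 0 ≤ alphaOf ρC t := by
        have := (alphaOf_strictMonoOn h0 hi hpos).monotoneOn (Set.mem_Ici.2 le_rfl)
          (Set.mem_Ici.2 ht.le) ht.le
        rwa [alphaOf_zero] at this
      -- On the exceptional set the comparison function is `c` minus the Jensen bound, a valid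
      -- minorant only because `c ≤ 0`.
      have hc0 : c ≤ 0 := by
        have := mul_nonneg hm.le (rate_nonneg hγ (show 0 ≤ (s + ε) / H by positivity))
        rw [hc]; linarith
      have hfi : Integrable (fun x => m * rateConst γ H * ((‖x‖ ^ 2 / d) ^ γ + meanRpow γ (C d)))
          (gaussianLaw (C d)) :=
        ((integrable_norm_sq_rpow (hC d) hγ).add (integrable_const _)).const_mul _
      rw [← integral_indicator (hBm d)]
      have e1 : c + -∫ x, (B d).indicator (fun x => m * rateConst γ H *
            ((‖x‖ ^ 2 / d) ^ γ + meanRpow γ (C d))) x ∂gaussianLaw (C d)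
          = ∫ x, (c - (B d).indicator (fun x => m * rateConst γ H *
            ((‖x‖ ^ 2 / d) ^ γ + meanRpow γ (C d))) x) ∂gaussianLaw (C d) := by
        rw [integral_sub (integrable_const _) (hfi.indicator (hBm d))]
        simp [sub_eq_add_neg]
      rw [e1]
      refine integral_mono ((integrable_const _).sub (hfi.indicator (hBm d)))
        (integrable_logExp (hC d) hγ hH hm.le) fun x => ?_
      simp only
      by_cases hx : x ∈ B d
      · rw [Set.indicator_of_mem hx]
        have := neg_le_logExp (hC d) hγ hH hm.le x
        linarith
      · rw [Set.indicator_of_notMem hx]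
        have := le_logExp_of_ball hγ hH hm.le hd0 (hdB x hx)
        linarith
    · have e : (fun x : EuclideanSpace ℝ (Fin d) =>
          (m * rateConst γ H * ((‖x‖ ^ 2 / d) ^ γ + meanRpow γ (C d))) ^ 2)
          = fun x => (m * rateConst γ H) ^ 2 * (((‖x‖ ^ 2 / d) ^ γ) ^ 2
            + 2 * meanRpow γ (C d) * (‖x‖ ^ 2 / d) ^ γ + meanRpow γ (C d) ^ 2) := by
        ext x; ring
      rw [e]
      exact (((integrable_rpow_sq (hC d) hγ).add
        ((integrable_norm_sq_rpow (hC d) hγ).const_mul _)).add (integrable_const _)).const_mul _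
    · have := rateConst_nonneg hγ hH
      have := meanRpow_nonneg γ (C d)
      positivity
    · have hi2 : Integrable (fun x => 2 * ((‖x‖ ^ 2 / d) ^ γ) ^ 2) (gaussianLaw (C d)) :=
        (integrable_rpow_sq (hC d) hγ).const_mul 2
      have hmono : ∫ x, (m * rateConst γ H * ((‖x‖ ^ 2 / d) ^ γ + meanRpow γ (C d))) ^ 2
            ∂gaussianLaw (C d)
          ≤ ∫ x, (m * rateConst γ H) ^ 2 * (2 * ((‖x‖ ^ 2 / d) ^ γ) ^ 2 + 2 * K ^ 2)
            ∂gaussianLaw (C d) := by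
        refine integral_mono_of_nonneg (ae_of_all _ fun x => sq_nonneg _)
          ((hi2.add (integrable_const _)).const_mul _) (ae_of_all _ fun x => ?_)
        simp only
        rw [mul_pow]
        refine mul_le_mul_of_nonneg_left ?_ (sq_nonneg _)
        have h1 := meanRpow_le hC hγ hM d
        have h2 := meanRpow_nonneg γ (C d)
        have h3 : meanRpow γ (C d) ^ 2 ≤ K ^ 2 := pow_le_pow_left₀ h2 h1 2
        nlinarith [sq_nonneg ((‖x‖ ^ 2 / d) ^ γ - meanRpow γ (C d))]
      refine hmono.trans ?_
      rw [integral_const_mul, integral_add hi2 (integrable_const _), integral_const_mul]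
      refine mul_le_mul_of_nonneg_left ?_ (sq_nonneg _)
      have := integral_rpow_sq_le hC hγ hM d
      simp only [integral_const, probReal_univ, one_smul]
      linarith
  · intro a ha
    have h1 := (hlim.tendsto_integral_log_laplace hM ht).const_add
      (-(m * rate γ (s / H)) + t / 2 * s)
    have h2 : -(m * rate γ (s / H)) + t / 2 * s + -psiOf ρC t < a := by
      rw [alphaOf_eq h0 hi ht.le] at ha
      linarith
    filter_upwards [h1.eventually_lt_const h2, eventually_gt_atTop 0] with d hd hd0
    refine lt_of_le_of_lt ?_ hd
    have hint := integrable_log_laplace (hC d) ht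
    calc _ ≤ ∫ x, (-(m * rate γ (s / H)) + t / 2 * s
          + 1 / (d : ℝ) * Real.log (laplace (C d) t x)) ∂gaussianLaw (C d) :=
          integral_mono (integrable_logExp (hC d) hγ hH hm.le) ((integrable_const _).add hint)
            fun x => logExp_le hγ hH hm.le hd0 hs0 ht hteq x
      _ = _ := by
          rw [integral_add (integrable_const _) hint]
          simp

lemma SpectralLimit.tendsto_gMean (hlim : SpectralLimit hC ρC)
    [IsProbabilityMeasure ρC] (hM : ∀ d, (C d).trace ≤ M * d) (hρC : ρC ≠ Measure.dirac 0)
    (hγ : 1 ≤ γ) {h m : ℝ} (hh : 0 < h) (hm : 0 < m) :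
    Tendsto (fun d : ℕ => gMean γ (C d) h m) atTop
      (𝓝 (logExpLimit ρC γ (h ^ 2) m - m * kernelExponent γ - m * Real.log h)) := by
  have h1 := ((hlim.tendsto_integral_logExp hM hρC hγ (show 0 < h ^ 2 by positivity) hm).sub
    ((tendsto_log_kernelMass hγ).const_mul m)).sub_const (m * Real.log h)
  refine h1.congr fun d => ?_
  have hint := integrable_logExp (m := m) (hC d) hγ (show 0 < h ^ 2 by positivity) hm.le
  rw [gMean]
  simp_rw [gFun_eq hγ hh hm.le]
  have hint' : Integrable (fun x => logExp γ (h ^ 2) m (C d) x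
      - m * (1 / (d : ℝ) * Real.log (kernelMass γ d))) (gaussianLaw (C d)) :=
    hint.sub (integrable_const _)
  rw [integral_sub hint' (integrable_const _), integral_sub hint (integrable_const _)]
  simp

lemma SpectralLimit.gBar_eq (hlim : SpectralLimit hC ρC)
    [IsProbabilityMeasure ρC] (hM : ∀ d, (C d).trace ≤ M * d) (hρC : ρC ≠ Measure.dirac 0)
    (hγ : 1 ≤ γ) {h m : ℝ} (hh : 0 < h) (hm : 0 < m) :
    gBar γ C h m = logExpLimit ρC γ (h ^ 2) m - m * kernelExponent γ - m * Real.log h :=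
  (hlim.tendsto_gMean hM hρC hγ hh hm).limUnder_eq

end MeanLimit

/-! ### Derivative of the replica free entropy at `m = 1`. -/

section Glass

variable {M γ : ℝ} {C : ∀ d : ℕ, Matrix (Fin d) (Fin d) ℝ} {hC : ∀ d, (C d).PosDef}
  {ρC : Measure ℝ}

/-- Concavity in `t`: the logarithm lies below its tangent, and the rational part falls short of its
own by an explicit nonnegative remainder. -/
lemma psiFun_le_tangent {t u c : ℝ} (ht : 0 ≤ t) (hu : 0 ≤ u) (hc : 0 ≤ c) :
    psiFun u c ≤ psiFun t c + (u - t) / 2 * lFun t c := by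
  have h1 : 0 < 1 + t * c := by positivity
  have h2 : 0 < 1 + u * c := by positivity
  have h3 := Real.log_le_sub_one_of_pos (div_pos h2 h1)
  rw [Real.log_div h2.ne' h1.ne'] at h3
  have h4 : (1 + u * c) / (1 + t * c) - 1 = (u - t) * (c / (1 + t * c)) := by
    field_simp
    ring
  have h5 : t * c / (1 + t * c) + (u - t) * (c / (1 + t * c) ^ 2) - u * c / (1 + u * c)
      = (u - t) ^ 2 * c ^ 2 / ((1 + t * c) ^ 2 * (1 + u * c)) := by
    field_simp
    ring
  have h6 : 0 ≤ (u - t) ^ 2 * c ^ 2 / ((1 + t * c) ^ 2 * (1 + u * c)) := by positivity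
  unfold psiFun lFun
  linarith

lemma psiOf_le_tangent (h0 : ∀ᵐ c ∂ρC, 0 ≤ c) (hi : Integrable (fun c => c) ρC) {t u : ℝ}
    (ht : 0 ≤ t) (hu : 0 ≤ u) : psiOf ρC u ≤ psiOf ρC t + (u - t) / 2 * lOf ρC t := by
  rw [lOf_eq, ← integral_const_mul, psiOf, psiOf,
    ← integral_add (integrable_psiFun h0 hi ht) ((integrable_lFun h0 hi ht).const_mul _)]
  refine integral_mono_ae (integrable_psiFun h0 hi hu)
    ((integrable_psiFun h0 hi ht).add ((integrable_lFun h0 hi ht).const_mul _)) ?_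
  filter_upwards [h0] with c hc using psiFun_le_tangent ht hu hc

/-- The value at the saddle point for one parameter bounds the value of the limit at any other. -/
lemma le_logExpLimit (h0 : ∀ᵐ c ∂ρC, 0 ≤ c) (hi : Integrable (fun c => c) ρC)
    (hpos : 0 < ρC (Set.Ioi 0)) (hγ : 1 ≤ γ) {H m t : ℝ} (hH : 0 < H) (hm : 0 < m) (ht : 0 < t) :
    -(m * rate γ (lOf ρC t / H)) - alphaOf ρC t ≤ logExpLimit ρC γ H m := by
  obtain ⟨ht', hteq⟩ := tilt_spec h0 hi hpos hγ (show 0 < m / H ^ γ by positivity)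
  rw [logExpLimit]
  set u := tilt ρC γ (m / H ^ γ) with hu
  have h1 := rate_support_scaled hγ hH hm.le (lOf_pos h0 hi hpos ht'.le)
    (lOf_pos h0 hi hpos ht.le).le hteq
  have h2 := psiOf_le_tangent h0 hi ht.le ht'.le
  rw [alphaOf_eq h0 hi ht'.le, alphaOf_eq h0 hi ht.le]
  linarith

/-- Envelope argument. The limit is a maximum over tilts of functions affine in `m` with slope minus
the rate. Using the optimiser at `1` for `m`, and conversely, traps the increment, so continuity of
the tilt suffices and its differentiability is never required. -/
lemma hasDerivAt_logExpLimit (h0 : ∀ᵐ c ∂ρC, 0 ≤ c) (hi : Integrable (fun c => c) ρC)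
    (hpos : 0 < ρC (Set.Ioi 0)) (hγ : 1 ≤ γ) {H : ℝ} (hH : 0 < H) :
    HasDerivAt (logExpLimit ρC γ H) (-rate γ (lOf ρC (tilt ρC γ (1 / H ^ γ)) / H)) 1 := by
  set r : ℝ → ℝ := fun m => rate γ (lOf ρC (tilt ρC γ (m / H ^ γ)) / H) with hr
  have hcont : ContinuousAt r 1 := by
    have hq : 0 < 1 / H ^ γ := by positivity
    have h1 : ContinuousAt (fun m : ℝ => tilt ρC γ (m / H ^ γ)) 1 :=
      ContinuousAt.comp (f := fun m : ℝ => m / H ^ γ) (tilt_continuousAt h0 hi hpos hγ hq)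
        (by fun_prop)
    have h2 : ContinuousAt (lOf ρC) (tilt ρC γ (1 / H ^ γ)) :=
      (lOf_continuousOn h0 hi).continuousAt (Ici_mem_nhds (tilt_spec h0 hi hpos hγ hq).1)
    exact (rate_continuous hγ).continuousAt.comp
      ((ContinuousAt.comp (f := fun m : ℝ => tilt ρC γ (m / H ^ γ)) h2 h1).div_const H)
  rw [hasDerivAt_iff_isLittleO, Asymptotics.isLittleO_iff]
  intro ε hε
  filter_upwards [Metric.tendsto_nhds.1 hcont ε hε, Ioi_mem_nhds (zero_lt_one (α := ℝ))]
    with m hmε hm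
  have hm : 0 < m := hm
  have htm := (tilt_spec h0 hi hpos hγ (show 0 < m / H ^ γ by positivity)).1
  have ht1 := (tilt_spec h0 hi hpos hγ (show 0 < 1 / H ^ γ by positivity)).1
  have e1 := le_logExpLimit h0 hi hpos hγ hH hm ht1
  have e2 := le_logExpLimit h0 hi hpos hγ hH zero_lt_one htm
  have f1 : logExpLimit ρC γ H 1 = -(1 * r 1) - alphaOf ρC (tilt ρC γ (1 / H ^ γ)) := rfl
  have fm : logExpLimit ρC γ H m = -(m * r m) - alphaOf ρC (tilt ρC γ (m / H ^ γ)) := rfl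
  change -(m * r 1) - _ ≤ _ at e1
  change -(1 * r m) - _ ≤ _ at e2
  change ‖logExpLimit ρC γ H m - logExpLimit ρC γ H 1 - (m - 1) • (-r 1)‖ ≤ _
  rw [Real.dist_eq] at hmε
  have h3 : 0 ≤ logExpLimit ρC γ H m - logExpLimit ρC γ H 1 - (m - 1) • (-r 1) := by
    rw [smul_eq_mul]; linarith
  have h4 : logExpLimit ρC γ H m - logExpLimit ρC γ H 1 - (m - 1) • (-r 1)
      ≤ -((m - 1) * (r m - r 1)) := by
    rw [smul_eq_mul]; linarith
  rw [Real.norm_of_nonneg h3]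
  calc _ ≤ -((m - 1) * (r m - r 1)) := h4
    _ ≤ |(m - 1) * (r m - r 1)| := neg_le_abs _
    _ = |r m - r 1| * |m - 1| := by rw [abs_mul, mul_comm]
    _ ≤ ε * ‖m - 1‖ := mul_le_mul_of_nonneg_right hmε.le (abs_nonneg _)

/-- Differentiating `gBar / m` subtracts `gBar` from its derivative; the rate, `kernelExponent` and
`log h` cancel and only the cost at the saddle remains. -/
lemma SpectralLimit.hasDerivAt_replicaFreeEntropy (hlim : SpectralLimit hC ρC)
    [IsProbabilityMeasure ρC] (hM : ∀ d, (C d).trace ≤ M * d) (hρC : ρC ≠ Measure.dirac 0)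
    (hγ : 1 ≤ γ) (α : ℝ) {h : ℝ} (hh : 0 < h) :
    HasDerivAt (fun m => replicaFreeEntropy γ α C h m)
      (alphaOf ρC (tilt ρC γ (1 / (h ^ 2) ^ γ)) - α) 1 := by
  have h0 := hlim.ae_nonneg
  have hi := hlim.integrable_id hM
  have hpos := measure_Ioi_pos h0 hρC
  have hd := hasDerivAt_logExpLimit h0 hi hpos hγ (show 0 < h ^ 2 by positivity)
  have hid := hasDerivAt_id (1 : ℝ)
  have hinv : HasDerivAt (fun m : ℝ => m⁻¹) (-1) 1 := by
    simpa using hasDerivAt_inv (one_ne_zero (α := ℝ))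
  have h1 := ((hid.const_sub 1).mul hinv).mul_const α
  have h2 := hinv.mul ((hd.sub (hid.mul_const (kernelExponent γ))).sub
    (hid.mul_const (Real.log h)))
  refine ((h1.add h2).congr_deriv ?_).congr_of_eventuallyEq ?_
  · simp only [logExpLimit, id, Pi.sub_apply]
    norm_num
    ring
  · filter_upwards [Ioi_mem_nhds (zero_lt_one (α := ℝ))] with m hm
    have hm : 0 < m := hm
    rw [replicaFreeEntropy, hlim.gBar_eq hM hρC hγ hh hm]
    simp [div_eq_mul_inv]

lemma SpectralLimit.glassD_eq (hlim : SpectralLimit hC ρC)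
    [IsProbabilityMeasure ρC] (hM : ∀ d, (C d).trace ≤ M * d) (hρC : ρC ≠ Measure.dirac 0)
    (hγ : 1 ≤ γ) (α : ℝ) {h : ℝ} (hh : 0 < h) :
    glassD γ α C h = alphaOf ρC (tilt ρC γ (1 / (h ^ 2) ^ γ)) - α :=
  (hlim.hasDerivAt_replicaFreeEntropy hM hρC hγ α hh).deriv

end Glass

/-! ### Finiteness and explicit form of the divergence. -/

section KullbackLeibler

variable {γ h : ℝ} {n d : ℕ} {A : Matrix (Fin d) (Fin d) ℝ}

/-- `∑ᵢ exp (-d f(|x - yᵢ|² / (d H)))`. -/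
noncomputable def expSum (γ H : ℝ) {n d : ℕ} (y : Fin n → EuclideanSpace ℝ (Fin d))
    (x : EuclideanSpace ℝ (Fin d)) : ℝ :=
  ∑ i, Real.exp (-(d * rate γ (‖x - y i‖ ^ 2 / d / H)))

lemma expSum_pos {H : ℝ} (hn : 0 < n) (y : Fin n → EuclideanSpace ℝ (Fin d))
    (x : EuclideanSpace ℝ (Fin d)) : 0 < expSum γ H y x :=
  have : Nonempty (Fin n) := ⟨⟨0, hn⟩⟩
  Finset.sum_pos (fun _ _ => Real.exp_pos _) Finset.univ_nonempty

lemma measurable_expSum (hγ : 1 ≤ γ) (H : ℝ) :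
    Measurable fun p : EuclideanSpace ℝ (Fin d) × (Fin n → EuclideanSpace ℝ (Fin d)) =>
      expSum γ H p.2 p.1 := by
  have := (rate_continuous hγ).measurable
  unfold expSum
  fun_prop

lemma log_expSum_le {H : ℝ} (hγ : 1 ≤ γ) (hH : 0 < H) (hn : 0 < n)
    (y : Fin n → EuclideanSpace ℝ (Fin d)) (x : EuclideanSpace ℝ (Fin d)) :
    Real.log (expSum γ H y x) ≤ Real.log n := by
  refine Real.log_le_log (expSum_pos hn y x) ?_
  calc expSum γ H y x ≤ ∑ _ : Fin n, (1 : ℝ) := by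
        refine Finset.sum_le_sum fun i _ => ?_
        rw [Real.exp_le_one_iff]
        have : 0 ≤ d * rate γ (‖x - y i‖ ^ 2 / d / H) :=
          mul_nonneg (Nat.cast_nonneg d) (rate_nonneg hγ (by positivity))
        linarith
    _ = n := by simp

lemma neg_le_log_expSum {H : ℝ} (y : Fin n → EuclideanSpace ℝ (Fin d))
    (x : EuclideanSpace ℝ (Fin d)) (i : Fin n) :
    -(d * rate γ (‖x - y i‖ ^ 2 / d / H)) ≤ Real.log (expSum γ H y x) := by
  rw [Real.le_log_iff_exp_le (expSum_pos i.pos y x)]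
  exact Finset.single_le_sum (f := fun i => Real.exp (-(d * rate γ (‖x - y i‖ ^ 2 / d / H))))
    (fun _ _ => (Real.exp_pos _).le) (Finset.mem_univ i)

/-- Above, every term is at most one; below, a single term suffices. The logarithm is thus dominated
by an integrable power of the norms. -/
lemma abs_log_expSum_le {H : ℝ} (hγ : 1 ≤ γ) (hH : 0 < H)
    (y : Fin n → EuclideanSpace ℝ (Fin d)) (x : EuclideanSpace ℝ (Fin d)) (i : Fin n) :
    |Real.log (expSum γ H y x)| ≤ Real.log n
      + d * (rateConst γ H * ((‖x‖ ^ 2 / d) ^ γ + (‖y i‖ ^ 2 / d) ^ γ)) := by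
  have h1 := log_expSum_le hγ hH i.pos y x
  have h2 := neg_le_log_expSum (γ := γ) (H := H) y x i
  have h3 := mul_le_mul_of_nonneg_left (rate_norm_sub_le hγ hH x (y i)) (Nat.cast_nonneg (α := ℝ) d)
  have h4 : 0 ≤ d * rate γ (‖x - y i‖ ^ 2 / d / H) :=
    mul_nonneg (Nat.cast_nonneg d) (rate_nonneg hγ (by positivity))
  have h5 : 0 ≤ Real.log n := Real.log_natCast_nonneg n
  rw [abs_le]
  constructor <;> linarith

lemma log_kde (hγ : 1 ≤ γ) (hh : 0 < h) (hn : 0 < n) (y : Fin n → EuclideanSpace ℝ (Fin d))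
    (x : EuclideanSpace ℝ (Fin d)) :
    Real.log (kde γ h y x) = Real.log (expSum γ (h ^ 2) y x)
      - (Real.log n + d * Real.log h + Real.log (kernelMass γ d)) := by
  have hn' : (0 : ℝ) < n := by exact_mod_cast hn
  have hI := kernelMass_pos hγ d
  have hS := expSum_pos (γ := γ) (H := h ^ 2) hn y x
  have h1 : kde γ h y x
      = 1 / ((n : ℝ) * h ^ d) * (expSum γ (h ^ 2) y x / kernelMass γ d) := by
    rw [kde, expSum, Finset.sum_div]
    congr 1
    exact Finset.sum_congr rfl fun i _ => by rw [gammaKernel_eq, kernelShape_smul_sub]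
  rw [h1, Real.log_mul (by positivity) (by positivity), Real.log_div hS.ne' hI.ne', one_div,
    Real.log_inv, Real.log_mul hn'.ne' (by positivity), Real.log_pow]
  ring

lemma integrable_log_expSum {H : ℝ} (hA : A.PosDef) (hγ : 1 ≤ γ) (hH : 0 < H) (hn : 0 < n)
    (y : Fin n → EuclideanSpace ℝ (Fin d)) :
    Integrable (fun x => Real.log (expSum γ H y x)) (gaussianLaw A) := by
  refine ((integrable_const (Real.log n)).add ((((integrable_norm_sq_rpow hA hγ).add
    (integrable_const ((‖y ⟨0, hn⟩‖ ^ 2 / d) ^ γ))).const_mul (rateConst γ H)).const_mul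
    (d : ℝ))).mono' ?_ (ae_of_all _ fun x => abs_log_expSum_le hγ hH y x ⟨0, hn⟩)
  exact (Real.measurable_log.comp
    ((measurable_expSum hγ H).comp (by fun_prop : Measurable fun x => (x, y)))).aestronglyMeasurable

lemma integrable_log_kde (hA : A.PosDef) (hγ : 1 ≤ γ) (hh : 0 < h) (hn : 0 < n)
    (y : Fin n → EuclideanSpace ℝ (Fin d)) :
    Integrable (fun x => Real.log (kde γ h y x)) (gaussianLaw A) := by
  simp_rw [log_kde hγ hh hn]
  exact (integrable_log_expSum hA hγ (by positivity) hn y).sub (integrable_const _)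

/-- The law with density the estimator. -/
noncomputable def kdeLaw (γ h : ℝ) {n d : ℕ} (y : Fin n → EuclideanSpace ℝ (Fin d)) :
    Measure (EuclideanSpace ℝ (Fin d)) :=
  volume.withDensity fun x => ENNReal.ofReal (kde γ h y x)

lemma kdeLaw_univ (hγ : 1 ≤ γ) (hh : 0 < h) (hn : 0 < n)
    (y : Fin n → EuclideanSpace ℝ (Fin d)) : kdeLaw γ h y Set.univ = 1 := by
  rw [kdeLaw, withDensity_apply _ MeasurableSet.univ, Measure.restrict_univ,
    ← ofReal_integral_eq_lintegral_ofReal (integrable_kde hγ hh y)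
      (ae_of_all _ fun x => (kde_pos hγ hh hn y x).le), integral_kde hγ hh hn, ENNReal.ofReal_one]

lemma isProbabilityMeasure_kdeLaw (hγ : 1 ≤ γ) (hh : 0 < h) (hn : 0 < n)
    (y : Fin n → EuclideanSpace ℝ (Fin d)) : IsProbabilityMeasure (kdeLaw γ h y) :=
  ⟨kdeLaw_univ hγ hh hn y⟩

lemma measurable_kde (hγ : 1 ≤ γ) (h : ℝ) (y : Fin n → EuclideanSpace ℝ (Fin d)) :
    Measurable (kde γ h y) :=
  ((kde_continuous hγ h).comp (by fun_prop : Continuous fun x => (y, x))).measurable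

lemma gaussianLaw_eq_withDensity_kdeLaw (hA : A.PosDef) (hγ : 1 ≤ γ) (hh : 0 < h) (hn : 0 < n)
    (y : Fin n → EuclideanSpace ℝ (Fin d)) :
    gaussianLaw A = (kdeLaw γ h y).withDensity
      fun x => ENNReal.ofReal (gaussianDensity hA x / kde γ h y x) := by
  have h1 := measurable_kde hγ h y
  have h2 := measurable_gaussianDensity hA
  have h4 : Measurable fun x => ENNReal.ofReal (gaussianDensity hA x / kde γ h y x) :=
    (h2.div h1).ennreal_ofReal
  rw [kdeLaw, ← withDensity_mul _ h1.ennreal_ofReal h4, gaussianLaw_eq_withDensity hA]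
  congr 1
  ext x
  have h3 := kde_pos hγ hh hn y x
  rw [Pi.mul_apply, ← ENNReal.ofReal_mul h3.le, mul_div_cancel₀ _ h3.ne']

lemma gaussianLaw_absolutelyContinuous_kdeLaw (hA : A.PosDef) (hγ : 1 ≤ γ) (hh : 0 < h)
    (hn : 0 < n) (y : Fin n → EuclideanSpace ℝ (Fin d)) : gaussianLaw A ≪ kdeLaw γ h y := by
  rw [gaussianLaw_eq_withDensity_kdeLaw hA hγ hh hn y]
  exact withDensity_absolutelyContinuous _ _

lemma llr_gaussianLaw_kdeLaw (hA : A.PosDef) (hγ : 1 ≤ γ) (hh : 0 < h) (hn : 0 < n)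
    (y : Fin n → EuclideanSpace ℝ (Fin d)) :
    llr (gaussianLaw A) (kdeLaw γ h y) =ᵐ[gaussianLaw A]
      fun x => Real.log (gaussianDensity hA x) - Real.log (kde γ h y x) := by
  have := isProbabilityMeasure_kdeLaw hγ hh hn y
  have h1 := Measure.rnDeriv_withDensity (kdeLaw γ h y)
    ((measurable_gaussianDensity hA).div (measurable_kde hγ h y)).ennreal_ofReal
  have h1' : (gaussianLaw A).rnDeriv (kdeLaw γ h y) =ᵐ[kdeLaw γ h y]
      fun x => ENNReal.ofReal (gaussianDensity hA x / kde γ h y x) := by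
    conv_lhs => rw [gaussianLaw_eq_withDensity_kdeLaw hA hγ hh hn y]
    exact h1
  filter_upwards [(gaussianLaw_absolutelyContinuous_kdeLaw hA hγ hh hn y).ae_le h1'] with x hx
  have h3 := kde_pos hγ hh hn y x
  have h4 := gaussianDensity_pos hA x
  rw [llr, hx, ENNReal.toReal_ofReal (div_pos h4 h3).le, Real.log_div h4.ne' h3.ne']

lemma integrable_llr_gaussianLaw_kdeLaw (hA : A.PosDef) (hγ : 1 ≤ γ) (hh : 0 < h) (hn : 0 < n)
    (y : Fin n → EuclideanSpace ℝ (Fin d)) :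
    Integrable (llr (gaussianLaw A) (kdeLaw γ h y)) (gaussianLaw A) :=
  ((integrable_log_gaussianDensity hA).sub (integrable_log_kde hA hγ hh hn y)).congr
    (llr_gaussianLaw_kdeLaw hA hγ hh hn y).symm

lemma klKde_ne_top (hA : A.PosDef) (hγ : 1 ≤ γ) (hh : 0 < h) (hn : 0 < n)
    (y : Fin n → EuclideanSpace ℝ (Fin d)) : klKde γ h A y ≠ ⊤ :=
  klDiv_ne_top (gaussianLaw_absolutelyContinuous_kdeLaw hA hγ hh hn y)
    (integrable_llr_gaussianLaw_kdeLaw hA hγ hh hn y)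

/-- Both measures have mass one, so the divergence is the integrated log-likelihood ratio. Among the
resulting terms only the last depends on the data. -/
lemma toReal_klKde (hA : A.PosDef) (hγ : 1 ≤ γ) (hh : 0 < h) (hn : 0 < n)
    (y : Fin n → EuclideanSpace ℝ (Fin d)) :
    (klKde γ h A y).toReal
      = -((d : ℝ) / 2) * (Real.log (2 * Real.pi) + 1) - 1 / 2 * traceLog hA
        + (Real.log n + d * Real.log h + Real.log (kernelMass γ d))
        - ∫ x, Real.log (expSum γ (h ^ 2) y x) ∂gaussianLaw A := by
  have := isProbabilityMeasure_kdeLaw hγ hh hn y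
  change (klDiv (gaussianLaw A) (kdeLaw γ h y)).toReal = _
  rw [toReal_klDiv_of_measure_eq (gaussianLaw_absolutelyContinuous_kdeLaw hA hγ hh hn y)
    (by rw [kdeLaw_univ hγ hh hn, measure_univ]),
    integral_congr_ae (llr_gaussianLaw_kdeLaw hA hγ hh hn y),
    integral_sub (integrable_log_gaussianDensity hA) (integrable_log_kde hA hγ hh hn y),
    integral_log_gaussianDensity]
  simp_rw [log_kde hγ hh hn]
  rw [integral_sub (integrable_log_expSum hA hγ (by positivity) hn y) (integrable_const _)]
  simp
  ring

end KullbackLeibler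

/-! ### The random sum: quenched upper bound and the nearest data point. -/

section LogSum

variable {γ H : ℝ} {n d : ℕ} {A : Matrix (Fin d) (Fin d) ℝ}

/-- The joint law of a test point and a data set. -/
noncomputable def jointLaw (n : ℕ) (A : Matrix (Fin d) (Fin d) ℝ) :
    Measure (EuclideanSpace ℝ (Fin d) × (Fin n → EuclideanSpace ℝ (Fin d))) :=
  (gaussianLaw A).prod (dataLaw n A)

instance : IsProbabilityMeasure (jointLaw n A) := by unfold jointLaw; infer_instance

lemma integrable_dataLaw_eval {f : EuclideanSpace ℝ (Fin d) → ℝ}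
    (hf : Integrable f (gaussianLaw A)) (i : Fin n) :
    Integrable (fun y => f (y i)) (dataLaw n A) :=
  integrable_comp_eval (μ := fun _ : Fin n => gaussianLaw A) hf

lemma integral_dataLaw_eval {f : EuclideanSpace ℝ (Fin d) → ℝ}
    (hf : AEStronglyMeasurable f (gaussianLaw A)) (i : Fin n) :
    ∫ y, f (y i) ∂dataLaw n A = ∫ x, f x ∂gaussianLaw A :=
  integral_comp_eval (μ := fun _ : Fin n => gaussianLaw A) hf

/-- The logarithm of a sum of exponentials is dominated at lower inverse temperature. -/
lemma log_sum_exp_le {ι : Type*} [Fintype ι] [Nonempty ι] {θ : ℝ} (hθ0 : 0 < θ) (hθ1 : θ ≤ 1)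
    (u : ι → ℝ) :
    Real.log (∑ i, Real.exp (u i)) ≤ 1 / θ * Real.log (∑ i, Real.exp (θ * u i)) := by
  have hT : 0 < ∑ i, Real.exp (θ * u i) :=
    Finset.sum_pos (fun _ _ => Real.exp_pos _) Finset.univ_nonempty
  -- Each `uᵢ` is at most `L`, hence `e^(uᵢ) ≤ e^((1-θ)L) e^(θuᵢ)`, and the last factors sum to
  -- `e^(θL)`.
  set L := 1 / θ * Real.log (∑ i, Real.exp (θ * u i)) with hL
  have hθL : Real.exp (θ * L) = ∑ i, Real.exp (θ * u i) := by
    rw [hL, ← mul_assoc, mul_one_div_cancel hθ0.ne', one_mul, Real.exp_log hT]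
  have hle : ∀ i, u i ≤ L := by
    intro i
    have h1 : Real.exp (θ * u i) ≤ Real.exp (θ * L) := by
      rw [hθL]
      exact Finset.single_le_sum (f := fun i => Real.exp (θ * u i))
        (fun _ _ => (Real.exp_pos _).le) (Finset.mem_univ i)
    exact le_of_mul_le_mul_left (Real.exp_le_exp.1 h1) hθ0
  rw [Real.log_le_iff_le_exp (Finset.sum_pos (fun _ _ => Real.exp_pos _) Finset.univ_nonempty)]
  calc ∑ i, Real.exp (u i) ≤ ∑ i, Real.exp (L - θ * L) * Real.exp (θ * u i) := by
        refine Finset.sum_le_sum fun i _ => ?_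
        rw [← Real.exp_add, Real.exp_le_exp]
        nlinarith [hle i]
    _ = Real.exp L := by
        rw [← Finset.mul_sum, ← hθL, ← Real.exp_add]; ring_nf

lemma integrable_log_expSum_data (hA : A.PosDef) (hγ : 1 ≤ γ) (hH : 0 < H) (hn : 0 < n)
    (x : EuclideanSpace ℝ (Fin d)) :
    Integrable (fun y => Real.log (expSum γ H y x)) (dataLaw n A) := by
  refine ((integrable_const (Real.log n)).add ((((integrable_const ((‖x‖ ^ 2 / d) ^ γ)).add
    (integrable_dataLaw_eval (integrable_norm_sq_rpow hA hγ) ⟨0, hn⟩)).const_mul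
    (rateConst γ H)).const_mul (d : ℝ))).mono' ?_
    (ae_of_all _ fun y => abs_log_expSum_le hγ hH y x ⟨0, hn⟩)
  exact (Real.measurable_log.comp
    ((measurable_expSum hγ H).comp (by fun_prop : Measurable fun y => (x, y)))).aestronglyMeasurable

lemma integrable_log_expSum_joint (hA : A.PosDef) (hγ : 1 ≤ γ) (hH : 0 < H) (hn : 0 < n) :
    Integrable (fun p => Real.log (expSum γ H p.2 p.1)) (jointLaw n A) := by
  refine ((integrable_const (Real.log n)).add
    (((((integrable_norm_sq_rpow hA hγ).comp_fst (dataLaw n A)).add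
    ((integrable_dataLaw_eval (integrable_norm_sq_rpow hA hγ) ⟨0, hn⟩).comp_snd
      (gaussianLaw A))).const_mul
    (rateConst γ H)).const_mul (d : ℝ))).mono' ?_
    (ae_of_all _ fun p => abs_log_expSum_le hγ hH p.2 p.1 ⟨0, hn⟩)
  exact (Real.measurable_log.comp (measurable_expSum hγ H)).aestronglyMeasurable

/-- The annealed upper bound at the inverse temperature `θ`. -/
lemma integral_log_expSum_data_le (hA : A.PosDef) (hγ : 1 ≤ γ) (hH : 0 < H) (hn : 0 < n)
    (hd : 0 < d) {θ s t : ℝ} (hθ0 : 0 < θ) (hθ1 : θ ≤ 1) (hs : 0 < s) (ht : 0 < t)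
    (hst : t = θ / H ^ γ * s ^ (γ - 1)) (x : EuclideanSpace ℝ (Fin d)) :
    ∫ y, Real.log (expSum γ H y x) ∂dataLaw n A
      ≤ 1 / θ * (-(d * (θ * rate γ (s / H) - t / 2 * s)) + Real.log n
        + Real.log (laplace A t x)) := by
  have hd' : (0 : ℝ) < d := by exact_mod_cast hd
  have hn' : (0 : ℝ) < n := by exact_mod_cast hn
  have : Nonempty (Fin n) := ⟨⟨0, hn⟩⟩
  have hZ := laplace_pos A ht.le x
  set e : (Fin n → EuclideanSpace ℝ (Fin d)) → ℝ :=
    fun y => ∑ i, Real.exp (-(t / 2 * ‖x - y i‖ ^ 2)) with he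
  have hei : ∀ i ∈ Finset.univ, Integrable (fun y : Fin n → EuclideanSpace ℝ (Fin d) =>
      Real.exp (-(t / 2 * ‖x - y i‖ ^ 2))) (dataLaw n A) := fun i _ =>
    integrable_dataLaw_eval (integrable_exp_neg_sq_dist A ht.le x) i
  have heint : Integrable e (dataLaw n A) := integrable_finsetSum _ hei
  have hemean : ∫ y, e y ∂dataLaw n A = n * laplace A t x := by
    simp only [he]
    rw [integral_finsetSum _ hei]
    have : ∀ i : Fin n, ∫ y, Real.exp (-(t / 2 * ‖x - y i‖ ^ 2)) ∂dataLaw n A = laplace A t x :=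
      fun i => integral_dataLaw_eval (f := fun z => Real.exp (-(t / 2 * ‖x - z‖ ^ 2)))
        (integrable_exp_neg_sq_dist A ht.le x).aestronglyMeasurable i
    simp [this]
  -- The tangent to the logarithm at the mean of `e`; integrating it yields `𝔼 log ≤ log 𝔼`.
  have hpt : ∀ y, Real.log (expSum γ H y x)
      ≤ 1 / θ * ((-(d * (θ * rate γ (s / H) - t / 2 * s)) + Real.log n
        + Real.log (laplace A t x) - 1) + (n * laplace A t x)⁻¹ * e y) := by
    intro y
    refine (log_sum_exp_le hθ0 hθ1 _).trans (mul_le_mul_of_nonneg_left ?_ (by positivity))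
    have he0 : 0 < e y := Finset.sum_pos (fun _ _ => Real.exp_pos _) Finset.univ_nonempty
    have h1 : ∑ i, Real.exp (θ * -(d * rate γ (‖x - y i‖ ^ 2 / d / H)))
        ≤ Real.exp (-(d * (θ * rate γ (s / H) - t / 2 * s))) * e y := by
      rw [he, Finset.mul_sum]
      refine Finset.sum_le_sum fun i _ => ?_
      rw [← Real.exp_add, Real.exp_le_exp]
      have h1 := rate_support_scaled hγ hH hθ0.le hs
        (show 0 ≤ ‖x - y i‖ ^ 2 / d by positivity) hst
      have h2 := mul_le_mul_of_nonneg_left h1 hd'.le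
      have h3 : (d : ℝ) * (θ * rate γ (s / H) + t / 2 * (‖x - y i‖ ^ 2 / d - s))
          = d * (θ * rate γ (s / H) - t / 2 * s) + t / 2 * ‖x - y i‖ ^ 2 := by
        field_simp
        ring
      linarith
    have h2 := Real.log_le_log
      (Finset.sum_pos (fun _ _ => Real.exp_pos _) Finset.univ_nonempty) h1
    rw [Real.log_mul (Real.exp_pos _).ne' he0.ne', Real.log_exp] at h2
    have h3 := Real.log_le_sub_one_of_pos
      (show 0 < (n * laplace A t x)⁻¹ * e y by positivity)
    rw [Real.log_mul (by positivity) he0.ne', Real.log_inv, Real.log_mul hn'.ne' hZ.ne'] at h3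
    linarith
  calc _ ≤ ∫ y, 1 / θ * ((-(d * (θ * rate γ (s / H) - t / 2 * s)) + Real.log n
        + Real.log (laplace A t x) - 1) + (n * laplace A t x)⁻¹ * e y) ∂dataLaw n A :=
        integral_mono (integrable_log_expSum_data hA hγ hH hn x)
          (((integrable_const _).add (heint.const_mul _)).const_mul _) hpt
    _ = _ := by
        rw [integral_const_mul, integral_add (integrable_const _) (heint.const_mul _),
          integral_const_mul, hemean, inv_mul_cancel₀ (by positivity)]
        simp

/-- The event that no data point is close to the test point. -/
def farEvent (n d : ℕ) (b : ℝ) :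
    Set (EuclideanSpace ℝ (Fin d) × (Fin n → EuclideanSpace ℝ (Fin d))) :=
  {p | ∀ i, d * b < ‖p.1 - p.2 i‖ ^ 2}

lemma measurableSet_farEvent (n d : ℕ) (b : ℝ) : MeasurableSet (farEvent n d b) := by
  unfold farEvent
  rw [Set.ofPred_forall]
  exact MeasurableSet.iInter fun i => measurableSet_lt (by fun_prop) (by fun_prop)

/-- By independence all points miss the ball with probability at most `(1-q)^n ≤ e^(-nq)`. -/
lemma dataLaw_far_le (x : EuclideanSpace ℝ (Fin d)) {b q : ℝ}
    (hq : q ≤ (gaussianLaw A).real {y | ‖x - y‖ ^ 2 ≤ d * b}) :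
    dataLaw n A (Prod.mk x ⁻¹' farEvent n d b) ≤ ENNReal.ofReal (Real.exp (-(n * q))) := by
  set S : Set (EuclideanSpace ℝ (Fin d)) := {y | ‖x - y‖ ^ 2 ≤ d * b} with hS
  have hSm : MeasurableSet S := measurableSet_le (by fun_prop) (by fun_prop)
  have h1 : Prod.mk x ⁻¹' farEvent n d b = Set.univ.pi fun _ : Fin n => Sᶜ := by
    ext y
    simp [farEvent, hS]
  rw [h1, dataLaw, Measure.pi_pi, Finset.prod_const, Finset.card_univ, Fintype.card_fin]
  have h2 : gaussianLaw A Sᶜ ≤ ENNReal.ofReal (Real.exp (-q)) := by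
    rw [← ofReal_measureReal, probReal_compl_eq_one_sub hSm]
    refine ENNReal.ofReal_le_ofReal ?_
    have := Real.add_one_le_exp (-q)
    linarith
  calc _ ≤ ENNReal.ofReal (Real.exp (-q)) ^ n := by gcongr
    _ = _ := by
        rw [← ENNReal.ofReal_pow (Real.exp_pos _).le, ← Real.exp_nat_mul]
        congr 2
        ring

lemma jointLaw_farEvent_le {b q : ℝ} {B : Set (EuclideanSpace ℝ (Fin d))} (hB : MeasurableSet B)
    (hq : ∀ x ∉ B, q ≤ (gaussianLaw A).real {y | ‖x - y‖ ^ 2 ≤ d * b}) :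
    (jointLaw n A).real (farEvent n d b) ≤ (gaussianLaw A).real B + Real.exp (-(n * q)) := by
  have h1 : jointLaw n A (farEvent n d b)
      ≤ gaussianLaw A B + ENNReal.ofReal (Real.exp (-(n * q))) := by
    rw [jointLaw, Measure.prod_apply (measurableSet_farEvent n d b)]
    calc _ ≤ ∫⁻ x, (B.indicator 1 x + ENNReal.ofReal (Real.exp (-(n * q)))) ∂gaussianLaw A := by
          refine lintegral_mono fun x => ?_
          by_cases hx : x ∈ B
          · rw [Set.indicator_of_mem hx]
            exact prob_le_one.trans le_self_add
          · rw [Set.indicator_of_notMem hx, zero_add]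
            exact dataLaw_far_le x (hq x hx)
      _ = _ := by
          rw [lintegral_add_right _ measurable_const, lintegral_indicator_one hB]
          simp
  rw [measureReal_def]
  refine (ENNReal.toReal_mono (by finiteness) h1).trans ?_
  rw [ENNReal.toReal_add (by finiteness) (by finiteness), ENNReal.toReal_ofReal (Real.exp_pos _).le,
    measureReal_def]

end LogSum

/-! ### Concentration on the nearest point and the limit of the divergence. -/

section Convergence

variable {M γ α : ℝ} {n : ℕ → ℕ} {C : ∀ d : ℕ, Matrix (Fin d) (Fin d) ℝ} {hC : ∀ d, (C d).PosDef}
  {ρC : Measure ℝ}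

/-- An integrable bound for the energy of the first data point. -/
noncomputable def energyBound (γ H : ℝ) {n d : ℕ} (hn : 0 < n)
    (p : EuclideanSpace ℝ (Fin d) × (Fin n → EuclideanSpace ℝ (Fin d))) : ℝ :=
  rateConst γ H * ((‖p.1‖ ^ 2 / d) ^ γ + (‖p.2 ⟨0, hn⟩‖ ^ 2 / d) ^ γ)

lemma energyBound_nonneg {H : ℝ} (hγ : 1 ≤ γ) (hH : 0 < H) {n d : ℕ} (hn : 0 < n)
    (p : EuclideanSpace ℝ (Fin d) × (Fin n → EuclideanSpace ℝ (Fin d))) :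
    0 ≤ energyBound γ H hn p := by
  have := rateConst_nonneg hγ hH
  unfold energyBound
  positivity

lemma integrable_energyBound (hγ : 1 ≤ γ) (H : ℝ) {n d : ℕ} (hn : 0 < n)
    {A : Matrix (Fin d) (Fin d) ℝ} (hA : A.PosDef) :
    Integrable (energyBound γ H hn) (jointLaw n A) :=
  (((integrable_norm_sq_rpow hA hγ).comp_fst (dataLaw n A)).add
    ((integrable_dataLaw_eval (integrable_norm_sq_rpow hA hγ) ⟨0, hn⟩).comp_snd
      (gaussianLaw A))).const_mul (rateConst γ H)

lemma integrable_energyBound_sq_majorant (hγ : 1 ≤ γ) {n d : ℕ} (hn : 0 < n)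
    {A : Matrix (Fin d) (Fin d) ℝ} (hA : A.PosDef) :
    Integrable (fun p : EuclideanSpace ℝ (Fin d) × (Fin n → EuclideanSpace ℝ (Fin d)) =>
      ((‖p.1‖ ^ 2 / d) ^ γ) ^ 2 + ((‖p.2 ⟨0, hn⟩‖ ^ 2 / d) ^ γ) ^ 2) (jointLaw n A) :=
  ((integrable_rpow_sq hA hγ).comp_fst (dataLaw n A)).add
    ((integrable_dataLaw_eval (integrable_rpow_sq hA hγ) ⟨0, hn⟩).comp_snd (gaussianLaw A))

lemma energyBound_sq_le {H : ℝ} {n d : ℕ} (hn : 0 < n)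
    (p : EuclideanSpace ℝ (Fin d) × (Fin n → EuclideanSpace ℝ (Fin d))) :
    energyBound γ H hn p ^ 2 ≤ 2 * rateConst γ H ^ 2 *
      (((‖p.1‖ ^ 2 / d) ^ γ) ^ 2 + ((‖p.2 ⟨0, hn⟩‖ ^ 2 / d) ^ γ) ^ 2) := by
  rw [energyBound, mul_pow, mul_comm 2, mul_assoc]
  refine mul_le_mul_of_nonneg_left ?_ (sq_nonneg _)
  nlinarith [sq_nonneg ((‖p.1‖ ^ 2 / d) ^ γ - (‖p.2 ⟨0, hn⟩‖ ^ 2 / d) ^ γ)]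

lemma integrable_energyBound_sq (hγ : 1 ≤ γ) (H : ℝ) {n d : ℕ} (hn : 0 < n)
    {A : Matrix (Fin d) (Fin d) ℝ} (hA : A.PosDef) :
    Integrable (fun p => energyBound γ H hn p ^ 2) (jointLaw n A) := by
  refine ((integrable_energyBound_sq_majorant hγ hn hA).const_mul (2 * rateConst γ H ^ 2)).mono'
    ((integrable_energyBound hγ H hn hA).aestronglyMeasurable.pow 2) (ae_of_all _ fun p => ?_)
  rw [Real.norm_of_nonneg (sq_nonneg _)]
  exact energyBound_sq_le hn p

lemma integral_energyBound_sq_le (hγ : 1 ≤ γ) (H : ℝ) (hC : ∀ d, (C d).PosDef)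
    (hM : ∀ d, (C d).trace ≤ M * d) {n d : ℕ} (hn : 0 < n) :
    ∫ p, energyBound γ H hn p ^ 2 ∂jointLaw n (C d)
      ≤ 2 * rateConst γ H ^ 2 * (2 * (|M| ^ (γ * 2) * stdMoment (γ * 2))) := by
  refine (integral_mono (integrable_energyBound_sq hγ H hn (hC d))
    ((integrable_energyBound_sq_majorant hγ hn (hC d)).const_mul _)
    fun p => energyBound_sq_le hn p).trans ?_
  rw [integral_const_mul]
  refine mul_le_mul_of_nonneg_left ?_ (by positivity)
  have h1 := integrable_rpow_sq (hC d) hγ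
  have h2 := integrable_dataLaw_eval h1 (⟨0, hn⟩ : Fin n)
  have e1 := integral_fun_fst (μ := gaussianLaw (C d)) (ν := dataLaw n (C d))
    (fun x => ((‖x‖ ^ 2 / d) ^ γ) ^ 2)
  have e2 := integral_fun_snd (μ := gaussianLaw (C d)) (ν := dataLaw n (C d))
    (fun y => ((‖y ⟨0, hn⟩‖ ^ 2 / d) ^ γ) ^ 2)
  have e3 := integral_dataLaw_eval h1.aestronglyMeasurable (⟨0, hn⟩ : Fin n)
  simp only [probReal_univ, one_smul] at e1 e2
  rw [jointLaw, integral_add (h1.comp_fst (dataLaw n (C d))) (h2.comp_snd (gaussianLaw (C d))),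
    e1, e2, e3]
  have := integral_rpow_sq_le hC hγ hM d
  linarith

/-- By continuity a tilt slightly below `l₀` still reaches distances below `b`, at a cost strictly
less than `α`. The expected number of data points in the ball then grows exponentially. -/
lemma SpectralLimit.tendsto_farEvent (hlim : SpectralLimit hC ρC) [IsProbabilityMeasure ρC]
    (hM : ∀ d, (C d).trace ≤ M * d) (hρC : ρC ≠ Measure.dirac 0)
    (hnα : Tendsto (fun d : ℕ => Real.log (n d) / d) atTop (𝓝 α)) (hn : ∀ d, 0 < n d)
    {l₀ b : ℝ} (hl₀ : 0 < l₀) (hα : alphaOf ρC l₀ = α) (hb : lOf ρC l₀ < b) :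
    Tendsto (fun d => (jointLaw (n d) (C d)).real (farEvent (n d) d b)) atTop (𝓝 0) := by
  have h0 := hlim.ae_nonneg
  have hi := hlim.integrable_id hM
  have hpos := measure_Ioi_pos h0 hρC
  have hcont : ContinuousAt (lOf ρC) l₀ :=
    (lOf_continuousOn h0 hi).continuousAt (Ici_mem_nhds hl₀)
  have hnear := (hcont.eventually_lt_const hb).and (eventually_gt_nhds hl₀)
  obtain ⟨t, ⟨htb, ht0⟩, htl⟩ := ((hnear.filter_mono nhdsWithin_le_nhds).and
    (self_mem_nhdsWithin : ∀ᶠ t in 𝓝[<] l₀, t < l₀)).exists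
  have hαt : alphaOf ρC t < α := by
    rw [← hα]
    exact alphaOf_strictMonoOn h0 hi hpos (Set.mem_Ici.2 ht0.le) (Set.mem_Ici.2 hl₀.le) htl
  set δ := (α - alphaOf ρC t) / 2 with hδ
  have hδ0 : 0 < δ := by rw [hδ]; linarith
  obtain ⟨B, hBm, hB0, hB⟩ := hlim.small_ball hM ht0 (sub_pos.2 htb) hδ0
  simp only [add_sub_cancel] at hB
  have hexp : Tendsto (fun d : ℕ =>
      Real.exp (-((n d : ℝ) * Real.exp (-(d * (alphaOf ρC t + δ)))))) atTop (𝓝 0) := by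
    refine Real.tendsto_exp_atBot.comp (tendsto_neg_atTop_atBot.comp ?_)
    have h1 : Tendsto (fun d : ℕ => Real.exp (d * (Real.log (n d) / d - (alphaOf ρC t + δ))))
        atTop atTop := by
      refine Real.tendsto_exp_atTop.comp (Tendsto.atTop_mul_pos (C := δ) hδ0
        tendsto_natCast_atTop_atTop ?_)
      have := hnα.sub_const (alphaOf ρC t + δ)
      rwa [show α - (alphaOf ρC t + δ) = δ by rw [hδ]; ring] at this
    refine h1.congr' ?_
    filter_upwards [eventually_gt_atTop 0] with d hd
    have hd' : (0 : ℝ) < d := by exact_mod_cast hd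
    have hn' : (0 : ℝ) < n d := by exact_mod_cast hn d
    rw [mul_sub, mul_div_cancel₀ _ hd'.ne', sub_eq_add_neg, Real.exp_add, Real.exp_log hn']
  have hsum := hB0.add hexp
  rw [add_zero] at hsum
  refine squeeze_zero' (Eventually.of_forall fun d => measureReal_nonneg) ?_ hsum
  filter_upwards [hB] with d hd
  exact jointLaw_farEvent_le (hBm d) hd

/-- In the glassy phase the normalised logarithm of the sum over the data concentrates on the
energy of the nearest data point. -/
lemma SpectralLimit.tendsto_integral_abs_log_expSum (hlim : SpectralLimit hC ρC)
    [IsProbabilityMeasure ρC]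
    (hM : ∀ d, (C d).trace ≤ M * d) (hρC : ρC ≠ Measure.dirac 0) (hγ : 1 ≤ γ)
    (hnα : Tendsto (fun d : ℕ => Real.log (n d) / d) atTop (𝓝 α)) (hn : ∀ d, 0 < n d)
    {l₀ H θ : ℝ} (hl₀ : 0 < l₀) (hα : alphaOf ρC l₀ = α) (hH : 0 < H) (hθ0 : 0 < θ) (hθ1 : θ ≤ 1)
    (hθ : l₀ = θ / H ^ γ * lOf ρC l₀ ^ (γ - 1)) :
    Tendsto (fun d : ℕ => ∫ p, |1 / (d : ℝ) * Real.log (expSum γ H p.2 p.1)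
      + rate γ (lOf ρC l₀ / H)| ∂jointLaw (n d) (C d)) atTop (𝓝 0) := by
  have h0 := hlim.ae_nonneg
  have hi := hlim.integrable_id hM
  have hpos := measure_Ioi_pos h0 hρC
  set l := lOf ρC l₀ with hl
  have hl0 : 0 < l := lOf_pos h0 hi hpos hl₀.le
  set f₀ := rate γ (l / H) with hf₀
  have hint : ∀ d : ℕ, Integrable (fun p => 1 / (d : ℝ) * Real.log (expSum γ H p.2 p.1))
      (jointLaw (n d) (C d)) := fun d =>
    (integrable_log_expSum_joint (hC d) hγ hH (hn d)).const_mul _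
  have hupper : ∀ ε > 0, ∀ᶠ d : ℕ in atTop,
      ∫ p, 1 / (d : ℝ) * Real.log (expSum γ H p.2 p.1) ∂jointLaw (n d) (C d) < -f₀ + ε := by
    intro ε hε
    have h1 := (((hnα.const_add (-(θ * f₀ - l₀ / 2 * l))).add
      (hlim.tendsto_integral_log_laplace hM hl₀)).const_mul (1 / θ))
    -- With `α = psiOf - (l₀/2) l` everything except the rate cancels, so the factor `1/θ` costs
    -- nothing.
    have h2 : 1 / θ * (-(θ * f₀ - l₀ / 2 * l) + α + -psiOf ρC l₀) = -f₀ := by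
      rw [← hα, alphaOf_eq h0 hi hl₀.le, ← hl]
      field_simp
      ring
    rw [h2] at h1
    filter_upwards [h1.eventually_lt_const (show -f₀ < -f₀ + ε by linarith), eventually_gt_atTop 0]
      with d hd hd0
    refine lt_of_le_of_lt ?_ hd
    have hd' : (0 : ℝ) < d := by exact_mod_cast hd0
    have hli := integrable_log_laplace (hC d) hl₀
    have hjoint := integrable_log_expSum_joint (hC d) hγ hH (hn d)
    have hlap : Integrable (fun x => Real.log (laplace (C d) l₀ x)) (gaussianLaw (C d)) := by
      refine (hli.const_mul (d : ℝ)).congr (ae_of_all _ fun x => ?_)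
      simp only
      rw [← mul_assoc, mul_one_div_cancel hd'.ne', one_mul]
    rw [integral_const_mul, integral_const_mul, jointLaw, integral_prod _ hjoint]
    calc _ ≤ 1 / (d : ℝ) * ∫ x, 1 / θ * (-(d * (θ * f₀ - l₀ / 2 * l))
          + Real.log (n d) + Real.log (laplace (C d) l₀ x)) ∂gaussianLaw (C d) := by
          refine mul_le_mul_of_nonneg_left (integral_mono hjoint.integral_prod_left
            (((integrable_const _).add hlap).const_mul _) fun x => ?_) (by positivity)
          exact integral_log_expSum_data_le (hC d) hγ hH (hn d) hd0 hθ0 hθ1 hl0 hl₀ hθ x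
      _ = _ := by
          rw [integral_const_mul, integral_add (integrable_const _) hlap]
          simp only [integral_const, probReal_univ, one_smul]
          field_simp
  rw [tendsto_order]
  refine ⟨fun a ha => Eventually.of_forall fun d =>
    ha.trans_le (integral_nonneg fun p => abs_nonneg _), fun a ha => ?_⟩
  -- The final budget is `ε` for the mean, `2ε` for the shift and `2ε` for the far event, below `8ε
  -- = a`.
  set ε := a / 8 with hε
  have hε0 : 0 < ε := by positivity
  obtain ⟨b, hbl, hb⟩ : ∃ b, l < b ∧ rate γ (b / H) < f₀ + ε := by
    have hcont : ContinuousAt (fun b => rate γ (b / H)) l := by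
      have := rate_continuous hγ
      exact Continuous.continuousAt (by fun_prop)
    obtain ⟨b, hb1, hb2⟩ := (((hcont.eventually_lt_const
      (show rate γ (l / H) < f₀ + ε by linarith)).filter_mono nhdsWithin_le_nhds).and
      (self_mem_nhdsWithin : ∀ᶠ b in 𝓝[>] l, l < b)).exists
    exact ⟨b, hb2, hb1⟩
  have hfar := tendsto_setIntegral_of_sq_bounded (μ := fun d => jointLaw (n d) (C d))
    (f := fun d => energyBound γ H (hn d))
    (fun d => integrable_energyBound hγ H (hn d) (hC d))
    (fun d => integrable_energyBound_sq hγ H (hn d) (hC d))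
    (fun d p => energyBound_nonneg hγ hH (hn d) p)
    (fun d => integral_energyBound_sq_le hγ H hC hM (hn d))
    (hlim.tendsto_farEvent hM hρC hnα hn hl₀ hα hbl)
  filter_upwards [hupper ε hε0, hfar.eventually_lt_const hε0, eventually_gt_atTop 0]
    with d hd1 hd2 hd0
  have hd' : (0 : ℝ) < d := by exact_mod_cast hd0
  have hind : Integrable ((farEvent (n d) d b).indicator (energyBound γ H (hn d)))
      (jointLaw (n d) (C d)) :=
    (integrable_energyBound hγ H (hn d) (hC d)).indicator (measurableSet_farEvent _ _ _)
  have hlow : ∀ (p : EuclideanSpace ℝ (Fin d) × (Fin (n d) → EuclideanSpace ℝ (Fin d))) i,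
      -rate γ (‖p.1 - p.2 i‖ ^ 2 / d / H) ≤ 1 / (d : ℝ) * Real.log (expSum γ H p.2 p.1) := by
    intro p i
    have h1 := mul_le_mul_of_nonneg_left (neg_le_log_expSum (γ := γ) (H := H) p.2 p.1 i)
      (show 0 ≤ 1 / (d : ℝ) by positivity)
    rwa [mul_neg, ← mul_assoc, one_div_mul_cancel hd'.ne', one_mul] at h1
  -- From `|Z| = Z + 2Z⁻`: the negative part is at most `ε` when some point is near and at most the
  -- energy bound otherwise. An upper bound on the mean therefore yields `L¹` convergence.
  have hpt : ∀ p, |1 / (d : ℝ) * Real.log (expSum γ H p.2 p.1) + f₀|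
      ≤ (1 / (d : ℝ) * Real.log (expSum γ H p.2 p.1) + (f₀ + 2 * ε))
        + 2 * (farEvent (n d) d b).indicator (energyBound γ H (hn d)) p := by
    intro p
    have hf₀nn : 0 ≤ f₀ := rate_nonneg hγ (by positivity)
    by_cases hp : p ∈ farEvent (n d) d b
    · rw [Set.indicator_of_mem hp]
      have h1 := hlow p ⟨0, hn d⟩
      have h2 := rate_norm_sub_le hγ hH p.1 (p.2 ⟨0, hn d⟩)
      have h3 := energyBound_nonneg hγ hH (hn d) p
      change _ ≤ energyBound γ H (hn d) p at h2
      rw [abs_le]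
      constructor <;> linarith
    · rw [Set.indicator_of_notMem hp]
      simp only [farEvent, Set.mem_ofPred_eq, not_forall, not_lt] at hp
      obtain ⟨i, hi⟩ := hp
      have h1 := hlow p i
      have h2 : rate γ (‖p.1 - p.2 i‖ ^ 2 / d / H) ≤ rate γ (b / H) := by
        refine rate_mono hγ (by positivity) ?_
        gcongr
        rw [div_le_iff₀ hd', mul_comm]
        exact hi
      rw [abs_le]
      constructor <;> linarith
  have hcint : Integrable (fun p => 1 / (d : ℝ) * Real.log (expSum γ H p.2 p.1) + (f₀ + 2 * ε))
      (jointLaw (n d) (C d)) := (hint d).add (integrable_const _)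
  have h5 := integral_mono (((hint d).add (integrable_const f₀)).abs)
    (hcint.add (hind.const_mul 2)) hpt
  have h6 : ∫ p, ((1 / (d : ℝ) * Real.log (expSum γ H p.2 p.1) + (f₀ + 2 * ε))
        + 2 * (farEvent (n d) d b).indicator (energyBound γ H (hn d)) p) ∂jointLaw (n d) (C d)
      = ∫ p, 1 / (d : ℝ) * Real.log (expSum γ H p.2 p.1) ∂jointLaw (n d) (C d) + (f₀ + 2 * ε)
        + 2 * ∫ p in farEvent (n d) d b, energyBound γ H (hn d) p ∂jointLaw (n d) (C d) := by
    rw [integral_add hcint (hind.const_mul 2), integral_add (hint d) (integrable_const _),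
      integral_const_mul, integral_const_mul 2, integral_indicator (measurableSet_farEvent _ _ _)]
    simp
  have h7 := h5.trans_eq h6
  refine lt_of_le_of_lt h7 ?_
  linarith

/-- The asymptotic value of the divergence per dimension. -/
noncomputable def klValue {d : ℕ} {A : Matrix (Fin d) (Fin d) ℝ} (hA : A.PosDef)
    (γ α h l : ℝ) : ℝ :=
  α - 1 / (2 * (d : ℝ)) * traceLog hA + 1 / 2 * Real.log 1 - rate γ 1 + Real.log h
    + rate γ (l / h ^ 2)

/-- The log-determinant and `log h` cancel, and the Gaussian entropy is absorbed by
`kernelExponent`. What remains is a deterministic error and the deviation of the log-sum. -/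
lemma klKde_sub_klValue {h l : ℝ} {d m : ℕ} {A : Matrix (Fin d) (Fin d) ℝ} (hA : A.PosDef)
    (hγ : 1 ≤ γ) (hh : 0 < h) (hm : 0 < m) (hd : 0 < d)
    (y : Fin m → EuclideanSpace ℝ (Fin d)) :
    1 / (d : ℝ) * (klKde γ h A y).toReal - klValue hA γ α h l
      = (Real.log m / d - α + (1 / (d : ℝ) * Real.log (kernelMass γ d) - kernelExponent γ))
        - ∫ x, (1 / (d : ℝ) * Real.log (expSum γ (h ^ 2) y x) + rate γ (l / h ^ 2))
          ∂gaussianLaw A := by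
  have hd' : (0 : ℝ) < d := by exact_mod_cast hd
  have hint := integrable_log_expSum hA hγ (show 0 < h ^ 2 by positivity) hm y
  have hr : rate γ 1 = 1 / (2 * γ) := by simp [rate]
  rw [toReal_klKde hA hγ hh hm, klValue, integral_add (hint.const_mul _) (integrable_const _),
    integral_const_mul, kernelExponent, hr]
  simp only [integral_const, probReal_univ, one_smul, Real.log_one]
  field_simp
  ring

lemma eLpNorm_klKde_sub_le {h l : ℝ} {d m : ℕ} {A : Matrix (Fin d) (Fin d) ℝ} (hA : A.PosDef)
    (hγ : 1 ≤ γ) (hh : 0 < h) (hm : 0 < m) (hd : 0 < d) :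
    eLpNorm (fun y : Fin m → EuclideanSpace ℝ (Fin d) =>
        1 / (d : ℝ) * (klKde γ h A y).toReal - klValue hA γ α h l) 1 (dataLaw m A)
      ≤ ENNReal.ofReal (|Real.log m / d - α
          + (1 / (d : ℝ) * Real.log (kernelMass γ d) - kernelExponent γ)|
        + ∫ p, |1 / (d : ℝ) * Real.log (expSum γ (h ^ 2) p.2 p.1) + rate γ (l / h ^ 2)|
          ∂jointLaw m A) := by
  set K := |Real.log m / d - α + (1 / (d : ℝ) * Real.log (kernelMass γ d) - kernelExponent γ)|
    with hK
  have hjoint : Integrable (fun p : EuclideanSpace ℝ (Fin d) × (Fin m → EuclideanSpace ℝ (Fin d)) =>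
      |1 / (d : ℝ) * Real.log (expSum γ (h ^ 2) p.2 p.1) + rate γ (l / h ^ 2)|)
      ((gaussianLaw A).prod (dataLaw m A)) :=
    (((integrable_log_expSum_joint hA hγ (show 0 < h ^ 2 by positivity) hm).const_mul _).add
      (integrable_const _)).abs
  rw [eLpNorm_one_eq_lintegral_enorm, jointLaw, integral_prod_symm _ hjoint]
  have hmean : K + ∫ y, ∫ x, |1 / (d : ℝ) * Real.log (expSum γ (h ^ 2) y x) + rate γ (l / h ^ 2)|
        ∂gaussianLaw A ∂dataLaw m A
      = ∫ y, (K + ∫ x, |1 / (d : ℝ) * Real.log (expSum γ (h ^ 2) y x) + rate γ (l / h ^ 2)|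
        ∂gaussianLaw A) ∂dataLaw m A := by
    rw [integral_add (integrable_const _) hjoint.integral_prod_right]
    simp
  have hKint : Integrable (fun y => K + ∫ x, |1 / (d : ℝ) * Real.log (expSum γ (h ^ 2) y x)
      + rate γ (l / h ^ 2)| ∂gaussianLaw A) (dataLaw m A) :=
    (integrable_const _).add hjoint.integral_prod_right
  simp only at hmean ⊢
  rw [hmean, ofReal_integral_eq_lintegral_ofReal hKint (ae_of_all _ fun y =>
      add_nonneg (abs_nonneg _) (integral_nonneg fun x => abs_nonneg _))]
  refine lintegral_mono fun y => ?_
  rw [Real.enorm_eq_ofReal_abs, klKde_sub_klValue hA hγ hh hm hd]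
  refine ENNReal.ofReal_le_ofReal ((abs_sub _ _).trans ?_)
  exact add_le_add le_rfl abs_integral_le_integral_abs

lemma SpectralLimit.tendsto_eLpNorm_klKde (hlim : SpectralLimit hC ρC)
    [IsProbabilityMeasure ρC]
    (hM : ∀ d, (C d).trace ≤ M * d) (hρC : ρC ≠ Measure.dirac 0) (hγ : 1 ≤ γ)
    (hnα : Tendsto (fun d : ℕ => Real.log (n d) / d) atTop (𝓝 α)) (hn : ∀ d, 0 < n d)
    {l₀ h θ : ℝ} (hl₀ : 0 < l₀) (hα : alphaOf ρC l₀ = α) (hh : 0 < h) (hθ0 : 0 < θ) (hθ1 : θ ≤ 1)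
    (hθ : l₀ = θ / (h ^ 2) ^ γ * lOf ρC l₀ ^ (γ - 1)) :
    Tendsto (fun d : ℕ => eLpNorm (fun y : Fin (n d) → EuclideanSpace ℝ (Fin d) =>
        1 / (d : ℝ) * (klKde γ h (C d) y).toReal - klValue (hC d) γ α h (lOf ρC l₀)) 1
        (dataLaw (n d) (C d))) atTop (𝓝 0) := by
  have h1 := ((hnα.sub_const α).add ((tendsto_log_kernelMass hγ).sub_const
    (kernelExponent γ))).abs.add (hlim.tendsto_integral_abs_log_expSum hM hρC hγ hnα hn hl₀ hα
      (show 0 < h ^ 2 by positivity) hθ0 hθ1 hθ)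
  simp only [sub_self, add_zero, abs_zero] at h1
  have h2 := ENNReal.tendsto_ofReal h1
  rw [ENNReal.ofReal_zero] at h2
  refine tendsto_of_tendsto_of_tendsto_of_le_of_le' tendsto_const_nhds h2
    (Eventually.of_forall fun d => zero_le) ?_
  filter_upwards [eventually_gt_atTop 0] with d hd
  exact eLpNorm_klKde_sub_le (hC d) hγ hh (hn d) hd

end Convergence

/-! ### The critical bandwidth in closed form. -/

section GlassTransition

variable {γ : ℝ} {ρC : Measure ℝ}

/-- The bandwidth at which the saddle point of the estimator has tilt `t`. -/
noncomputable def glassBandwidth (ρC : Measure ℝ) (γ t : ℝ) : ℝ :=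
  (lOf ρC t ^ (γ - 1) / t) ^ (1 / (2 * γ))

lemma rpow_glassBandwidth (hγ : 1 ≤ γ) {t : ℝ} (ht : 0 < t) (hl : 0 < lOf ρC t) :
    (glassBandwidth ρC γ t ^ 2) ^ γ = lOf ρC t ^ (γ - 1) / t := by
  have hpos : 0 < lOf ρC t ^ (γ - 1) / t := by positivity
  rw [glassBandwidth, ← Real.rpow_natCast, ← Real.rpow_mul (by positivity),
    ← Real.rpow_mul hpos.le]
  have : 1 / (2 * γ) * (((2 : ℕ) : ℝ) * γ) = 1 := by
    have : γ ≠ 0 := by linarith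
    push_cast
    field_simp
  rw [this, Real.rpow_one]

lemma sq_rpow_lt_iff (hγ : 1 ≤ γ) {h k : ℝ} (hh : 0 < h) (hk : 0 < k) :
    (h ^ 2) ^ γ < (k ^ 2) ^ γ ↔ h < k := by
  rw [Real.rpow_lt_rpow_iff (by positivity) (by positivity) (by linarith),
    pow_lt_pow_iff_left₀ hh.le hk.le two_ne_zero]

lemma sq_rpow_inj (hγ : 1 ≤ γ) {h k : ℝ} (hh : 0 < h) (hk : 0 < k) :
    (h ^ 2) ^ γ = (k ^ 2) ^ γ ↔ h = k := by
  rw [Real.rpow_left_inj (by positivity) (by positivity) (by linarith),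
    pow_left_inj₀ hh.le hk.le two_ne_zero]

end GlassTransition

end HighDimKDE

/-! ### Assembly of the result. -/

theorem proposition12
    (γ α M : ℝ) (hγ : 1 ≤ γ) (hα : 0 < α)
    (n : ℕ → ℕ) (hn : ∀ d, 0 < n d)
    (hnα : Tendsto (fun d : ℕ => Real.log (n d) / d) atTop (𝓝 α))
    (C : ∀ d : ℕ, Matrix (Fin d) (Fin d) ℝ) (hC : ∀ d, (C d).PosDef)
    (hM : ∀ d, (C d).trace ≤ M * d)
    (ρC : Measure ℝ) [IsProbabilityMeasure ρC] (hρC : ρC ≠ Measure.dirac 0)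
    (hlim : HighDimKDE.SpectralLimit hC ρC) :
    -- the replica free entropy is well defined, and differentiable at `m = 1`
    (∀ h m : ℝ, 0 < h → 0 < m →
      ∃ L, Tendsto (fun d : ℕ => HighDimKDE.gMean γ (C d) h m) atTop (𝓝 L)) ∧
    (∀ h : ℝ, 0 < h →
      DifferentiableAt ℝ (fun m => HighDimKDE.replicaFreeEntropy γ α C h m) 1) ∧
    ∃ hG lhat ustar : ℝ, 0 < hG ∧ 0 < lhat ∧ 0 < ustar ∧
      -- `hG` is the unique solution of `D(α, h) = 0`
      (∀ h : ℝ, 0 < h → (HighDimKDE.glassD γ α C h = 0 ↔ h = hG)) ∧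
      -- `lhat` is the unique positive solution of its equation
      (∀ t : ℝ, 0 < t → (α = HighDimKDE.alphaOf ρC t ↔ t = lhat)) ∧
      -- `ustar` is the unique positive solution of `2 u f'(u) = 1`
      (∀ u : ℝ, 0 < u → (2 * u * deriv (HighDimKDE.rate γ) u = 1 ↔ u = ustar)) ∧
      ∀ h : ℝ, 0 < h → h < hG →
        (∀ (d : ℕ) (y : Fin (n d) → EuclideanSpace ℝ (Fin d)),
          HighDimKDE.klKde γ h (C d) y ≠ ⊤) ∧
        Tendsto
          (fun d : ℕ => eLpNorm
            (fun y : Fin (n d) → EuclideanSpace ℝ (Fin d) =>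
              1 / (d : ℝ) * (HighDimKDE.klKde γ h (C d) y).toReal
                - (α - 1 / (2 * (d : ℝ)) * HighDimKDE.traceLog (hC d)
                  + 1 / 2 * Real.log ustar - HighDimKDE.rate γ ustar
                  + Real.log h
                  + HighDimKDE.rate γ (HighDimKDE.lOf ρC lhat / h ^ 2)))
            1 (HighDimKDE.dataLaw (n d) (C d)))
          atTop (𝓝 0) := by
  have h0 := hlim.ae_nonneg
  have hi := hlim.integrable_id hM
  have hpos := HighDimKDE.measure_Ioi_pos h0 hρC
  refine ⟨fun h m hh hm => ⟨_, hlim.tendsto_gMean hM hρC hγ hh hm⟩,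
    fun h hh => (hlim.hasDerivAt_replicaFreeEntropy hM hρC hγ α hh).differentiableAt, ?_⟩
  obtain ⟨lhat, hlhat, hαl⟩ := HighDimKDE.exists_alphaOf_eq h0 hi hpos hα
  have hmono := HighDimKDE.alphaOf_strictMonoOn h0 hi hpos
  have hl := HighDimKDE.lOf_pos h0 hi hpos hlhat.le
  have hlγ : 0 < HighDimKDE.lOf ρC lhat ^ (γ - 1) := Real.rpow_pos_of_pos hl _
  set hG := HighDimKDE.glassBandwidth ρC γ lhat with hGdef
  have hG0 : 0 < hG := Real.rpow_pos_of_pos (div_pos hlγ hlhat) _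
  have hGγ : (hG ^ 2) ^ γ = HighDimKDE.lOf ρC lhat ^ (γ - 1) / lhat :=
    HighDimKDE.rpow_glassBandwidth hγ hlhat hl
  -- The third witness is `u* = 1`, because `2 u f'(u) = u^γ`.
  refine ⟨hG, lhat, 1, hG0, hlhat, one_pos, fun h hh => ?_, fun t ht => ?_, fun u hu => ?_,
    fun h hh hhG => ⟨fun d y => HighDimKDE.klKde_ne_top (hC d) hγ hh (hn d) y, ?_⟩⟩
  · have hq : 0 < 1 / (h ^ 2) ^ γ := by positivity
    -- Strict monotonicity of `alphaOf` turns `D = 0` into equality of the saddle with `lhat`, an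
    -- equation that determines `h^(2γ)`.
    rw [hlim.glassD_eq hM hρC hγ α hh, sub_eq_zero, ← hαl,
      hmono.eq_iff_eq (Set.mem_Ici.2 (HighDimKDE.tilt_spec h0 hi hpos hγ hq).1.le)
        (Set.mem_Ici.2 hlhat.le), HighDimKDE.tilt_eq_iff h0 hi hpos hγ hq hlhat,
      ← HighDimKDE.sq_rpow_inj hγ hh hG0, hGγ, one_div_mul_eq_div,
      eq_div_iff (by positivity), eq_div_iff hlhat.ne', mul_comm]
  · rw [← hαl, hmono.eq_iff_eq (Set.mem_Ici.2 hlhat.le) (Set.mem_Ici.2 ht.le), eq_comm]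
  · rw [HighDimKDE.two_mul_deriv_rate hγ hu, HighDimKDE.rpow_eq_one_iff_of_one_le hγ hu]
  · have hlt := (HighDimKDE.sq_rpow_lt_iff hγ hh hG0).2 hhG
    rw [hGγ, lt_div_iff₀ hlhat] at hlt
    -- This `θ` equals `(h/hG)^(2γ)`: it makes `lhat` solve the saddle equation at bandwidth `h`,
    -- and `h < hG` gives `θ ≤ 1`.
    refine hlim.tendsto_eLpNorm_klKde hM hρC hγ hnα hn hlhat hαl hh
      (θ := lhat * (h ^ 2) ^ γ / HighDimKDE.lOf ρC lhat ^ (γ - 1)) (by positivity) ?_ ?_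
    · rw [div_le_one hlγ]
      linarith
    · have : 0 < (h ^ 2) ^ γ := by positivity
      field_simp
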